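/- **Theorem 1.3.** Let $\mathcal A=\{a_1,\dots,a_m\}$, and let $G$ be a group generated by elements $a_1,\dots,a_m$. *Definitions.* Words are finite sequences of letters in $\mathcal A^{\pm1}=\mathcal A\cup\mathcal A^{-1}$ (not necessarily reduced). The word problem for $G$ is the problem to decide whether a given word over $\mathcal A^{\pm1}$ represents the identity of $G$. A presentation $\langle a_1,\dots,a_m\,\|\,\mathcal R\rangle$ for $G$ is given by a (possibly infinite) set $\mathcal R$ of nonempty cyclically reduced words over $\mathcal A^{\pm1}$ whose normal closure $\langle\langle\mathcal R\rangle\rangle$ in the free group $F(\mathcal A)$ is the kernel of the natural homomorphism $F(\mathcal A)\to G$. A van Kampen diagram over it is a finite, connected and simply connected planar 2-complex $\Delta$ whose oriented edges are labelled by letters of $\mathcal A^{\pm 1}$, mutually inverse oriented edges having inverse labels, such that the boundary of each 2-cell reads, from a suitable starting point, a word of $\mathcal R$ or the inverse of one. For a word $W$ that represents an element of $\langle\langle\mathcal R\rangle\rangle$, let $L_1(W)$ be the minimal number of edges of a van Kampen diagram whose boundary path is labelled by the cyclic word $W$. The Dehn 1-function is $$f_1(x)=\max\{\,L_1(W)\mid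 W\in\langle\langle\mathcal R\rangle\rangle,\ |W|\le x\,\}\qquad(x\ge1).$$ *Statement.* The word problem for $G$ is in **NP** (that is, it can be solved in nondeterministic polynomial time) if and only if there is a presentation $\langle a_1,\dots,a_m\,\|\,\mathcal R\rangle$ for $G$ such that 1. its Dehn 1-function $f_1$ is bounded from above by a polynomial, and 2. the problem to decide whether a word over $\mathcal A^{\pm1}$ belongs to $\mathcal R$ is in **NP**. The same equivalence holds with **PSPACE** (decision problems solvable in polynomial space) in place of **NP**, in both places. -/

import Mathlib

/-! ## Machines and complexity classes -/

/-- A nondeterministic multi-stack Turing machine with input alphabet `α`. Statements (push, peek,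
pop, load, branch, goto, halt) and their execution are Mathlib's `Turing.TM2`; here every label has
a finite list of statements, one of which is chosen at each step, and the sets of stacks, of stack
symbols (for every stack), of labels and of internal states are all finite. -/
structure StackMachine (α : Type) where
  /-- the index set of the stacks -/
  K : Type
  [decEqK : DecidableEq K]
  [fintypeK : Fintype K]
  /-- the alphabet of each stack -/
  Γ : K → Type
  [finiteΓ : ∀ k, Finite (Γ k)]
  /-- the labels (control states) -/
  Λ : Type
  [finiteΛ : Finite Λ]
  /-- the internal states (a finite memory) -/
  σ : Type
  [finiteσ : Finite σ]
  /-- the stack that holds the input -/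
  inputStack : K
  /-- the input alphabet is a part of the alphabet of the input stack -/
  inputSymbol : α ↪ Γ inputStack
  /-- the initial label -/
  main : Λ
  /-- the initial internal state -/
  start : σ
  /-- the finitely many possible moves at each label -/
  program : Λ → List (Turing.TM2.Stmt Γ Λ σ)
  /-- the internal states in which halting means acceptance -/
  acceptStates : Set σ

namespace StackMachine

attribute [instance] StackMachine.decEqK StackMachine.fintypeK StackMachine.finiteΓ
  StackMachine.finiteΛ StackMachine.finiteσ

variable {α : Type} (M : StackMachine α)

/-- Configurations; a configuration has halted if its label is `none`. -/
abbrev Config : Type := Turing.TM2.Cfg M.Γ M.Λ M.σ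

/-- The initial configuration: the input is on the input stack with its first letter on top, all
other stacks are empty. -/
def initial (w : List α) : M.Config :=
  ⟨some M.main, M.start, Function.update (fun _ => []) M.inputStack (w.map M.inputSymbol)⟩

/-- One computation step: run one of the statements that belong to the current label. -/
def Step (c c' : M.Config) : Prop :=
  ∃ l, c.l = some l ∧ ∃ q ∈ M.program l, c' = Turing.TM2.stepAux q c.var c.stk

/-- `M.ReachesIn n c c'`: some computation of exactly `n` steps leads from `c` to `c'`. -/
def ReachesIn : ℕ → M.Config → M.Config → Prop
  | 0, c, c' => c = c'
  | n + 1, c, c' => ∃ d, M.Step c d ∧ ReachesIn n d c'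

/-- Some computation leads from `c` to `c'`. -/
def Reaches (c c' : M.Config) : Prop := ∃ n, M.ReachesIn n c c'

/-- The configuration has halted. -/
def Halted (c : M.Config) : Prop := c.l = none

/-- The configuration has halted in an accepting state. -/
def Accepting (c : M.Config) : Prop := M.Halted c ∧ c.var ∈ M.acceptStates

/-- `M` accepts `w` if some computation on input `w` accepts. -/
def Accepts (w : List α) : Prop := ∃ c, M.Reaches (M.initial w) c ∧ M.Accepting c

/-- Some computation on input `w` accepts after at most `t` steps. -/
def AcceptsWithin (t : ℕ) (w : List α) : Prop :=
  ∃ n ≤ t, ∃ c, M.ReachesIn n (M.initial w) c ∧ M.Accepting c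

/-- The machine is deterministic: it has exactly one possible move at each label. -/
def IsDeterministic : Prop := ∀ l, ∃ q, M.program l = [q]

/-- The space used by a configuration: the number of symbols on all stacks. -/
def space (c : M.Config) : ℕ := ∑ k, (c.stk k).length

end StackMachine

/-- The class **NP**: the language is accepted by a nondeterministic machine that has, on each
word `w` of the language, an accepting computation with at most `p (|w|)` steps, where `p` is a
polynomial. -/
def InNP {α : Type} (L : Set (List α)) : Prop :=
  ∃ (M : StackMachine α) (p : Polynomial ℕ),
    (∀ w, w ∈ L ↔ M.Accepts w) ∧ ∀ w ∈ L, M.AcceptsWithin (p.eval w.length) w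

/-- The class **PSPACE**: the language is decided by a deterministic machine that halts on every
word `w` and uses space at most `p (|w|)` on it, where `p` is a polynomial. -/
def InPSPACE {α : Type} (L : Set (List α)) : Prop :=
  ∃ (M : StackMachine α) (p : Polynomial ℕ), M.IsDeterministic ∧
    (∀ w, ∃ c, M.Reaches (M.initial w) c ∧ M.Halted c) ∧
    (∀ w c, M.Reaches (M.initial w) c → M.space c ≤ p.eval w.length) ∧
    ∀ w, w ∈ L ↔ M.Accepts w

/-! ## Words and presentations -/

/-- Words over `α ∪ α⁻¹`, not necessarily reduced; `(x, true)` is the letter `x` and `(x, false)`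
is the letter `x⁻¹`, as in Mathlib's `FreeGroup`. -/
abbrev GroupWord (α : Type) : Type := List (α × Bool)

/-- The normal closure, in the free group on `α`, of a set of words. -/
def relatorClosure {α : Type} (R : Set (GroupWord α)) : Subgroup (FreeGroup α) :=
  Subgroup.normalClosure (FreeGroup.mk '' R)

/-- The word problem of the group `G` with respect to the family `a`: the set of all words that
represent the identity. -/
def wordProblem {α : Type} {G : Type*} [Group G] (a : α → G) : Set (GroupWord α) :=
  {w | FreeGroup.lift a (FreeGroup.mk w) = 1}

/-- `⟨α ‖ R⟩` is a presentation of the group `G` on the generators `a`: the relators are nonempty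
cyclically reduced words, the family `a` generates `G`, and the kernel of the natural homomorphism
from the free group to `G` is the normal closure of `R`. -/
structure IsPresentation {α : Type} {G : Type*} [Group G] (a : α → G)
    (R : Set (GroupWord α)) : Prop where
  nonempty : ∀ r ∈ R, r ≠ []
  cyclicallyReduced : ∀ r ∈ R, FreeGroup.IsCyclicallyReduced r
  generates : Subgroup.closure (Set.range a) = ⊤
  ker_eq : (FreeGroup.lift a).ker = relatorClosure R

/-! ## Van Kampen diagrams -/

/-- The label of an oriented edge whose positive orientation has the label `x`: it is `x` for the
positive orientation `true` and `x⁻¹` for the negative orientation `false`. -/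
def orientedLabel {α : Type} (x : α × Bool) : Bool → α × Bool
  | true => x
  | false => (x.1, !x.2)

/-- A van Kampen diagram over `⟨α ‖ R⟩`, i.e. a finite, connected and simply connected planar
2-complex with edges labelled by letters, each of whose 2-cells reads a relator or the inverse of a
relator along its boundary.

The planar complex is given by its combinatorial map. The edges `e : E` are oriented
by a Boolean: `(e, true)` and `(e, false)` are the two oriented edges of `e`, inverse to each other.
The complex is drawn on the oriented sphere, where its complement is one further face, the outer
face `none : Option F`. Each oriented edge lies on the boundary of exactly one face (the one on its
left), and `next` is the next oriented edge on the boundary of this face. Rotating around a vertex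
is `d ↦ next d⁻¹`, and the oriented edges that start at a vertex form one orbit of the rotation.
The surface obtained in this way is connected, and it is the sphere by Euler's formula
`|V| - |E| + (|F| + 1) = 2`. The diagram with one vertex and no edges is included. -/
structure VanKampenDiagram {α : Type} (R : Set (GroupWord α)) where
  /-- the 0-cells -/
  V : Type
  /-- the (unoriented) 1-cells -/
  E : Type
  /-- the 2-cells -/
  F : Type
  [fintypeV : Fintype V]
  [fintypeE : Fintype E]
  [fintypeF : Fintype F]
  /-- the label of the positively oriented edge -/
  label : E → α × Bool
  /-- the starting vertex of an oriented edge -/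
  origin : E × Bool → V
  /-- the next oriented edge on the boundary of the face on the left -/
  next : Equiv.Perm (E × Bool)
  /-- the boundary path of each face, read from some starting point; `none` is the outer face -/
  boundary : Option F → List (E × Bool)
  /-- each oriented edge is on the boundary of exactly one face, and occurs there once -/
  boundary_nodup : ∀ f, (boundary f).Nodup
  boundary_unique : ∀ d, ∃! f, d ∈ boundary f
  /-- each boundary path is closed, with successive edges related by `next` -/
  boundary_next : ∀ f, (boundary f).map next = (boundary f).rotate 1
  /-- if there are edges at all, then the outer face has a boundary edge -/
  outer_nonempty : Nonempty E → boundary none ≠ []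
  /-- two oriented edges start at the same vertex iff rotating around it takes one to the other -/
  origin_eq_iff : ∀ d d', origin d = origin d' ↔ ∃ n : ℕ, (fun x => next (x.1, !x.2))^[n] d = d'
  /-- the complex is nonempty and connected -/
  nonempty_vertices : Nonempty V
  connected : ∀ u v, Relation.ReflTransGen
    (fun x y => ∃ d : E × Bool, origin d = x ∧ origin (d.1, !d.2) = y) u v
  /-- Euler's formula for the sphere, with the outer face counted -/
  euler : Fintype.card V + (Fintype.card F + 1) = Fintype.card E + 2
  /-- each 2-cell reads, from a suitable starting point, a relator or the inverse of a relator -/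
  relator : ∀ f : F, ∃ r ∈ R,
    (boundary (some f)).map (fun d => orientedLabel (label d.1) d.2) = r ∨
    (boundary (some f)).map (fun d => orientedLabel (label d.1) d.2) = FreeGroup.invRev r

namespace VanKampenDiagram

attribute [instance] VanKampenDiagram.fintypeV VanKampenDiagram.fintypeE
  VanKampenDiagram.fintypeF

variable {α : Type} {R : Set (GroupWord α)} (Δ : VanKampenDiagram R)

/-- The label of an oriented edge: inverse oriented edges have inverse labels. -/
def dartLabel (d : Δ.E × Bool) : α × Bool := orientedLabel (Δ.label d.1) d.2

/-- The label of the boundary path of the diagram. Its starting point is an arbitrary one, so the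
diagrams with boundary label `W` are those whose boundary is labelled by the cyclic word `W`. -/
def boundaryLabel : GroupWord α := (Δ.boundary none).map Δ.dartLabel

/-- The number of 1-cells. -/
def numEdges : ℕ := Fintype.card Δ.E

end VanKampenDiagram

/-! ## The Dehn 1-function -/

/-- The minimal number of edges of a van Kampen diagram over `⟨α ‖ R⟩` with boundary label `W`
(and `⊤` if there is no such diagram). -/
noncomputable def minEdges {α : Type} (R : Set (GroupWord α)) (W : GroupWord α) : ℕ∞ :=
  ⨅ (Δ : VanKampenDiagram R) (_ : Δ.boundaryLabel = W), (Δ.numEdges : ℕ∞)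

/-- The Dehn 1-function of `⟨α ‖ R⟩`: the maximum of `minEdges R W` over all words `W` of length at
most `x` that represent an element of the normal closure of `R`. -/
noncomputable def dehnOne {α : Type} (R : Set (GroupWord α)) (x : ℕ) : ℕ∞ :=
  ⨆ (W : GroupWord α) (_ : FreeGroup.mk W ∈ relatorClosure R) (_ : W.length ≤ x), minEdges R W

/-- The function is bounded from above by a polynomial on the positive integers. -/
def PolynomiallyBounded (f : ℕ → ℕ∞) : Prop :=
  ∃ p : Polynomial ℕ, ∀ x, 1 ≤ x → f x ≤ (p.eval x : ℕ)

/-! From the word problem to a presentation. Take as relators all nonempty cyclically reduced words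
that represent the identity (`cyclicRelators`). The Dehn 1-function is then at most `x`: a trivial
word is either cyclically reduced, hence empty or the boundary of a single polygon, or it has a
cyclic conjugate `x x⁻¹ V`, and then a hair is attached to a diagram for the shorter word `V`
(`exists_diagram`). This set of relators is the word problem intersected with a regular language, so
a preliminary scan of the input by a finite automaton keeps it in the same complexity class
(`InNP.inter_accepts`, `InPSPACE.inter_accepts`).

From a presentation to the word problem. A diagram is cut open by merging its faces with the outer
face one at a time, each time removing an edge between them; every removal splits one conjugate of a
relator or of its inverse off the boundary label (`Merged.exists_products`). Once all faces are
merged, Euler's formula shows that the remaining connected graph is a tree, and the closed paths in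
a tree have freely trivial labels. Hence a trivial word is freely equal to a product of polynomially
many conjugates, with relators and conjugators of polynomial length.

The nondeterministic machine `guess` multiplies its input by the inverses of such conjugates, runs
the given machine for the relators on each relator it has guessed, and cancels inverse letters. The
invariant `Guess.Inv` shows that only trivial words are accepted, and `Guess.cost_accept` bounds the
cost of an accepting computation. If the cost is the number of steps, this settles **NP**
(`InNP.of_products`).

For **PSPACE** the test of a relator may take more than polynomial time, so only the steps at which
there is a choice are charged (`choiceCost`). As the machine for the relators is now deterministic
and always halts, the number of choices is polynomial, the space is polynomial in the input length
and the number of choices, and the forced stretches between choices end. A machine with these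
properties is simulated deterministically by `search`, which runs through all choice strings of a
fixed polynomial length by counting, and reuses the space for every string (`InPSPACE.of_choices`).
-/

/-! ## Polynomially bounded functions -/

/-- The function is bounded from above by a polynomial with natural coefficients. -/
def PolyBdd (f : ℕ → ℕ) : Prop := ∃ p : Polynomial ℕ, ∀ n, f n ≤ p.eval n

theorem Polynomial.eval_mono_nat (p : Polynomial ℕ) : Monotone fun n : ℕ => p.eval n := by
  intro a b h
  simp only [Polynomial.eval_eq_sum_range]
  gcongr

namespace PolyBdd

theorem const (c : ℕ) : PolyBdd fun _ => c := ⟨Polynomial.C c, by simp⟩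

theorem id : PolyBdd fun n => n := ⟨Polynomial.X, by simp⟩

theorem add {f g : ℕ → ℕ} (hf : PolyBdd f) (hg : PolyBdd g) : PolyBdd fun n => f n + g n := by
  obtain ⟨p, hp⟩ := hf
  obtain ⟨q, hq⟩ := hg
  exact ⟨p + q, fun n => by simpa using add_le_add (hp n) (hq n)⟩

theorem mul {f g : ℕ → ℕ} (hf : PolyBdd f) (hg : PolyBdd g) : PolyBdd fun n => f n * g n := by
  obtain ⟨p, hp⟩ := hf
  obtain ⟨q, hq⟩ := hg
  exact ⟨p * q, fun n => by simpa using Nat.mul_le_mul (hp n) (hq n)⟩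

theorem pow {f : ℕ → ℕ} (hf : PolyBdd f) (k : ℕ) : PolyBdd fun n => f n ^ k := by
  obtain ⟨p, hp⟩ := hf
  exact ⟨p ^ k, fun n => by simpa using Nat.pow_le_pow_left (hp n) k⟩

theorem eval_comp (p : Polynomial ℕ) {f : ℕ → ℕ} (hf : PolyBdd f) :
    PolyBdd fun n => p.eval (f n) := by
  obtain ⟨q, hq⟩ := hf
  exact ⟨p.comp q, fun n => by simpa using p.eval_mono_nat (hq n)⟩

/-- Bounds of this shape can be laid out in unary by `search`: the length of a string is multiplied
`k` times by a counter of length `n + C + 1`. -/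
theorem exists_pow {f : ℕ → ℕ} (hf : PolyBdd f) : ∃ C k : ℕ, ∀ n, f n ≤ (n + C + 1) ^ k := by
  obtain ⟨p, hp⟩ := hf
  suffices h : ∃ C k : ℕ, ∀ n, p.eval n ≤ (n + C + 1) ^ k by
    obtain ⟨C, k, h⟩ := h
    exact ⟨C, k, fun n => (hp n).trans (h n)⟩
  clear hp
  induction p using Polynomial.induction_on' with
  | add p q hp hq =>
    obtain ⟨C, k, h⟩ := hp
    obtain ⟨C', k', h'⟩ := hq
    -- The extra 1 in the constant makes the base at least 2, so one further factor absorbs the sum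
    -- of two equal powers.
    refine ⟨C + C' + 1, max k k' + 1, fun n => ?_⟩
    have h1 : (n + C + 1) ^ k ≤ (n + (C + C' + 1) + 1) ^ (max k k') :=
      (Nat.pow_le_pow_left (by omega) _).trans (Nat.pow_le_pow_right (by omega) (le_max_left _ _))
    have h2 : (n + C' + 1) ^ k' ≤ (n + (C + C' + 1) + 1) ^ (max k k') :=
      (Nat.pow_le_pow_left (by omega) _).trans (Nat.pow_le_pow_right (by omega) (le_max_right _ _))
    calc (p + q).eval n = p.eval n + q.eval n := by simp
      _ ≤ (n + (C + C' + 1) + 1) ^ (max k k') + (n + (C + C' + 1) + 1) ^ (max k k') :=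
        add_le_add ((h n).trans h1) ((h' n).trans h2)
      _ = (n + (C + C' + 1) + 1) ^ (max k k') * 2 := by ring
      _ ≤ _ := by rw [pow_succ]; exact Nat.mul_le_mul_left _ (by omega)
  | monomial k c =>
    refine ⟨c, k + 1, fun n => ?_⟩
    rw [Polynomial.eval_monomial, pow_succ, mul_comm]
    exact Nat.mul_le_mul (Nat.pow_le_pow_left (by omega) _) (by omega)

end PolyBdd

namespace StackMachine

open Turing.TM2

variable {α : Type} (M : StackMachine α)

/-! ## Computations -/

/-- Some computation from `c` accepts. -/
def AcceptsFrom (c : M.Config) : Prop := ∃ d, M.Reaches c d ∧ M.Accepting d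

theorem accepts_iff_acceptsFrom (w : List α) : M.Accepts w ↔ M.AcceptsFrom (M.initial w) := Iff.rfl

variable {M}

theorem Reaches.refl (c : M.Config) : M.Reaches c c := ⟨0, rfl⟩

theorem Reaches.head {c d e : M.Config} (h : M.Step c d) (h' : M.Reaches d e) : M.Reaches c e := by
  obtain ⟨n, hn⟩ := h'
  exact ⟨n + 1, d, h, hn⟩

theorem Reaches.cases_head {c e : M.Config} (h : M.Reaches c e) :
    c = e ∨ ∃ d, M.Step c d ∧ M.Reaches d e := by
  obtain ⟨_ | n, hn⟩ := h
  · exact .inl hn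
  · obtain ⟨d, hd, hn⟩ := hn
    exact .inr ⟨d, hd, n, hn⟩

theorem ReachesIn.trans {m n : ℕ} {c d e : M.Config} (h : M.ReachesIn m c d)
    (h' : M.ReachesIn n d e) : M.ReachesIn (m + n) c e := by
  induction m generalizing c with
  | zero => cases h; simpa using h'
  | succ m ih =>
    obtain ⟨x, hx, h⟩ := h
    rw [Nat.succ_add]
    exact ⟨x, hx, ih h⟩

theorem Reaches.trans {c d e : M.Config} (h : M.Reaches c d) (h' : M.Reaches d e) :
    M.Reaches c e := by
  obtain ⟨m, hm⟩ := h
  obtain ⟨n, hn⟩ := h'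
  exact ⟨_, hm.trans hn⟩

theorem Reaches.tail {c d e : M.Config} (h : M.Reaches c d) (h' : M.Step d e) :
    M.Reaches c e := h.trans (.head h' (.refl e))

theorem step_iff {l : M.Λ} {v : M.σ} {S : ∀ k, List (M.Γ k)} {d : M.Config} :
    M.Step ⟨some l, v, S⟩ d ↔ ∃ q ∈ M.program l, d = stepAux q v S := by
  simp [Step]

theorem step_iff_of_program_eq {l : M.Λ} {q : Stmt M.Γ M.Λ M.σ} (hq : M.program l = [q])
    {v : M.σ} {S : ∀ k, List (M.Γ k)} {d : M.Config} :
    M.Step ⟨some l, v, S⟩ d ↔ d = stepAux q v S := by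
  simp [step_iff, hq]

theorem Halted.not_step {c d : M.Config} (h : M.Halted c) : ¬ M.Step c d := by
  rintro ⟨l, hl, -⟩
  simp [Halted] at h
  simp [h] at hl

theorem Halted.eq_of_reaches {c d : M.Config} (h : M.Halted c) (h' : M.Reaches c d) : d = c := by
  obtain h' | ⟨_, hs, -⟩ := h'.cases_head
  · exact h'.symm
  · exact (h.not_step hs).elim

theorem Halted.acceptsFrom_iff {c : M.Config} (h : M.Halted c) :
    M.AcceptsFrom c ↔ c.var ∈ M.acceptStates := by
  constructor
  · rintro ⟨d, hd, -, hv⟩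
    rwa [h.eq_of_reaches hd] at hv
  · exact fun hv => ⟨c, .refl c, h, hv⟩

variable (M) in
/-- A forced computation of `n` steps from `c` to `d` whose configurations before `d` use space at
most `B`: at each of them there is exactly one possible move. -/
inductive DetRun (B : ℕ) : ℕ → M.Config → M.Config → Prop
  | refl (c : M.Config) : DetRun B 0 c c
  | step {n : ℕ} {l : M.Λ} {q : Stmt M.Γ M.Λ M.σ} {v : M.σ} {S : ∀ k, List (M.Γ k)} {d : M.Config}
      (hq : M.program l = [q]) (hB : M.space ⟨some l, v, S⟩ ≤ B)
      (h : DetRun B n (stepAux q v S) d) : DetRun B (n + 1) ⟨some l, v, S⟩ d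

namespace DetRun

variable {B B' m n : ℕ} {c d e : M.Config}

theorem trans (h : M.DetRun B m c d) (h' : M.DetRun B n d e) : M.DetRun B (m + n) c e := by
  induction h with
  | refl => simpa using h'
  | step hq hB _ ih =>
    rw [Nat.succ_add]
    exact .step hq hB (ih h')

theorem mono (hB : B ≤ B') (h : M.DetRun B n c d) : M.DetRun B' n c d := by
  induction h with
  | refl => exact .refl _
  | step hq h1 _ ih => exact .step hq (h1.trans hB) ih

theorem reachesIn (h : M.DetRun B n c d) : M.ReachesIn n c d := by
  induction h with
  | refl => rfl
  | step hq _ _ ih => exact ⟨_, (step_iff_of_program_eq hq).2 rfl, ih⟩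

theorem reaches (h : M.DetRun B n c d) : M.Reaches c d := ⟨n, h.reachesIn⟩

/-- As every move on the run is forced, whatever is reachable from `c` lies on the run, where `B`
applies, or beyond its end. -/
theorem space_le_or_reaches (h : M.DetRun B n c d) (h' : M.Reaches c e) :
    M.space e ≤ B ∨ M.Reaches d e := by
  induction h with
  | refl => exact .inr h'
  | step hq hB _ ih =>
    obtain rfl | ⟨x, hx, h'⟩ := h'.cases_head
    · exact .inl hB
    · rw [(step_iff_of_program_eq hq).1 hx] at h'
      exact ih h'

theorem reaches_or_reaches (h : M.DetRun B n c d) (h' : M.Reaches c e) :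
    M.Reaches e d ∨ M.Reaches d e := by
  induction h with
  | refl => exact .inr h'
  | step hq hB hr ih =>
    obtain rfl | ⟨x, hx, h'⟩ := h'.cases_head
    · exact .inl ⟨_, (DetRun.step hq hB hr).reachesIn⟩
    · rw [(step_iff_of_program_eq hq).1 hx] at h'
      exact ih h'

/-- A configuration that can still move is not accepting, and its only move stays on the run;
acceptance can therefore be read off at the end. -/
theorem acceptsFrom_iff (h : M.DetRun B n c d) : M.AcceptsFrom c ↔ M.AcceptsFrom d := by
  induction h with
  | refl => rfl
  | step hq _ _ ih =>
    rw [← ih]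
    constructor
    · rintro ⟨e, he, ha⟩
      obtain rfl | ⟨x, hx, he⟩ := he.cases_head
      · exact absurd ha.1 (by simp [Halted])
      · rw [(step_iff_of_program_eq hq).1 hx] at he
        exact ⟨e, he, ha⟩
    · rintro ⟨e, he, ha⟩
      exact ⟨e, .head ((step_iff_of_program_eq hq).2 rfl) he, ha⟩

end DetRun

/-- In a deterministic machine each halting computation is forced. -/
theorem IsDeterministic.exists_detRun (hM : M.IsDeterministic) {c d : M.Config} {B : ℕ}
    (h : M.Reaches c d) (hB : ∀ e, M.Reaches c e → M.space e ≤ B) : ∃ n, M.DetRun B n c d := by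
  obtain ⟨n, hn⟩ := h
  refine ⟨n, ?_⟩
  induction n generalizing c with
  | zero => cases hn; exact .refl _
  | succ n ih =>
    obtain ⟨x, hx, hn⟩ := hn
    obtain ⟨_ | l, v, S⟩ := c
    · exact (Halted.not_step (M := M) (c := ⟨none, v, S⟩) rfl hx).elim
    · obtain ⟨q, hq⟩ := hM l
      have hs := hx
      rw [step_iff_of_program_eq hq] at hx
      subst hx
      exact .step hq (hB _ (.refl _)) (ih (fun e he => hB e (.head hs he)) hn)

variable (M) in
/-- A computation from `c` to `d` of total cost `n`, where a step at the label `l` costs `wt l`. -/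
inductive CostReaches (wt : M.Λ → ℕ) : ℕ → M.Config → M.Config → Prop
  | refl (c : M.Config) : CostReaches wt 0 c c
  | step {n : ℕ} {l : M.Λ} {q : Stmt M.Γ M.Λ M.σ} {v : M.σ} {S : ∀ k, List (M.Γ k)} {d : M.Config}
      (hq : q ∈ M.program l) (h : CostReaches wt n (stepAux q v S) d) :
      CostReaches wt (wt l + n) ⟨some l, v, S⟩ d

variable (M) in
/-- A computation from `c` to `d` of total cost at most `n`. -/
def CostWithin (wt : M.Λ → ℕ) (n : ℕ) (c d : M.Config) : Prop := ∃ k ≤ n, M.CostReaches wt k c d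

section Cost

variable {wt : M.Λ → ℕ} {m n : ℕ} {c d e : M.Config}

theorem CostReaches.trans (h : M.CostReaches wt m c d) (h' : M.CostReaches wt n d e) :
    M.CostReaches wt (m + n) c e := by
  induction h with
  | refl => simpa using h'
  | step hq _ ih =>
    rw [add_assoc]
    exact .step hq (ih h')

theorem CostReaches.reachesIn (h : M.CostReaches wt n c d) (hwt : ∀ l, wt l = 1) :
    M.ReachesIn n c d := by
  induction h with
  | refl => rfl
  | step hq _ ih =>
    rw [hwt, add_comm]
    exact ⟨_, step_iff.2 ⟨_, hq, rfl⟩, ih⟩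

theorem CostWithin.refl (c : M.Config) : M.CostWithin wt n c c := ⟨0, Nat.zero_le _, .refl c⟩

theorem CostWithin.trans (h : M.CostWithin wt m c d) (h' : M.CostWithin wt n d e) :
    M.CostWithin wt (m + n) c e := by
  obtain ⟨i, hi, h⟩ := h
  obtain ⟨j, hj, h'⟩ := h'
  exact ⟨i + j, add_le_add hi hj, h.trans h'⟩

theorem CostWithin.mono (hmn : m ≤ n) (h : M.CostWithin wt m c d) : M.CostWithin wt n c d := by
  obtain ⟨i, hi, h⟩ := h
  exact ⟨i, hi.trans hmn, h⟩

theorem CostWithin.single {l : M.Λ} {q : Stmt M.Γ M.Λ M.σ} {v : M.σ} {S : ∀ k, List (M.Γ k)}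
    (hq : q ∈ M.program l) (hwt : wt l ≤ n) :
    M.CostWithin wt n ⟨some l, v, S⟩ (stepAux q v S) :=
  ⟨_, hwt, by simpa using CostReaches.step hq (.refl _)⟩

theorem DetRun.costWithin {B : ℕ} (h : M.DetRun B n c d) (hwt : ∀ l, wt l ≤ 1) :
    M.CostWithin wt n c d := by
  induction h with
  | refl => exact .refl _
  | step hq _ _ ih =>
    rw [add_comm]
    exact (CostWithin.single (by simp [hq]) (hwt _)).trans ih

end Cost

/-! ## Space -/

/-- A bound for the number of symbols that a statement pushes. -/
def pushCount {K : Type} {Γ : K → Type} {Λ σ : Type} : Stmt Γ Λ σ → ℕ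
  | .push _ _ q => pushCount q + 1
  | .peek _ _ q => pushCount q
  | .pop _ _ q => pushCount q
  | .load _ q => pushCount q
  | .branch _ q₁ q₂ => max (pushCount q₁) (pushCount q₂)
  | .goto _ => 0
  | .halt => 0

theorem length_stepAux_le {K : Type} [DecidableEq K] {Γ : K → Type} {Λ σ : Type}
    (q : Stmt Γ Λ σ) (v : σ) (S : ∀ k, List (Γ k)) (k : K) :
    ((stepAux q v S).stk k).length ≤ (S k).length + pushCount q := by
  induction q generalizing v S with
  | push j f q ih =>
    refine (ih _ _).trans ?_
    by_cases h : k = j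
    · subst h; simp [pushCount]; omega
    · simp [pushCount, Function.update_of_ne h]
  | peek j f q ih => exact ih _ _
  | pop j f q ih =>
    refine (ih _ _).trans ?_
    by_cases h : k = j
    · subst h; simp [pushCount]
    · simp [pushCount, Function.update_of_ne h]
  | load f q ih => exact ih _ _
  | branch f q₁ q₂ ih₁ ih₂ =>
    simp only [stepAux, pushCount]
    cases f v
    · exact (ih₂ _ _).trans (by simp)
    · exact (ih₁ _ _).trans (by simp)
  | goto => simp [stepAux]
  | halt => simp [stepAux]

variable (M) in
theorem exists_pushCount_le : ∃ b, ∀ l, ∀ q ∈ M.program l, pushCount q ≤ b := by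
  cases nonempty_fintype M.Λ
  refine ⟨∑ l, ((M.program l).map pushCount).sum, fun l q hq => ?_⟩
  refine le_trans ?_ (Finset.single_le_sum (f := fun l => ((M.program l).map pushCount).sum)
    (fun _ _ => Nat.zero_le _) (Finset.mem_univ l))
  exact List.single_le_sum (by simp) _ (List.mem_map_of_mem hq)

/-- A bound on time is a bound on stack lengths. This limits the cleaning that follows an accepting
run when only the running time is controlled. -/
theorem ReachesIn.length_le {b : ℕ} (hb : ∀ l, ∀ q ∈ M.program l, pushCount q ≤ b) {n : ℕ}
    {c d : M.Config} (h : M.ReachesIn n c d) (k : M.K) :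
    (d.stk k).length ≤ (c.stk k).length + n * b := by
  induction n generalizing c with
  | zero => cases h; simp
  | succ n ih =>
    obtain ⟨x, ⟨l, hl, q, hq, rfl⟩, h⟩ := h
    have h1 := ih h
    have h2 := length_stepAux_le q c.var c.stk k
    have h3 := hb l q hq
    rw [Nat.succ_mul]
    omega

theorem length_le_space (c : M.Config) (k : M.K) : (c.stk k).length ≤ M.space c :=
  Finset.single_le_sum (f := fun k => (c.stk k).length) (fun _ _ => Nat.zero_le _)
    (Finset.mem_univ k)

theorem space_initial (w : List α) : M.space (M.initial w) = w.length := by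
  rw [space, Finset.sum_eq_single M.inputStack]
  · simp [initial]
  · intro k _ hk; simp [initial, Function.update_of_ne hk]
  · simp

/-! ## Running a machine inside another one -/

/-- The alphabets of two families of stacks. -/
abbrev SumFam {K K₂ : Type} (Γ : K → Type) (Γ₂ : K₂ → Type) : K ⊕ K₂ → Type
  | .inl k => Γ k
  | .inr k => Γ₂ k

/-- The contents of two families of stacks. -/
def joinStk {K K₂ : Type} {Γ : K → Type} {Γ₂ : K₂ → Type} (S : ∀ k, List (Γ k))
    (T : ∀ k, List (Γ₂ k)) : ∀ k : K ⊕ K₂, List (SumFam Γ Γ₂ k)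
  | .inl k => S k
  | .inr k => T k

section Join

variable {K K₂ : Type} {Γ : K → Type} {Γ₂ : K₂ → Type} {Λ Λ₂ σ τ : Type}
  (S : ∀ k, List (Γ k)) (T : ∀ k, List (Γ₂ k))

@[simp] theorem joinStk_inl (k : K) : joinStk S T (.inl k) = S k := rfl

@[simp] theorem joinStk_inr (k : K₂) : joinStk S T (.inr k) = T k := rfl

theorem eq_joinStk (U : ∀ k : K ⊕ K₂, List (SumFam Γ Γ₂ k)) :
    U = joinStk (fun k => U (.inl k)) (fun k => U (.inr k)) := by
  funext k; cases k <;> rfl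

variable [DecidableEq K] [DecidableEq K₂]

@[simp] theorem update_joinStk_inl (k : K) (a : List (Γ k)) :
    Function.update (joinStk S T) (.inl k) a = joinStk (Function.update S k a) T := by
  funext j
  cases j with
  | inl j =>
    by_cases h : j = k
    · subst h; simp
    · rw [Function.update_of_ne (by simpa using h)]; simp [Function.update_of_ne h]
  | inr j => rw [Function.update_of_ne (by simp)]; simp

@[simp] theorem update_joinStk_inr (k : K₂) (a : List (Γ₂ k)) :
    Function.update (joinStk S T) (.inr k) a = joinStk S (Function.update T k a) := by
  funext j
  cases j with
  | inr j =>
    by_cases h : j = k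
    · subst h; simp
    · rw [Function.update_of_ne (by simpa using h)]; simp [Function.update_of_ne h]
  | inl j => rw [Function.update_of_ne (by simp)]; simp

/-- The statement `q` of a machine as a statement of a machine with more stacks, labels and
states, where `ex` is executed in place of halting. -/
def liftStmt (ex : Stmt (SumFam Γ Γ₂) (Λ ⊕ Λ₂) (σ × τ)) :
    Stmt Γ Λ σ → Stmt (SumFam Γ Γ₂) (Λ ⊕ Λ₂) (σ × τ)
  | .push k f q => .push (.inl k) (fun s => f s.1) (liftStmt ex q)
  | .peek k f q => .peek (.inl k) (fun s o => (f s.1 o, s.2)) (liftStmt ex q)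
  | .pop k f q => .pop (.inl k) (fun s o => (f s.1 o, s.2)) (liftStmt ex q)
  | .load f q => .load (fun s => (f s.1, s.2)) (liftStmt ex q)
  | .branch f q₁ q₂ => .branch (fun s => f s.1) (liftStmt ex q₁) (liftStmt ex q₂)
  | .goto f => .goto (fun s => .inl (f s.1))
  | .halt => ex

/-- The configuration of the larger machine that corresponds to a configuration of the smaller one,
with the statement `ex` executed if the latter has halted. -/
def liftCfg (ex : Stmt (SumFam Γ Γ₂) (Λ ⊕ Λ₂) (σ × τ)) (y : τ) (c : Cfg Γ Λ σ) :
    Cfg (SumFam Γ Γ₂) (Λ ⊕ Λ₂) (σ × τ) :=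
  match c.l with
  | some l => ⟨some (.inl l), (c.var, y), joinStk c.stk T⟩
  | none => stepAux ex (c.var, y) (joinStk c.stk T)

/-- Since `ex` replaces `halt` inside the same statement, leaving the smaller machine takes no
additional step, and one step of it is exactly one step of the larger machine. -/
theorem stepAux_liftStmt (ex : Stmt (SumFam Γ Γ₂) (Λ ⊕ Λ₂) (σ × τ)) (q : Stmt Γ Λ σ) (v : σ)
    (y : τ) :
    stepAux (liftStmt ex q) (v, y) (joinStk S T) = liftCfg T ex y (stepAux q v S) := by
  induction q generalizing v S with
  | push k f q ih => simp [liftStmt, ← ih]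
  | peek k f q ih => simp [liftStmt, ← ih]
  | pop k f q ih => simp [liftStmt, ← ih]
  | load f q ih => simp [liftStmt, ← ih]
  | branch f q₁ q₂ ih₁ ih₂ => cases h : f v <;> simp [liftStmt, ← ih₁, ← ih₂, h]
  | goto f => simp [liftStmt, liftCfg]
  | halt => simp [liftStmt, liftCfg]

end Join

/-! ## Emptying stacks -/

section PopAll

variable {K : Type} [DecidableEq K] {Γ : K → Type} {Λ σ : Type}

/-- Pop from all stacks of the list, marking the state if one of them was not empty. -/
def popAll (mark : σ → σ) (ks : List K) (q : Stmt Γ Λ σ) : Stmt Γ Λ σ :=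
  ks.foldr (fun k q => .pop k (fun v o => if o.isSome then mark v else v) q) q

open Classical in
theorem stepAux_popAll {mark : σ → σ} (hmark : ∀ v, mark (mark v) = mark v) {ks : List K}
    (hks : ks.Nodup) (q : Stmt Γ Λ σ) (v : σ) (S : ∀ k, List (Γ k)) :
    stepAux (popAll mark ks q) v S =
      stepAux q (if ∃ k ∈ ks, S k ≠ [] then mark v else v)
        (fun k => if k ∈ ks then (S k).tail else S k) := by
  induction ks generalizing v S with
  | nil => simp [popAll]
  | cons k ks ih =>
    rw [List.nodup_cons] at hks
    rw [show popAll mark (k :: ks) q =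
      .pop k (fun v o => if o.isSome then mark v else v) (popAll mark ks q) from rfl]
    rw [stepAux, ih hks.2]
    have hne : ∀ j ∈ ks, j ≠ k := fun j hj h => hks.1 (h ▸ hj)
    congr 1
    · have h1 : (∃ j ∈ ks, Function.update S k (S k).tail j ≠ []) ↔ ∃ j ∈ ks, S j ≠ [] := by
        refine exists_congr fun j => and_congr_right fun hj => ?_
        rw [Function.update_of_ne (hne j hj)]
      simp only [h1, List.mem_cons, exists_eq_or_imp]
      by_cases h2 : S k = []
      · simp [h2]
      · have : (S k).head?.isSome := by simpa using h2
        by_cases h3 : ∃ j ∈ ks, S j ≠ [] <;> simp [h2, h3, this, hmark]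
    · funext j
      by_cases hj : j = k
      · subst hj; simp [hks.1]
      · simp [hj]

end PopAll

open Classical in
/-- The loop that pops from the stacks of the list `ks` until they are empty. -/
theorem DetRun.clean {clear mark : M.σ → M.σ} {flag : M.σ → Bool} {cl nx : M.Λ} {ks : List M.K}
    (hprog : M.program cl =
      [.load clear (popAll mark ks (.branch flag (.goto fun _ => cl) (.goto fun _ => nx)))])
    (hks : ks.Nodup) (hmark : ∀ v, mark (mark v) = mark v) (hfm : ∀ v, flag (mark v) = true)
    (hfc : ∀ v, flag (clear v) = false) (hcm : ∀ v, clear (mark (clear v)) = clear v)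
    {B n : ℕ} {v : M.σ} {S : ∀ k, List (M.Γ k)} (hn : ∀ k ∈ ks, (S k).length ≤ n)
    (hB : ∑ k, (S k).length ≤ B) :
    ∃ t ≤ n + 1, M.DetRun B t ⟨some cl, v, S⟩
      ⟨some nx, clear v, fun k => if k ∈ ks then [] else S k⟩ := by
  induction n generalizing v S with
  | zero =>
    have h0 : ∀ k ∈ ks, S k = [] := fun k hk => by simpa using hn k hk
    refine ⟨1, le_rfl, .step hprog hB ?_⟩
    rw [stepAux, stepAux_popAll hmark hks, if_neg (by simpa using h0)]
    simp only [stepAux, hfc, cond_false]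
    convert DetRun.refl (M := M) (B := B) _ using 3
    split_ifs with hk
    · simp [h0 _ hk]
    · rfl
  | succ n ih =>
    by_cases h : ∃ k ∈ ks, S k ≠ []
    -- A round shortens every nonempty stack of the list by one and leaves a mark. The next `clear`
    -- forgets the mark (`hcm`), so the final state does not depend on the number of rounds.
    · obtain ⟨t, ht, hr⟩ := ih (v := mark (clear v))
        (S := fun k => if k ∈ ks then (S k).tail else S k)
        (fun k hk => by have := hn k hk; simp [hk]; omega)
        ((Finset.sum_le_sum fun k _ => by split_ifs <;> simp).trans hB)
      refine ⟨t + 1, by omega, .step hprog hB ?_⟩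
      rw [stepAux, stepAux_popAll hmark hks, if_pos h]
      simp only [stepAux, hfm, cond_true]
      convert hr using 2
      · exact (hcm v).symm
      · funext k; split_ifs <;> rfl
    · have h0 : ∀ k ∈ ks, S k = [] := fun k hk => by_contra fun h' => h ⟨k, hk, h'⟩
      refine ⟨1, by omega, .step hprog hB ?_⟩
      rw [stepAux, stepAux_popAll hmark hks, if_neg h]
      simp only [stepAux, hfc, cond_false]
      convert DetRun.refl (M := M) (B := B) _ using 3
      split_ifs with hk
      · simp [h0 _ hk]
      · rfl

end StackMachine

namespace StackMachine

open Turing.TM2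

variable {α : Type}

theorem finite_alphabet (M : StackMachine α) : Finite α :=
  Finite.of_injective M.inputSymbol M.inputSymbol.injective

theorem sum_length_joinStk {K K₂ : Type} [Fintype K] [Fintype K₂] {Γ : K → Type} {Γ₂ : K₂ → Type}
    (S : ∀ k, List (Γ k)) (T : ∀ k, List (Γ₂ k)) :
    ∑ k, (joinStk S T k).length = ∑ k, (S k).length + ∑ k, (T k).length := by
  simp [Fintype.sum_sum_type]

theorem sum_length_update {K : Type} [Fintype K] [DecidableEq K] {Γ : K → Type}
    (S : ∀ k, List (Γ k)) (k : K) (a : List (Γ k)) :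
    ∑ j, (Function.update S k a j).length + (S k).length = ∑ j, (S j).length + a.length := by
  rw [← Finset.add_sum_erase _ _ (Finset.mem_univ k),
    ← Finset.add_sum_erase _ (fun j => (S j).length) (Finset.mem_univ k), Function.update_self]
  have : ∑ j ∈ Finset.univ.erase k, (Function.update S k a j).length =
      ∑ j ∈ Finset.univ.erase k, (S j).length := by
    refine Finset.sum_congr rfl fun j hj => ?_
    rw [Function.update_of_ne (Finset.ne_of_mem_erase hj)]
  omega

theorem sum_length_update_cons {K : Type} [Fintype K] [DecidableEq K] {Γ : K → Type}
    (S : ∀ k, List (Γ k)) (k : K) (x : Γ k) :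
    ∑ j, (Function.update S k (x :: S k) j).length = ∑ j, (S j).length + 1 := by
  have := sum_length_update S k (x :: S k)
  simp only [List.length_cons] at this
  omega

/-! ## Restriction to a regular language -/

/-- The stacks used to scan the input. -/
inductive ScanStack | inp | tmp
  deriving DecidableEq

instance : Fintype ScanStack := ⟨{.inp, .tmp}, by rintro (_ | _) <;> decide⟩

/-- The labels used to scan the input. -/
inductive ScanLabel | scan | back
  deriving DecidableEq

instance : Fintype ScanLabel := ⟨{.scan, .back}, by rintro (_ | _) <;> decide⟩

/-- The contents of the two stacks used to scan the input. -/
def scanStk (a b : List α) : ∀ _ : ScanStack, List α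
  | .inp => a
  | .tmp => b

@[simp] theorem scanStk_inp (a b : List α) : scanStk a b .inp = a := rfl

@[simp] theorem scanStk_tmp (a b : List α) : scanStk a b .tmp = b := rfl

@[simp] theorem update_scanStk_inp (a b c : List α) :
    Function.update (scanStk a b) .inp c = scanStk c b := by
  funext k; cases k <;> simp [Function.update, scanStk]

@[simp] theorem update_scanStk_tmp (a b c : List α) :
    Function.update (scanStk a b) .tmp c = scanStk a c := by
  funext k; cases k <;> simp [Function.update, scanStk]

theorem sum_scanStk (a b : List α) : ∑ k, (scanStk a b k).length = a.length + b.length := by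
  rw [show (Finset.univ : Finset ScanStack) = {.inp, .tmp} from rfl,
    Finset.sum_pair (by decide)]
  simp

open Classical in
/-- The machine that first runs the automaton `A` on the input and, if it accepts, runs `M`. -/
noncomputable abbrev restrict (M : StackMachine α) {Q : Type} [Finite Q] (A : DFA α Q)
    [Inhabited α] : StackMachine α where
  K := M.K ⊕ ScanStack
  Γ := SumFam M.Γ (fun _ => α)
  finiteΓ k := by
    have := M.finite_alphabet
    cases k <;> dsimp only [SumFam] <;> infer_instance
  Λ := M.Λ ⊕ ScanLabel
  σ := M.σ × (α × Bool × Q)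
  finiteσ := by have := M.finite_alphabet; infer_instance
  inputStack := .inr .inp
  inputSymbol := Function.Embedding.refl α
  main := .inr .scan
  start := (M.start, default, false, A.start)
  program
    | .inl l => (M.program l).map (liftStmt .halt)
    | .inr .scan => [.pop (.inr .inp)
        (fun s o => (s.1, o.getD default, o.isSome, o.elim s.2.2.2 (A.step s.2.2.2)))
        (.branch (fun s => s.2.2.1) (.push (.inr .tmp) (fun s => s.2.1) (.goto fun _ => .inr .scan))
          (.branch (fun s => decide (s.2.2.2 ∈ A.accept)) (.goto fun _ => .inr .back) .halt))]
    | .inr .back => [.pop (.inr .tmp) (fun s o => (s.1, o.getD default, o.isSome, s.2.2.2))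
        (.branch (fun s => s.2.2.1)
          (.push (.inl M.inputStack) (fun s => M.inputSymbol s.2.1) (.goto fun _ => .inr .back))
          (.goto fun _ => .inl M.main))]
  -- The verdict of the automaton has to be part of the condition: when `A` rejects, the state of
  -- `M` is still `M.start`, which may be accepting.
  acceptStates := {s | s.1 ∈ M.acceptStates ∧ s.2.2.2 ∈ A.accept}

section Restrict

variable (M : StackMachine α) {Q : Type} [Finite Q] (A : DFA α Q) [Inhabited α]

/-- The final label is the parameter `o`, so that acceptance and rejection by the automaton share
one induction. The input ends up reversed on the second stack, from which it is then transferred to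
`M` in the right order. -/
theorem restrict_scan (B : ℕ) (v : M.σ) (S : ∀ k, List (M.Γ k)) (a b : List α) (x : α) (t : Bool)
    (q : Q) (hB : ∑ k, (S k).length + a.length + b.length ≤ B) {o : Option (restrict M A).Λ}
    (h1 : A.evalFrom q a ∈ A.accept → o = some (.inr .back))
    (h0 : A.evalFrom q a ∉ A.accept → o = none) :
    (restrict M A).DetRun B (a.length + 1)
      ⟨some (.inr .scan), (v, x, t, q), joinStk S (scanStk a b)⟩
      ⟨o, (v, default, false, A.evalFrom q a), joinStk S (scanStk [] (a.reverse ++ b))⟩ := by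
  induction a generalizing b x t q with
  | nil =>
    refine .step rfl ?_ ?_
    · dsimp only [space]
      rw [sum_length_joinStk, sum_scanStk]
      omega
    · by_cases h : q ∈ A.accept
      · simp [h, h1 h]; exact .refl _
      · simp [h, h0 h]; exact .refl _
  | cons y a ih =>
    refine .step rfl ?_ ?_
    · dsimp only [space]
      rw [sum_length_joinStk, sum_scanStk]
      omega
    · simpa using ih (y :: b) y true (A.step q y) (by simp at hB ⊢; omega) h1 h0

theorem restrict_back (B : ℕ) (v : M.σ) (S : ∀ k, List (M.Γ k)) (a b : List α) (x : α) (t : Bool)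
    (q : Q) (hB : ∑ k, (S k).length + a.length + b.length ≤ B) :
    (restrict M A).DetRun B (b.length + 1)
      ⟨some (.inr .back), (v, x, t, q), joinStk S (scanStk a b)⟩
      ⟨some (.inl M.main), (v, default, false, q), joinStk (Function.update S M.inputStack
        ((b.reverse.map M.inputSymbol) ++ S M.inputStack)) (scanStk a [])⟩ := by
  induction b generalizing S x t with
  | nil =>
    refine .step rfl ?_ ?_
    · dsimp only [space]
      rw [sum_length_joinStk, sum_scanStk]
      omega
    · simp; exact .refl _
  | cons y b ih =>
    refine .step rfl ?_ ?_
    · dsimp only [space]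
      rw [sum_length_joinStk, sum_scanStk]
      omega
    · have := ih (Function.update S M.inputStack (M.inputSymbol y :: S M.inputStack)) y true (by
        simp at hB ⊢
        have := sum_length_update_cons S M.inputStack (M.inputSymbol y)
        omega)
      simpa using this

/-- The configuration of `restrict M A` that corresponds to a configuration of `M`. -/
abbrev restrictCfg (q : Q) (c : M.Config) : (restrict M A).Config :=
  liftCfg (scanStk [] []) .halt (default, false, q) c

theorem restrict_initial (w : List α) : (restrict M A).initial w =
    ⟨some (.inr .scan), (M.start, default, false, A.start),
      joinStk (fun _ => []) (scanStk w [])⟩ := by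
  rw [initial]
  congr 1
  rw [eq_joinStk (Function.update _ _ _)]
  congr 1
  funext k
  cases k
  · exact List.map_id w
  · rfl

theorem restrict_initial_of_mem {w : List α} (hw : A.eval w ∈ A.accept) :
    (restrict M A).DetRun w.length (2 * w.length + 2) ((restrict M A).initial w)
      (restrictCfg M A (A.eval w) (M.initial w)) := by
  have h1 := restrict_scan M A w.length M.start (fun _ => []) w [] default false A.start (by simp)
    (fun _ => rfl) (fun h => (h hw).elim)
  have h2 := restrict_back M A w.length M.start (fun _ => []) [] w.reverse default false (A.eval w)
    (by simp)
  rw [show A.evalFrom A.start w = A.eval w from rfl, List.append_nil] at h1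
  have h := h1.trans h2
  rw [List.length_reverse, List.reverse_reverse, List.append_nil] at h
  rw [restrict_initial, show 2 * w.length + 2 = w.length + 1 + (w.length + 1) by omega]
  exact h

theorem restrict_initial_of_notMem {w : List α} (hw : A.eval w ∉ A.accept) :
    ∃ c, (restrict M A).DetRun w.length (w.length + 1) ((restrict M A).initial w) c ∧
      (restrict M A).Halted c ∧ c.var ∉ (restrict M A).acceptStates ∧
      (restrict M A).space c ≤ w.length := by
  have h1 := restrict_scan M A w.length M.start (fun _ => []) w [] default false A.start (by simp)
    (fun h => (hw h).elim) (fun _ => rfl)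
  rw [show A.evalFrom A.start w = A.eval w from rfl, List.append_nil, ← restrict_initial] at h1
  refine ⟨_, h1, rfl, by simp [hw], ?_⟩
  dsimp only [space]
  rw [sum_length_joinStk, sum_scanStk]
  simp

/-- An exact correspondence of steps, in both directions, because `M` may be nondeterministic: it
transports acceptance, running time and space at once. -/
theorem restrict_step_iff (q : Q) (c : M.Config) (d : (restrict M A).Config) :
    (restrict M A).Step (restrictCfg M A q c) d ↔
      ∃ c', M.Step c c' ∧ d = restrictCfg M A q c' := by
  obtain ⟨_ | l, v, S⟩ := c
  · constructor
    · exact fun h => (Halted.not_step (by simp [Halted, liftCfg]) h).elim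
    · rintro ⟨c', h, -⟩
      exact (Halted.not_step (M := M) (c := ⟨none, v, S⟩) rfl h).elim
  · refine Iff.trans (step_iff (M := restrict M A) (l := .inl l) (v := (v, default, false, q))
      (S := joinStk S (scanStk [] []))) ?_
    simp only [step_iff, List.mem_map]
    constructor
    · rintro ⟨_, ⟨s, hs, rfl⟩, rfl⟩
      exact ⟨_, ⟨s, hs, rfl⟩, stepAux_liftStmt ..⟩
    · rintro ⟨_, ⟨s, hs, rfl⟩, rfl⟩
      exact ⟨_, ⟨s, hs, rfl⟩, (stepAux_liftStmt ..).symm⟩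

theorem restrict_reachesIn_iff (q : Q) (n : ℕ) (c : M.Config) (d : (restrict M A).Config) :
    (restrict M A).ReachesIn n (restrictCfg M A q c) d ↔
      ∃ c', M.ReachesIn n c c' ∧ d = restrictCfg M A q c' := by
  induction n generalizing c with
  | zero => simp [ReachesIn, eq_comm]
  | succ n ih =>
    constructor
    · rintro ⟨x, hx, h⟩
      obtain ⟨c', hc', rfl⟩ := (restrict_step_iff M A q c x).1 hx
      obtain ⟨e, he, rfl⟩ := (ih c').1 h
      exact ⟨e, ⟨c', hc', he⟩, rfl⟩
    · rintro ⟨e, ⟨c', hc', he⟩, rfl⟩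
      exact ⟨_, (restrict_step_iff M A q c _).2 ⟨c', hc', rfl⟩, (ih c').2 ⟨e, he, rfl⟩⟩

theorem restrict_accepting_iff {q : Q} (hq : q ∈ A.accept) (c : M.Config) :
    (restrict M A).Accepting (restrictCfg M A q c) ↔ M.Accepting c := by
  obtain ⟨_ | l, v, S⟩ := c <;> simp [Accepting, Halted, liftCfg, hq]

theorem space_restrictCfg (q : Q) (c : M.Config) :
    (restrict M A).space (restrictCfg M A q c) = M.space c := by
  obtain ⟨_ | l, v, S⟩ := c <;>
    exact (sum_length_joinStk S (scanStk [] [])).trans (by rw [sum_scanStk]; simp [space])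

theorem restrict_accepts_iff (w : List α) :
    (restrict M A).Accepts w ↔ M.Accepts w ∧ A.eval w ∈ A.accept := by
  rw [accepts_iff_acceptsFrom]
  by_cases hw : A.eval w ∈ A.accept
  · rw [(restrict_initial_of_mem M A hw).acceptsFrom_iff, and_iff_left hw]
    constructor
    · rintro ⟨d, ⟨n, hn⟩, hd⟩
      obtain ⟨c, hc, rfl⟩ := (restrict_reachesIn_iff ..).1 hn
      exact ⟨c, ⟨n, hc⟩, (restrict_accepting_iff M A hw c).1 hd⟩
    · rintro ⟨c, ⟨n, hn⟩, hc⟩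
      exact ⟨_, ⟨n, (restrict_reachesIn_iff ..).2 ⟨c, hn, rfl⟩⟩,
        (restrict_accepting_iff M A hw c).2 hc⟩
  · obtain ⟨c, hc, hh, ha, -⟩ := restrict_initial_of_notMem M A hw
    rw [hc.acceptsFrom_iff, hh.acceptsFrom_iff]
    tauto

end Restrict

end StackMachine

open StackMachine

theorem InNP.inter_accepts {α Q : Type} [Inhabited α] [Finite Q] {L : Set (List α)} (hL : InNP L)
    (A : DFA α Q) : InNP {w | w ∈ L ∧ A.eval w ∈ A.accept} := by
  obtain ⟨M, p, h1, h2⟩ := hL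
  refine ⟨restrict M A, 2 * Polynomial.X + 2 + p, fun w => ?_, fun w hw => ?_⟩
  · rw [restrict_accepts_iff, ← h1]
    rfl
  · obtain ⟨n, hn, c, hc, ha⟩ := h2 w hw.1
    refine ⟨2 * w.length + 2 + n, by simpa using hn, _,
      (restrict_initial_of_mem M A hw.2).reachesIn.trans
        ((restrict_reachesIn_iff ..).2 ⟨c, hc, rfl⟩), (restrict_accepting_iff M A hw.2 c).2 ha⟩

theorem InPSPACE.inter_accepts {α Q : Type} [Inhabited α] [Finite Q] {L : Set (List α)}
    (hL : InPSPACE L) (A : DFA α Q) : InPSPACE {w | w ∈ L ∧ A.eval w ∈ A.accept} := by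
  obtain ⟨M, p, hdet, hhalt, hsp, h1⟩ := hL
  refine ⟨restrict M A, Polynomial.X + p, ?_, fun w => ?_, fun w c hc => ?_, fun w => ?_⟩
  · rintro (l | _ | _)
    · obtain ⟨q, hq⟩ := hdet l
      exact ⟨_, by simp [hq]; rfl⟩
    · exact ⟨_, rfl⟩
    · exact ⟨_, rfl⟩
  · by_cases hw : A.eval w ∈ A.accept
    · obtain ⟨c, ⟨n, hn⟩, hc⟩ := hhalt w
      refine ⟨_, (restrict_initial_of_mem M A hw).reaches.trans
        ⟨n, (restrict_reachesIn_iff ..).2 ⟨c, hn, rfl⟩⟩, ?_⟩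
      obtain ⟨_ | l, v, S⟩ := c <;> simp_all [Halted, liftCfg]
    · obtain ⟨c, hc, hh, -⟩ := restrict_initial_of_notMem M A hw
      exact ⟨c, hc.reaches, hh⟩
  · simp only [Polynomial.eval_add, Polynomial.eval_X]
    by_cases hw : A.eval w ∈ A.accept
    · obtain h | ⟨n, hn⟩ := (restrict_initial_of_mem M A hw).space_le_or_reaches hc
      · omega
      · obtain ⟨c, hcn, rfl⟩ := (restrict_reachesIn_iff ..).1 hn
        rw [space_restrictCfg]
        have := hsp w c ⟨n, hcn⟩
        omega
    · obtain ⟨d, hd, hh, -, hs⟩ := restrict_initial_of_notMem M A hw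
      obtain h | h := hd.space_le_or_reaches hc
      · omega
      · rw [hh.eq_of_reaches h]
        omega
  · rw [restrict_accepts_iff, ← h1]
    rfl

namespace StackMachine

open Turing.TM2

open Classical in
/-- The cost function that counts the steps for which there are several possible moves. -/
noncomputable def choiceCost {α : Type} (M : StackMachine α) (l : M.Λ) : ℕ :=
  if ∃ q, M.program l = [q] then 0 else 1

theorem choiceCost_le_one {α : Type} (M : StackMachine α) (l : M.Λ) : M.choiceCost l ≤ 1 := by
  unfold choiceCost; split_ifs <;> omega

/-! ## A machine that guesses a product of conjugates of relators -/

/-- The inverse of a letter. -/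
def invLetter {α : Type} (x : α × Bool) : α × Bool := (x.1, !x.2)

/-- The stacks that hold a word with a marked position. -/
inductive WordStack | left | right
  deriving DecidableEq

instance : Fintype WordStack := ⟨{.left, .right}, by rintro (_ | _) <;> decide⟩

/-- The labels of the guessing machine. -/
inductive GuessLabel | main | gen (s : Bool) | clean
  deriving DecidableEq

instance : Fintype GuessLabel :=
  ⟨{.main, .gen true, .gen false, .clean}, by rintro (_ | (_ | _) | _) <;> decide⟩

section WordStk

variable {β : Type}

/-- The contents of the two stacks that hold a word with a marked position. -/
def wordStk (a b : List β) : ∀ _ : WordStack, List β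
  | .left => a
  | .right => b

@[simp] theorem wordStk_left (a b : List β) : wordStk a b .left = a := rfl

@[simp] theorem wordStk_right (a b : List β) : wordStk a b .right = b := rfl

@[simp] theorem update_wordStk_left (a b c : List β) :
    Function.update (wordStk a b) .left c = wordStk c b := by
  funext k; cases k <;> simp [Function.update, wordStk]

@[simp] theorem update_wordStk_right (a b c : List β) :
    Function.update (wordStk a b) .right c = wordStk a c := by
  funext k; cases k <;> simp [Function.update, wordStk]

theorem sum_wordStk (a b : List β) : ∑ k, (wordStk a b k).length = a.length + b.length := by
  rw [show (Finset.univ : Finset WordStack) = {.left, .right} from rfl,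
    Finset.sum_pair (by decide)]
  simp

end WordStk

variable {α : Type} (M : StackMachine (α × Bool))

/-- The statements of the guessing machine. -/
abbrev GuessStmt : Type :=
  Stmt (SumFam M.Γ (fun _ : WordStack => α × Bool)) (M.Λ ⊕ GuessLabel) (M.σ × Bool)

namespace Guess

open Classical in
/-- After `M` has halted: continue if it has accepted. -/
noncomputable def exit : GuessStmt M :=
  .branch (fun s => decide (s.1 ∈ M.acceptStates)) (.goto fun _ => .inr .clean)
    (.load (fun s => (s.1, false)) .halt)

/-- Insert the letter `x` and its inverse at the marked position. -/
def shift (x : α × Bool) : GuessStmt M :=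
  .push (.inr .left) (fun _ => x) (.push (.inr .right) (fun _ => invLetter x)
    (.goto fun _ => .inr .main))

open Classical in
/-- The test whether a symbol is the letter `x`. -/
noncomputable def isLetter (x : α × Bool) (o : Option (α × Bool)) : Bool := decide (o = some x)

theorem isLetter_iff {x : α × Bool} {o : Option (α × Bool)} :
    isLetter x o = true ↔ o = some x := by simp [isLetter]

/-- Move the marked position over the letter `x` to the left. -/
noncomputable def unshift (x : α × Bool) : GuessStmt M :=
  .pop (.inr .left) (fun s o => (s.1, isLetter x o))
    (.branch (fun s => s.2) (.push (.inr .right) (fun _ => x) (.load (fun s => (s.1, false))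
      (.goto fun _ => .inr .main))) .halt)

/-- Remove the letter `x` and its inverse to the right of the marked position. -/
noncomputable def cancel (x : α × Bool) : GuessStmt M :=
  .pop (.inr .right) (fun s o => (s.1, isLetter x o))
    (.pop (.inr .right) (fun s o => (s.1, s.2 && isLetter (invLetter x) o))
      (.branch (fun s => s.2) (.load (fun s => (s.1, false)) (.goto fun _ => .inr .main)) .halt))

/-- Accept if the word is empty. -/
def finish : GuessStmt M :=
  .peek (.inr .left) (fun s o => (s.1, o.isNone))
    (.peek (.inr .right) (fun s o => (s.1, s.2 && o.isNone)) .halt)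

/-- Insert a letter of a relator or of the inverse of a relator. -/
def genLetter (s : Bool) (x : α × Bool) : GuessStmt M :=
  .push (.inl M.inputStack) (fun _ => M.inputSymbol x)
    (if s then .push (.inr .right) (fun _ => x) (.goto fun _ => .inr (.gen s))
      else .push (.inr .left) (fun _ => invLetter x) (.goto fun _ => .inr (.gen s)))

/-- The stacks of `M`. -/
noncomputable def stackList : List (M.K ⊕ WordStack) := (Finset.univ : Finset M.K).toList.map .inl

theorem nodup_stackList : (stackList M).Nodup :=
  (Finset.nodup_toList _).map Sum.inl_injective

@[simp] theorem inl_mem_stackList (k : M.K) : .inl k ∈ stackList M := by simp [stackList]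

@[simp] theorem inr_notMem_stackList (k : WordStack) : .inr k ∉ stackList M := by simp [stackList]

theorem tail_stackList [∀ k, Decidable (k ∈ stackList M)] (S : ∀ k, List (M.Γ k))
    (T : WordStack → List (α × Bool)) :
    (fun k => if k ∈ stackList M then (joinStk S T k).tail else joinStk S T k) =
      joinStk (fun k => (S k).tail) T := by
  funext k; cases k <;> simp

theorem nil_stackList [∀ k, Decidable (k ∈ stackList M)] (S : ∀ k, List (M.Γ k))
    (T : WordStack → List (α × Bool)) :
    (fun k => if k ∈ stackList M then [] else joinStk S T k) = joinStk (fun _ => []) T := by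
  funext k; cases k <;> simp

/-- The stacks are at most as long as those of a configuration that `M` reaches on an input of
length at most `t`. -/
def StkLe (t : ℕ) (S : ∀ k, List (M.Γ k)) : Prop :=
  ∃ r : GroupWord α, r.length ≤ t ∧ ∃ c, M.Reaches (M.initial r) c ∧
    ∀ k, (S k).length ≤ (c.stk k).length

theorem stkLe_nil (t : ℕ) : StkLe M t (fun _ => []) :=
  ⟨[], by simp, _, .refl _, by simp⟩

variable {M} in
theorem StkLe.clean {t : ℕ} {S : ∀ k, List (M.Γ k)} (h : StkLe M t S) :
    StkLe M t fun k => (S k).tail := by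
  obtain ⟨r, hr, c, hc, h⟩ := h
  refine ⟨r, hr, c, hc, fun k => (Nat.le_trans ?_ (h k))⟩
  simp

variable {M} in
theorem initial_stk_cons (x : α × Bool) (r : GroupWord α) :
    Function.update (M.initial r).stk M.inputStack
      (M.inputSymbol x :: (M.initial r).stk M.inputStack) = (M.initial (x :: r)).stk := by
  simp [initial]

variable [Fintype α]

/-- The list of all letters. -/
noncomputable def letters (α : Type) [Fintype α] : List (α × Bool) :=
  (Finset.univ : Finset (α × Bool)).toList

@[simp] theorem mem_letters (x : α × Bool) : x ∈ letters α := by simp [letters]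

/-- The program of the guessing machine. -/
noncomputable def program : M.Λ ⊕ GuessLabel → List (GuessStmt M)
  | .inl l => (M.program l).map (liftStmt (exit M))
  | .inr .main => (letters α).map (shift M) ++ (letters α).map (unshift M) ++
      (letters α).map (cancel M) ++
      [finish M, .goto fun _ => .inr (.gen true), .goto fun _ => .inr (.gen false)]
  | .inr (.gen s) => (letters α).map (genLetter M s) ++ [.goto fun _ => .inl M.main]
  | .inr .clean => [.load (fun _ => (M.start, false)) (popAll (fun s => (s.1, true)) (stackList M)
      (.branch (fun s => s.2) (.goto fun _ => .inr .clean) (.goto fun _ => .inr .main)))]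

end Guess

variable [Fintype α]

/-- The machine that tries to transform its input into the empty word by inserting and removing
pairs of inverse letters and by inserting words accepted by `M` and their inverses. -/
noncomputable abbrev guess : StackMachine (α × Bool) where
  K := M.K ⊕ WordStack
  Γ := SumFam M.Γ (fun _ => α × Bool)
  finiteΓ k := by cases k <;> dsimp only [SumFam] <;> infer_instance
  Λ := M.Λ ⊕ GuessLabel
  σ := M.σ × Bool
  inputStack := .inr .right
  inputSymbol := Function.Embedding.refl _
  main := .inr .main
  start := (M.start, false)
  program := Guess.program M
  acceptStates := {s | s.2 = true}

namespace Guess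

/-- The configurations in which the next move is to be guessed. -/
abbrev mainCfg (L R : GroupWord α) : (guess M).Config :=
  ⟨some (.inr .main), (M.start, false), joinStk (fun _ => []) (wordStk L R)⟩

theorem initial_eq (w : GroupWord α) : (guess M).initial w = mainCfg M [] w := by
  rw [initial]
  congr 1
  rw [eq_joinStk (Function.update _ _ _)]
  congr 1
  funext k
  cases k
  · rfl
  · exact List.map_id w

section Val

variable {β : Type} {G : Type*} [Group G] (φ : FreeGroup β →* G)

theorem map_mk_append (L R : GroupWord β) :
    φ (.mk (L ++ R)) = φ (.mk L) * φ (.mk R) := by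
  rw [← FreeGroup.mul_mk, map_mul]

theorem map_mk_cons (x : β × Bool) (R : GroupWord β) :
    φ (.mk (x :: R)) = φ (.mk [x]) * φ (.mk R) :=
  map_mk_append φ [x] R

theorem map_mk_invLetter_cons (x : β × Bool) (R : GroupWord β) :
    φ (.mk (invLetter x :: R)) = (φ (.mk [x]))⁻¹ * φ (.mk R) := by
  rw [map_mk_cons, ← map_inv, FreeGroup.inv_mk]
  rfl

theorem map_mk_cancel (L R : GroupWord β) (x : β × Bool) :
    φ (.mk (L ++ x :: invLetter x :: R)) = φ (.mk (L ++ R)) := by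
  rw [map_mk_append, map_mk_append, map_mk_cons, map_mk_invLetter_cons, mul_inv_cancel_left]

end Val

/-! ### Soundness of the guessing machine: the invariant -/

section Invariant

variable {G : Type*} [Group G] (φ : FreeGroup α →* G)

/-- The invariant of the computations of the guessing machine on the input `w`. -/
inductive Inv (w : GroupWord α) : ℕ → (guess M).Config → Prop
  | main {t : ℕ} {L R : GroupWord α} (hlen : L.length + R.length ≤ w.length + 2 * t)
      (hφ : φ (.mk (L.reverse ++ R)) = 1 → φ (.mk w) = 1) : Inv w t (mainCfg M L R)
  | gen {t : ℕ} {s : Bool} {r L R : GroupWord α} (hr : r.length ≤ t)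
      (hlen : L.length + R.length + r.length ≤ w.length + 2 * t)
      (hφ : φ (.mk (L.reverse ++ R)) = 1 → φ (.mk w) = 1) :
      Inv w t ⟨some (.inr (.gen s)), (M.start, false), joinStk (M.initial r).stk
        (wordStk (if s then L else r.map invLetter ++ L) (if s then r ++ R else R))⟩
  | run {t : ℕ} {r L R : GroupWord α} {l : M.Λ} {v : M.σ} {S : ∀ k, List (M.Γ k)}
      (hr : r.length ≤ t) (hc : M.Reaches (M.initial r) ⟨some l, v, S⟩)
      (hlen : L.length + R.length ≤ w.length + 2 * t)
      (hφ : φ (.mk r) = 1 → φ (.mk (L.reverse ++ R)) = 1 → φ (.mk w) = 1) :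
      Inv w t ⟨some (.inl l), (v, false), joinStk S (wordStk L R)⟩
  | clean {t : ℕ} {L R : GroupWord α} {s : M.σ × Bool} {S : ∀ k, List (M.Γ k)} (hS : StkLe M t S)
      (hlen : L.length + R.length ≤ w.length + 2 * t)
      (hφ : φ (.mk (L.reverse ++ R)) = 1 → φ (.mk w) = 1) :
      Inv w t ⟨some (.inr .clean), s, joinStk S (wordStk L R)⟩
  | halt {t : ℕ} {L R : GroupWord α} {s : M.σ × Bool} {S : ∀ k, List (M.Γ k)} (hS : StkLe M t S)
      (hlen : L.length + R.length ≤ w.length + 2 * t) (hφ : s.2 = true → φ (.mk w) = 1) :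
      Inv w t ⟨none, s, joinStk S (wordStk L R)⟩

variable {M φ}

theorem Inv.shift {w : GroupWord α} {t : ℕ} {L R : GroupWord α}
    (hlen : L.length + R.length ≤ w.length + 2 * t)
    (hφ : φ (.mk (L.reverse ++ R)) = 1 → φ (.mk w) = 1) (x : α × Bool) :
    Inv M φ w (t + 1) (stepAux (Guess.shift M x) (M.start, false)
      (joinStk (fun _ => []) (wordStk L R))) := by
  simp only [Guess.shift, stepAux, joinStk_inr, wordStk_left, wordStk_right, update_joinStk_inr,
    update_wordStk_left, update_wordStk_right]
  refine .main (by simp; omega) fun h => hφ ?_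
  rwa [List.reverse_cons, List.append_assoc, List.singleton_append, map_mk_cancel] at h

theorem Inv.unshift {w : GroupWord α} {t : ℕ} {L R : GroupWord α}
    (hlen : L.length + R.length ≤ w.length + 2 * t)
    (hφ : φ (.mk (L.reverse ++ R)) = 1 → φ (.mk w) = 1) (x : α × Bool) :
    Inv M φ w (t + 1) (stepAux (Guess.unshift M x) (M.start, false)
      (joinStk (fun _ => []) (wordStk L R))) := by
  simp only [Guess.unshift, stepAux, joinStk_inr, wordStk_left, wordStk_right, update_joinStk_inr,
    update_wordStk_left, update_wordStk_right]
  by_cases h : L.head? = some x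
  · obtain ⟨L, rfl⟩ : ∃ L', L = x :: L' := by cases L <;> simp_all
    simp only [isLetter_iff.2 h, cond_true, List.tail_cons]
    refine .main (by simp at hlen ⊢; omega) fun h => hφ ?_
    simpa using h
  · simp only [Bool.eq_false_iff.2 (mt isLetter_iff.1 h), cond_false]
    exact .halt (stkLe_nil _ _) (by simp; omega) (by simp)

theorem Inv.cancel {w : GroupWord α} {t : ℕ} {L R : GroupWord α}
    (hlen : L.length + R.length ≤ w.length + 2 * t)
    (hφ : φ (.mk (L.reverse ++ R)) = 1 → φ (.mk w) = 1) (x : α × Bool) :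
    Inv M φ w (t + 1) (stepAux (Guess.cancel M x) (M.start, false)
      (joinStk (fun _ => []) (wordStk L R))) := by
  simp only [Guess.cancel, stepAux, joinStk_inr, wordStk_right, update_joinStk_inr,
    update_wordStk_right]
  by_cases h : R.head? = some x ∧ R.tail.head? = some (invLetter x)
  · obtain ⟨R, rfl⟩ : ∃ R', R = x :: invLetter x :: R' := by
      obtain _ | ⟨y, _ | ⟨z, R⟩⟩ := R <;> simp_all
    have h1 : ∀ y : α × Bool, isLetter y (some y) = true := fun y => isLetter_iff.2 rfl
    simp only [List.head?_cons, List.tail_cons, h1, Bool.and_self, cond_true]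
    refine .main (by simp at hlen ⊢; omega) fun h => hφ ?_
    rwa [map_mk_cancel]
  · have : (isLetter x R.head? && isLetter (invLetter x) R.tail.head?) = false := by
      rw [Bool.eq_false_iff, Ne, Bool.and_eq_true, isLetter_iff, isLetter_iff]
      exact h
    simp only [this, cond_false]
    exact .halt (stkLe_nil _ _) (by simp; omega) (by simp)

theorem Inv.finish {w : GroupWord α} {t : ℕ} {L R : GroupWord α}
    (hlen : L.length + R.length ≤ w.length + 2 * t)
    (hφ : φ (.mk (L.reverse ++ R)) = 1 → φ (.mk w) = 1) :
    Inv M φ w (t + 1) (stepAux (Guess.finish M) (M.start, false)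
      (joinStk (fun _ => []) (wordStk L R))) := by
  simp only [Guess.finish, stepAux, joinStk_inr, wordStk_left, wordStk_right]
  refine .halt (stkLe_nil _ _) (by omega) fun h => hφ ?_
  obtain ⟨rfl, rfl⟩ : L = [] ∧ R = [] := by simpa using h
  simp [← FreeGroup.one_eq_mk]

/-- While `M` runs, the triviality of the inserted `r` is only a premise in the invariant.
Acceptance by `M` discharges it; rejection halts with the flag cleared, where nothing is claimed
about `w`. -/
theorem Inv.liftCfg {w : GroupWord α} {t : ℕ} {r L R : GroupWord α} {c : M.Config}
    (hM : ∀ r, M.Accepts r → φ (.mk r) = 1)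
    (hr : r.length ≤ t) (hc : M.Reaches (M.initial r) c)
    (hlen : L.length + R.length ≤ w.length + 2 * t)
    (hφ : φ (.mk r) = 1 → φ (.mk (L.reverse ++ R)) = 1 → φ (.mk w) = 1) :
    Inv M φ w t (liftCfg (wordStk L R) (exit M) false c) := by
  obtain ⟨_ | l, v, S⟩ := c
  · by_cases hv : v ∈ M.acceptStates
    · simp only [StackMachine.liftCfg, exit, stepAux, hv, decide_true, cond_true]
      exact .clean ⟨r, hr, _, hc, fun _ => le_rfl⟩ hlen (hφ (hM r ⟨_, hc, rfl, hv⟩))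
    · simp only [StackMachine.liftCfg, exit, stepAux, hv, decide_false, cond_false]
      exact .halt ⟨r, hr, _, hc, fun _ => le_rfl⟩ hlen (by simp)
  · exact .run hr hc hlen hφ

theorem choiceCost_main : (guess M).choiceCost (.inr .main) = 1 := by
  refine if_neg ?_
  rintro ⟨q, hq⟩
  have := congrArg List.length hq
  simp [program] at this
  omega

/-- A letter is needed as an alternative to stopping; over an empty alphabet this label would be
deterministic and free. -/
theorem choiceCost_gen [Nonempty α] (s : Bool) : (guess M).choiceCost (.inr (.gen s)) = 1 := by
  refine if_neg ?_
  rintro ⟨q, hq⟩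
  have := congrArg List.length hq
  simp [program, letters] at this

theorem choiceCost_clean : (guess M).choiceCost (.inr .clean) = 0 := if_pos ⟨_, rfl⟩

/-- The index has to grow only at choices. This is enough because the word becomes longer only when
a pair or a letter of a relator is guessed, while steps of `M` leave the word alone and cleaning
only empties the stacks of `M`. -/
theorem Inv.step [Nonempty α] {w : GroupWord α} {t : ℕ} {l : (guess M).Λ} {v : (guess M).σ}
    {S : ∀ k, List ((guess M).Γ k)} {q : GuessStmt M} (hM : ∀ r, M.Accepts r → φ (.mk r) = 1)
    (h : Inv M φ w t ⟨some l, v, S⟩) (hq : q ∈ (guess M).program l) :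
    Inv M φ w (t + (guess M).choiceCost l) (stepAux q v S) := by
  cases h with
  | main hlen hφ =>
    rw [choiceCost_main]
    simp only [program, List.mem_append, List.mem_map, mem_letters, true_and, List.mem_cons,
      List.not_mem_nil, or_false] at hq
    obtain ((⟨x, rfl⟩ | ⟨x, rfl⟩) | ⟨x, rfl⟩) | rfl | rfl | rfl := hq
    · exact .shift hlen hφ x
    · exact .unshift hlen hφ x
    · exact .cancel hlen hφ x
    · exact .finish hlen hφ
    · convert Inv.gen (r := []) (s := true) (Nat.zero_le _)
        (show _ ≤ w.length + 2 * (t + 1) by simp; omega) hφ using 1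
      simp [initial, stepAux]
    · convert Inv.gen (r := []) (s := false) (Nat.zero_le _)
        (show _ ≤ w.length + 2 * (t + 1) by simp; omega) hφ using 1
      simp [initial, stepAux]
  | @gen s r L R hr hlen hφ =>
    rw [choiceCost_gen]
    simp only [program, List.mem_append, List.mem_map, mem_letters, true_and, List.mem_cons,
      List.not_mem_nil, or_false] at hq
    obtain ⟨x, rfl⟩ | rfl := hq
    · convert Inv.gen (s := s) (r := x :: r) (show _ ≤ t + 1 by simpa using hr)
        (show _ ≤ w.length + 2 * (t + 1) by simp; omega) hφ using 1
      cases s <;> simp [genLetter, initial_stk_cons, joinStk_inl (M.initial r).stk]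
    · refine .liftCfg (c := M.initial r) hM (show r.length ≤ t + 1 by omega) (.refl _) ?_ ?_
      · cases s <;> simp <;> omega
      · cases s
        · simp only [Bool.false_eq_true, if_false, List.reverse_append, map_mk_append]
          intro h1
          have : φ (.mk (r.map invLetter).reverse) = (φ (.mk r))⁻¹ := by
            rw [← map_inv, FreeGroup.inv_mk]; rfl
          simpa [this, h1, map_mk_append] using hφ
        · simp only [if_true, map_mk_append]
          intro h1
          simpa [h1, map_mk_append] using hφ
  | run hr hc hlen hφ =>
    obtain ⟨q, hq', rfl⟩ := List.mem_map.1 hq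
    rw [stepAux_liftStmt]
    exact .liftCfg hM (by omega) (hc.tail (step_iff.2 ⟨q, hq', rfl⟩)) (by omega) hφ
  | @clean L R _ S hS hlen hφ =>
    rw [choiceCost_clean, add_zero]
    simp only [program, List.mem_singleton] at hq
    subst hq
    rw [stepAux, stepAux_popAll (mark := fun s : M.σ × Bool => (s.1, true)) (fun _ => rfl)
      (nodup_stackList M), tail_stackList]
    split_ifs with h
    · exact .clean hS.clean hlen hφ
    · have hS0 : (fun k => (S k).tail) = fun _ => [] := by
        funext k
        have : ¬ (joinStk S (wordStk L R) (.inl k) ≠ []) := fun h' =>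
          h ⟨.inl k, inl_mem_stackList M k, h'⟩
        simp only [joinStk_inl, ne_eq, not_not] at this
        simp [this]
      rw [hS0]
      exact .main hlen hφ

theorem Inv.costReaches [Nonempty α] {w : GroupWord α} {s t : ℕ} {c d : (guess M).Config}
    (hM : ∀ r, M.Accepts r → φ (.mk r) = 1) (h : Inv M φ w s c)
    (hcd : (guess M).CostReaches (guess M).choiceCost t c d) : Inv M φ w (s + t) d := by
  induction hcd generalizing s with
  | refl => exact h
  | step hq _ ih =>
    rw [← add_assoc]
    exact ih (h.step hM hq)

end Invariant

/-! ### Completeness of the guessing machine: the cost of accepting -/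

section Completeness

variable {M} {wt : (guess M).Λ → ℕ} (hwt : ∀ l, wt l ≤ 1)
include hwt

theorem cost_shift (L R : GroupWord α) (x : α × Bool) :
    (guess M).CostWithin wt 1 (mainCfg M L R) (mainCfg M (x :: L) (invLetter x :: R)) := by
  convert CostWithin.single (M := guess M) (l := .inr .main) (q := shift M x) (by simp [program])
    (hwt _) using 1
  simp [shift]

theorem cost_unshift (L R : GroupWord α) (x : α × Bool) :
    (guess M).CostWithin wt 1 (mainCfg M (x :: L) R) (mainCfg M L (x :: R)) := by
  convert CostWithin.single (M := guess M) (l := .inr .main) (q := unshift M x) (by simp [program])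
    (hwt _) using 1
  simp [unshift, isLetter_iff.2]

theorem cost_cancel (L R : GroupWord α) (x : α × Bool) :
    (guess M).CostWithin wt 1 (mainCfg M L (x :: invLetter x :: R)) (mainCfg M L R) := by
  convert CostWithin.single (M := guess M) (l := .inr .main) (q := cancel M x) (by simp [program])
    (hwt _) using 1
  simp [cancel, isLetter_iff.2]

theorem cost_finish : ∃ d, (guess M).CostWithin wt 1 (mainCfg M [] []) d ∧
    (guess M).Accepting d := by
  refine ⟨_, CostWithin.single (M := guess M) (l := .inr .main) (q := finish M)
    (by simp [program]) (hwt _), ?_⟩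
  simp [finish, Accepting, Halted]

theorem cost_shift_word (L R g : GroupWord α) : (guess M).CostWithin wt g.length (mainCfg M L R)
    (mainCfg M (g.reverse ++ L) (FreeGroup.invRev g ++ R)) := by
  induction g generalizing L R with
  | nil => exact .refl _
  | cons x g ih =>
    convert (cost_shift hwt L R x).trans (ih (x :: L) (invLetter x :: R)) using 1
    · simp [add_comm]
    · simp [FreeGroup.invRev, invLetter]

theorem cost_unshift_word (L R : GroupWord α) : (guess M).CostWithin wt L.length (mainCfg M L R)
    (mainCfg M [] (L.reverse ++ R)) := by
  induction L generalizing R with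
  | nil => exact .refl _
  | cons x L ih =>
    convert (cost_unshift hwt L R x).trans (ih (x :: R)) using 1
    · simp [add_comm]
    · simp

/-- There is no instruction that moves to the right. To pass a letter `x`, insert `x x⁻¹` at the
marked position, with the mark in between, and cancel the `x⁻¹` against the old `x`. -/
theorem cost_move_word (L R g : GroupWord α) : (guess M).CostWithin wt (2 * g.length)
    (mainCfg M L (g ++ R)) (mainCfg M (g.reverse ++ L) R) := by
  induction g generalizing L with
  | nil => exact .refl _
  | cons x g ih =>
    have h := cost_cancel hwt (x :: L) (g ++ R) (invLetter x)
    rw [show invLetter (invLetter x) = x by simp [invLetter]] at h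
    rw [show (x :: g).reverse ++ L = g.reverse ++ x :: L by simp,
      show 2 * (x :: g).length = 1 + 1 + 2 * g.length by simp; omega]
    exact ((cost_shift hwt L _ x).trans h).trans (ih (x :: L))

/-- Each of the at most `V.length` cancellations consists of walking to the pair (two moves per
letter), one move to remove it, and walking back (one move per letter). -/
theorem cost_reduce {V : GroupWord α} (hV : FreeGroup.mk V = 1) :
    (guess M).CostWithin wt ((3 * V.length + 1) * V.length) (mainCfg M [] V) (mainCfg M [] []) := by
  have hred : FreeGroup.Red V [] := by
    obtain ⟨W, h1, h2⟩ := FreeGroup.Red.exact.1 (hV.trans FreeGroup.one_eq_mk)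
    rwa [FreeGroup.Red.nil_iff.1 h2] at h1
  induction hred using Relation.ReflTransGen.head_induction_on with
  | refl => exact .refl _
  | head hs hr ih =>
    obtain @⟨A, B, x, b⟩ := hs
    have h1 := cost_move_word hwt [] ((x, b) :: (x, !b) :: B) A
    have h2 := cost_cancel hwt (A.reverse ++ []) B (x, b)
    have h3 := cost_unshift_word hwt (A.reverse ++ []) B
    have h4 := ih (FreeGroup.Red.exact.2 ⟨[], hr, .refl⟩)
    simp only [List.append_nil, List.reverse_reverse] at h1 h2 h3
    refine CostWithin.mono ?_ (((h1.trans h2).trans h3).trans h4)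
    simp only [List.length_append, List.length_reverse, List.length_cons]
    nlinarith

/-- Every guessed letter goes both to the input stack of `M` and into the word, so the relator grows
from its last letter to its first. Inverse letters are pushed on the left stack, which is read
backwards, so there they spell the inverse of the relator. -/
theorem cost_gen (s : Bool) (r r' L R : GroupWord α) :
    (guess M).CostWithin wt r.length
      ⟨some (.inr (.gen s)), (M.start, false), joinStk (M.initial r').stk
        (wordStk (if s then L else r'.map invLetter ++ L) (if s then r' ++ R else R))⟩
      ⟨some (.inr (.gen s)), (M.start, false), joinStk (M.initial (r ++ r')).stk
        (wordStk (if s then L else (r ++ r').map invLetter ++ L)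
          (if s then r ++ r' ++ R else R))⟩ := by
  induction r with
  | nil => exact .refl _
  | cons x r ih =>
    refine ih.trans ?_
    convert CostWithin.single (M := guess M) (l := .inr (.gen s)) (q := genLetter M s x)
      (by simp [program]) (hwt _) using 1
    cases s <;>
      simp [genLetter, initial_stk_cons, joinStk_inl (M.initial (r ++ r')).stk]

theorem cost_insert (s : Bool) (r L R : GroupWord α) {P : ℕ}
    (hrun : ∀ L R, (guess M).CostWithin wt P (liftCfg (wordStk L R) (exit M) false (M.initial r))
      (mainCfg M L R)) :
    (guess M).CostWithin wt (r.length + 2 + P) (mainCfg M L R)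
      (mainCfg M (if s then L else r.map invLetter ++ L) (if s then r ++ R else R)) := by
  have h1 : (guess M).CostWithin wt 1 (mainCfg M L R)
      ⟨some (.inr (.gen s)), (M.start, false), joinStk (M.initial []).stk
        (wordStk (if s then L else [].map invLetter ++ L) (if s then [] ++ R else R))⟩ := by
    convert CostWithin.single (M := guess M) (l := .inr .main) (q := .goto fun _ => .inr (.gen s))
      (by cases s <;> simp [program]) (hwt _) using 1
    simp [initial]
  have h2 := cost_gen hwt s r [] L R
  rw [List.append_nil] at h2
  have h3 := CostWithin.single (M := guess M) (wt := wt) (l := .inr (.gen s))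
    (q := .goto fun _ => .inl M.main) (v := (M.start, false)) (S := joinStk (M.initial r).stk
        (wordStk (if s then L else r.map invLetter ++ L) (if s then r ++ R else R)))
    (by simp [program]) (hwt _)
  refine CostWithin.mono ?_ ((h1.trans h2).trans (h3.trans (hrun _ _)))
  omega

omit hwt in
/-- The conjugate of a word or of its inverse. -/
def conjWord (g r : GroupWord α) (s : Bool) : GroupWord α :=
  g ++ (if s then r else FreeGroup.invRev r) ++ FreeGroup.invRev g

theorem cost_conj (s : Bool) (g r R : GroupWord α) {P : ℕ}
    (hrun : ∀ L R, (guess M).CostWithin wt P (liftCfg (wordStk L R) (exit M) false (M.initial r))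
      (mainCfg M L R)) :
    (guess M).CostWithin wt (2 * g.length + 2 * r.length + 2 + P) (mainCfg M [] R)
      (mainCfg M [] (conjWord g r s ++ R)) := by
  have h1 := cost_shift_word hwt [] R g
  have h2 := cost_insert hwt s r (g.reverse ++ []) (FreeGroup.invRev g ++ R) hrun
  have h3 := cost_unshift_word hwt (if s then (g.reverse ++ []) else r.map invLetter ++
    (g.reverse ++ [])) (if s then r ++ (FreeGroup.invRev g ++ R) else (FreeGroup.invRev g ++ R))
  have h := (h1.trans h2).trans h3
  cases s
  · simp only [Bool.false_eq_true, if_false] at h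
    convert CostWithin.mono ?_ h using 1
    · simp [conjWord, FreeGroup.invRev]; rfl
    · simp; omega
  · simp only [if_true] at h
    convert CostWithin.mono ?_ h using 1
    · simp [conjWord]
    · simp; omega

/-- Multiplying `W` on the left by the inverse of the first factor (hence the sign `!s`) leaves the
product of the remaining factors. Each factor lengthens the word by at most `3 * b`, and the word
that remains at the end is freely trivial. -/
theorem cost_accept {b P : ℕ} (cs : List (GroupWord α × GroupWord α × Bool))
    (hb : ∀ c ∈ cs, c.1.length ≤ b ∧ c.2.1.length ≤ b)
    (hrun : ∀ c ∈ cs, ∀ L R, (guess M).CostWithin wt P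
      (liftCfg (wordStk L R) (exit M) false (M.initial c.2.1)) (mainCfg M L R))
    (W : GroupWord α)
    (hW : (cs.map fun c => FreeGroup.mk (conjWord c.1 c.2.1 c.2.2)).prod = FreeGroup.mk W) :
    ∃ d, (guess M).CostWithin wt (cs.length * (4 * b + 2 + P) +
      (3 * (W.length + cs.length * (3 * b)) + 1) * (W.length + cs.length * (3 * b)) + 1)
      (mainCfg M [] W) d ∧ (guess M).Accepting d := by
  induction cs generalizing W with
  | nil =>
    obtain ⟨d, hd, ha⟩ := cost_finish (M := M) hwt
    refine ⟨d, ?_, ha⟩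
    simpa using (cost_reduce hwt (by simpa using hW.symm)).trans hd
  | cons c cs ih =>
    obtain ⟨g, r, s⟩ := c
    have hbc := hb _ (by simp : (g, r, s) ∈ _)
    dsimp only at hbc
    have h1 := cost_conj hwt (!s) g r W (hrun (g, r, s) (by simp))
    have hinv : FreeGroup.mk (conjWord g r (!s)) = (FreeGroup.mk (conjWord g r s))⁻¹ := by
      cases s <;> simp [conjWord, ← FreeGroup.mul_mk, ← FreeGroup.inv_mk, mul_assoc]
    obtain ⟨d, hd, ha⟩ := ih (fun c hc => hb c (by simp [hc])) (fun c hc => hrun c (by simp [hc]))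
      (conjWord g r (!s) ++ W) (by
        rw [← FreeGroup.mul_mk, ← hW, hinv, List.map_cons, List.prod_cons, inv_mul_cancel_left])
    refine ⟨d, (h1.trans hd).mono ?_, ha⟩
    have hlen : (conjWord g r (!s) ++ W).length + cs.length * (3 * b) ≤
        W.length + ((g, r, s) :: cs).length * (3 * b) := by
      have : (conjWord g r (!s)).length = 2 * g.length + r.length := by
        cases s <;> simp [conjWord] <;> omega
      simp only [List.length_append, this, List.length_cons]
      nlinarith
    have := Nat.mul_le_mul (Nat.add_le_add_right (Nat.mul_le_mul_left 3 hlen) 1) hlen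
    simp only [List.length_cons] at this ⊢
    nlinarith

omit hwt in
theorem cost_lift {ω : ℕ} (hω : ∀ l, wt (.inl l) ≤ ω) {n : ℕ} {c d : M.Config}
    (h : M.ReachesIn n c d) (T : WordStack → List (α × Bool)) :
    (guess M).CostWithin wt (n * ω) (liftCfg T (exit M) false c) (liftCfg T (exit M) false d) := by
  induction n generalizing c with
  | zero => cases h; exact .refl _
  | succ n ih =>
    obtain ⟨e, hs, h⟩ := h
    obtain ⟨_ | l, v, S⟩ := c
    · exact (Halted.not_step (M := M) (c := ⟨none, v, S⟩) rfl hs).elim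
    · obtain ⟨q, hq, rfl⟩ := step_iff.1 hs
      have h1 := CostWithin.single (M := guess M) (wt := wt) (l := .inl l)
        (q := liftStmt (exit M) q) (v := (v, false)) (S := joinStk S T)
        (List.mem_map_of_mem hq) (hω l)
      rw [stepAux_liftStmt] at h1
      rw [Nat.succ_mul, add_comm]
      exact h1.trans (ih h)

/-- The run of `M` costs at most `ω` per step; cleaning takes a round for each symbol of the longest
stack and one to notice that all are empty. The value is `ω = 1` when steps are counted and `ω = 0`
when only choices are counted and `M` is deterministic. -/
theorem cost_run {ω : ℕ} (hω : ∀ l, wt (.inl l) ≤ ω) {n b : ℕ} {r : GroupWord α} {c : M.Config}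
    (h : M.ReachesIn n (M.initial r) c) (hc : M.Accepting c) (hb : ∀ k, (c.stk k).length ≤ b)
    (L R : GroupWord α) :
    (guess M).CostWithin wt (n * ω + (b + 1))
      (liftCfg (wordStk L R) (exit M) false (M.initial r)) (mainCfg M L R) := by
  refine (cost_lift hω h _).trans ?_
  obtain ⟨_ | l, v, S⟩ := c
  · obtain ⟨-, hv⟩ := hc
    obtain ⟨t, ht, hr⟩ := DetRun.clean (M := guess M) (cl := .inr .clean) (nx := .inr .main)
      (ks := stackList M) (mark := fun s => (s.1, true)) (flag := fun s => s.2)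
      (clear := fun _ => (M.start, false)) rfl (nodup_stackList M) (fun _ => rfl) (fun _ => rfl)
      (fun _ => rfl) (fun _ => rfl) (n := b) (v := (v, false)) (S := joinStk S (wordStk L R))
      (fun k hk => by cases k with
        | inl k => exact hb k
        | inr k => simp at hk) le_rfl
    rw [nil_stackList] at hr
    have hcfg : liftCfg (wordStk L R) (exit M) false ⟨none, v, S⟩ =
        ⟨some (.inr .clean), (v, false), joinStk S (wordStk L R)⟩ := by
      have hv' : v ∈ M.acceptStates := hv
      simp [liftCfg, exit, hv']
    rw [hcfg]
    exact (hr.costWithin hwt).mono ht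
  · exact absurd hc.1 (by simp [Halted])

end Completeness

end Guess

end StackMachine

/-! ### Soundness of the guessing machine, and the result for **NP** -/

namespace StackMachine

open Turing.TM2

theorem Reaches.exists_costReaches {α : Type} {M : StackMachine α} (wt : M.Λ → ℕ) {c d : M.Config}
    (h : M.Reaches c d) : ∃ n, M.CostReaches wt n c d := by
  obtain ⟨n, hn⟩ := h
  induction n generalizing c with
  | zero => cases hn; exact ⟨0, .refl _⟩
  | succ n ih =>
    obtain ⟨e, hs, hn⟩ := hn
    obtain ⟨k, hk⟩ := ih hn
    obtain ⟨_ | l, v, S⟩ := c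
    · exact (Halted.not_step (M := M) (c := ⟨none, v, S⟩) rfl hs).elim
    · obtain ⟨q, hq, rfl⟩ := step_iff.1 hs
      exact ⟨_, .step hq hk⟩

namespace Guess

variable {α : Type} [Fintype α] {M : StackMachine (α × Bool)}
  {G : Type*} [Group G] {φ : FreeGroup α →* G}

theorem inv_initial (w : GroupWord α) : Inv M φ w 0 ((guess M).initial w) := by
  rw [initial_eq]
  exact .main (by simp) (by simp)

/-- An accepting configuration has halted with the flag set, and for halted configurations the
invariant ties this flag to the triviality of the input. -/
theorem map_mk_of_accepts [Nonempty α] (hM : ∀ r, M.Accepts r → φ (.mk r) = 1) {w : GroupWord α}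
    (hw : (guess M).Accepts w) : φ (.mk w) = 1 := by
  obtain ⟨d, hd, ha⟩ := hw
  obtain ⟨n, hn⟩ := hd.exists_costReaches (guess M).choiceCost
  have h := (inv_initial w).costReaches hM hn
  cases h with
  | halt hS hlen hφ => exact hφ ha.2
  | _ => exact absurd ha.1 (by simp [Halted])

end Guess

end StackMachine

-- Here each step costs 1: the guessed computation spells out the given product, and both the number
-- of factors and the time to verify each of them are polynomial.
open StackMachine in
theorem InNP.of_products {α : Type} [Fintype α] [Nonempty α] {G : Type*} [Group G]
    {φ : FreeGroup α →* G} {R : Set (GroupWord α)} (hR : InNP R)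
    (hφ : ∀ r ∈ R, φ (.mk r) = 1) {b : ℕ → ℕ} (hb : PolyBdd b)
    (hprod : ∀ W : GroupWord α, φ (.mk W) = 1 → ∃ cs : List (GroupWord α × GroupWord α × Bool),
      cs.length ≤ b W.length ∧
      (∀ c ∈ cs, c.1.length ≤ b W.length ∧ c.2.1.length ≤ b W.length ∧ c.2.1 ∈ R) ∧
      (cs.map fun c => FreeGroup.mk (Guess.conjWord c.1 c.2.1 c.2.2)).prod = FreeGroup.mk W) :
    InNP {W : GroupWord α | φ (.mk W) = 1} := by
  obtain ⟨M, p, h1, h2⟩ := hR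
  obtain ⟨e, he⟩ := M.exists_pushCount_le
  -- `P` bounds the verification of one relator: at most `p (b n)` steps of `M`, then the emptying
  -- of stacks that have grown by at most `e` symbols per step. `X` bounds the length of the word
  -- after all insertions.
  let P : ℕ → ℕ := fun n => p.eval (b n) * 1 + (b n + p.eval (b n) * e + 1)
  let X : ℕ → ℕ := fun n => n + b n * (3 * b n)
  have hP : PolyBdd P := ((PolyBdd.eval_comp p hb).mul (.const 1)).add
    ((hb.add ((PolyBdd.eval_comp p hb).mul (.const e))).add (.const 1))
  have hX : PolyBdd X := PolyBdd.id.add (hb.mul ((PolyBdd.const 3).mul hb))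
  obtain ⟨q, hq⟩ : PolyBdd fun n => b n * (4 * b n + 2 + P n) + (3 * X n + 1) * X n + 1 :=
    ((hb.mul ((((PolyBdd.const 4).mul hb).add (.const 2)).add hP)).add
      ((((PolyBdd.const 3).mul hX).add (.const 1)).mul hX)).add (.const 1)
  have hacc : ∀ w : GroupWord α, φ (.mk w) = 1 → (guess M).AcceptsWithin (q.eval w.length) w := by
    intro W hW
    obtain ⟨cs, hlen, hcs, hcW⟩ := hprod W hW
    obtain ⟨d, ⟨k, hk, hd⟩, ha⟩ := Guess.cost_accept (M := M) (wt := fun _ => 1) (fun _ => le_rfl)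
      (b := b W.length) (P := P W.length) cs (fun c hc => ⟨(hcs c hc).1, (hcs c hc).2.1⟩)
      (fun c hc L R => by
        obtain ⟨n, hn, d, hd, ha⟩ := h2 _ (hcs c hc).2.2
        have hn' : n ≤ p.eval (b W.length) := hn.trans (p.eval_mono_nat (hcs c hc).2.1)
        refine (Guess.cost_run (wt := fun _ => 1) (fun _ => le_rfl) (fun _ => le_rfl) hd ha
          (b := b W.length + p.eval (b W.length) * e) (fun k => ?_) L R).mono ?_
        · refine (hd.length_le he k).trans (add_le_add ?_ (Nat.mul_le_mul_right _ hn'))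
          exact ((length_le_space _ k).trans (space_initial _).le).trans (hcs c hc).2.1
        · exact add_le_add (Nat.mul_le_mul_right _ hn') le_rfl) W hcW
    refine ⟨k, hk.trans (le_trans ?_ (hq W.length)), d, ?_, ha⟩
    · have hX' : W.length + cs.length * (3 * b W.length) ≤ X W.length :=
        Nat.add_le_add_left (Nat.mul_le_mul_right _ hlen) _
      exact Nat.add_le_add (Nat.add_le_add (Nat.mul_le_mul_right _ hlen)
        (Nat.mul_le_mul (Nat.add_le_add_right (Nat.mul_le_mul_left 3 hX') 1) hX')) le_rfl
    · rw [Guess.initial_eq]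
      exact hd.reachesIn fun _ => rfl
  refine ⟨guess M, q, fun w => ⟨fun hw => ?_, fun hw => ?_⟩, hacc⟩
  · obtain ⟨n, -, d, hd, ha⟩ := hacc w hw
    exact ⟨d, ⟨n, hd⟩, ha⟩
  · exact Guess.map_mk_of_accepts (fun r hr => hφ r ((h1 r).2 hr)) hw

namespace StackMachine

open Turing.TM2

/-! ## Deterministic search for an accepting sequence of choices -/

/-- The stacks of the search. -/
inductive SearchStack | inp | sav | cnt | tmp | stg | ch | us
  deriving DecidableEq

instance : Fintype SearchStack :=
  ⟨{.inp, .sav, .cnt, .tmp, .stg, .ch, .us}, by rintro (_ | _ | _ | _ | _ | _ | _) <;> decide⟩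

/-- The labels of the search. -/
inductive SearchLabel
  | init | scan | stage | outer | inner | restore | back | load | unload | clean | rewind | inc
  | carry
  deriving DecidableEq

instance : Fintype SearchLabel :=
  ⟨{.init, .scan, .stage, .outer, .inner, .restore, .back, .load, .unload, .clean, .rewind, .inc,
    .carry}, by
    rintro (_ | _ | _ | _ | _ | _ | _ | _ | _ | _ | _ | _ | _) <;> decide⟩

/-- The alphabets of the stacks of the search. -/
abbrev SearchSymbol (α : Type) (b : ℕ) : SearchStack → Type
  | .inp => α
  | .sav => α
  | .cnt => Unit
  | .tmp => Unit
  | .stg => Unit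
  | .ch => Fin (b + 1)
  | .us => Fin (b + 1)

/-- The contents of the stacks of the search: the input `inp`, the reversed input `sav`, two unary
counters `cnt` and `tmp`, the number of multiplications to be done, the choices that are still
available, and the choices that have been used. -/
structure Store (α : Type) (b : ℕ) where
  inp : List α
  sav : List α
  cnt : List Unit
  tmp : List Unit
  stg : List Unit
  ch : List (Fin (b + 1))
  us : List (Fin (b + 1))

namespace Store

variable {α : Type} {b : ℕ} (s : Store α b)

/-- The stacks of the search with the contents `s`. -/
def stk : ∀ k, List (SearchSymbol α b k)
  | .inp => s.inp
  | .sav => s.sav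
  | .cnt => s.cnt
  | .tmp => s.tmp
  | .stg => s.stg
  | .ch => s.ch
  | .us => s.us

@[simp] theorem stk_inp : s.stk .inp = s.inp := rfl
@[simp] theorem stk_sav : s.stk .sav = s.sav := rfl
@[simp] theorem stk_cnt : s.stk .cnt = s.cnt := rfl
@[simp] theorem stk_tmp : s.stk .tmp = s.tmp := rfl
@[simp] theorem stk_stg : s.stk .stg = s.stg := rfl
@[simp] theorem stk_ch : s.stk .ch = s.ch := rfl
@[simp] theorem stk_us : s.stk .us = s.us := rfl

@[simp] theorem update_inp (a : List α) :
    Function.update s.stk .inp a = { s with inp := a }.stk := by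
  funext k; cases k <;> simp [Function.update, stk]

@[simp] theorem update_sav (a : List α) :
    Function.update s.stk .sav a = { s with sav := a }.stk := by
  funext k; cases k <;> simp [Function.update, stk]

@[simp] theorem update_cnt (a : List Unit) :
    Function.update s.stk .cnt a = { s with cnt := a }.stk := by
  funext k; cases k <;> simp [Function.update, stk]

@[simp] theorem update_tmp (a : List Unit) :
    Function.update s.stk .tmp a = { s with tmp := a }.stk := by
  funext k; cases k <;> simp [Function.update, stk]

@[simp] theorem update_stg (a : List Unit) :
    Function.update s.stk .stg a = { s with stg := a }.stk := by
  funext k; cases k <;> simp [Function.update, stk]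

@[simp] theorem update_ch (a : List (Fin (b + 1))) :
    Function.update s.stk .ch a = { s with ch := a }.stk := by
  funext k; cases k <;> simp [Function.update, stk]

@[simp] theorem update_us (a : List (Fin (b + 1))) :
    Function.update s.stk .us a = { s with us := a }.stk := by
  funext k; cases k <;> simp [Function.update, stk]

/-- The number of symbols on all stacks. -/
def size : ℕ := s.inp.length + (s.sav.length + (s.cnt.length + (s.tmp.length + (s.stg.length +
  (s.ch.length + s.us.length)))))

theorem sum_stk : ∑ k, (s.stk k).length = s.size := by
  rw [show (Finset.univ : Finset SearchStack) = {.inp, .sav, .cnt, .tmp, .stg, .ch, .us} from rfl]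
  iterate 6 rw [Finset.sum_insert (by decide)]
  rw [Finset.sum_singleton]
  rfl

end Store

variable {α : Type} (N : StackMachine α) (b C k : ℕ)

namespace Search

/-- The statements of the search. -/
abbrev SStmt : Type :=
  Stmt (SumFam N.Γ (SearchSymbol α b)) (N.Λ ⊕ (SearchLabel ⊕ N.Λ × Fin (b + 1)))
    (N.σ × (α × Bool × Fin (b + 1)))

variable {N b}

/-- Jump to a label of the search. -/
def jump (l : SearchLabel) : SStmt N b := .goto fun _ => .inr (.inl l)

/-- Push `n` times the same symbol. -/
def pushN (j : SearchStack) (x : SearchSymbol α b j) (q : SStmt N b) : ℕ → SStmt N b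
  | 0 => q
  | n + 1 => .push (.inr j) (fun _ => x) (pushN j x q n)

theorem stepAux_pushN {j : SearchStack} {x : SearchSymbol α b j} {q : SStmt N b} (n : ℕ)
    (v : N.σ × (α × Bool × Fin (b + 1))) (S : ∀ j, List (N.Γ j))
    (T : ∀ j, List (SearchSymbol α b j)) :
    stepAux (pushN j x q n) v (joinStk S T) =
      stepAux q v (joinStk S (Function.update T j (List.replicate n x ++ T j))) := by
  induction n generalizing T with
  | zero => simp [pushN]
  | succ n ih =>
    simp only [pushN, stepAux, update_joinStk_inr, joinStk_inr, ih, Function.update_self,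
      Function.update_idem]
    simp [List.replicate_succ', List.append_assoc]

variable [Inhabited α]

/-- Remember a letter. -/
def setLetter (s : N.σ × (α × Bool × Fin (b + 1))) (o : Option α) :
    N.σ × (α × Bool × Fin (b + 1)) := (s.1, o.getD default, o.isSome, s.2.2.2)

/-- Remember a digit. -/
def setDigit (s : N.σ × (α × Bool × Fin (b + 1))) (o : Option (Fin (b + 1))) :
    N.σ × (α × Bool × Fin (b + 1)) := (s.1, s.2.1, o.isSome, o.getD 0)

/-- Remember whether a symbol has been popped. -/
def setFlag (s : N.σ × (α × Bool × Fin (b + 1))) (t : Bool) :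
    N.σ × (α × Bool × Fin (b + 1)) := (s.1, s.2.1, t, s.2.2.2)

variable (N b)

open Classical in
/-- After the simulated machine has halted: accept or try the next sequence of choices. -/
noncomputable def exit : SStmt N b :=
  .branch (fun s => decide (s.1 ∈ N.acceptStates)) (.load (fun s => setFlag s true) .halt)
    (jump .clean)

/-- The stacks of the simulated machine. -/
noncomputable def stackList : List (N.K ⊕ SearchStack) :=
  (Finset.univ : Finset N.K).toList.map .inl

/-- The test whether a symbol has been popped. -/
def flag (s : N.σ × (α × Bool × Fin (b + 1))) : Bool := s.2.2.1

open Classical in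
/-- The program of the search. -/
noncomputable def program : N.Λ ⊕ (SearchLabel ⊕ N.Λ × Fin (b + 1)) → SStmt N b
  | .inr (.inl .init) => pushN .cnt () (pushN .stg () (pushN .ch 0 (jump .scan) 1) k) (C + 1)
  | .inr (.inl .scan) => .pop (.inr .inp) setLetter (.branch (flag N b)
      (.push (.inr .sav) (fun s => s.2.1) (.push (.inr .cnt) (fun _ => ()) (jump .scan)))
      (jump .stage))
  | .inr (.inl .stage) => .pop (.inr .stg) (fun s o => setFlag s o.isSome)
      (.branch (flag N b) (jump .outer) (jump .load))
  | .inr (.inl .outer) => .pop (.inr .ch) (fun s o => setFlag s o.isSome)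
      (.branch (flag N b) (jump .inner) (jump .back))
  | .inr (.inl .inner) => .pop (.inr .cnt) (fun s o => setFlag s o.isSome) (.branch (flag N b)
      (.push (.inr .tmp) (fun _ => ()) (.push (.inr .us) (fun _ => 0) (jump .inner)))
      (jump .restore))
  | .inr (.inl .restore) => .pop (.inr .tmp) (fun s o => setFlag s o.isSome) (.branch (flag N b)
      (.push (.inr .cnt) (fun _ => ()) (jump .restore)) (jump .outer))
  | .inr (.inl .back) => .pop (.inr .us) (fun s o => setFlag s o.isSome) (.branch (flag N b)
      (.push (.inr .ch) (fun _ => 0) (jump .back)) (jump .stage))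
  | .inr (.inl .load) => .pop (.inr .sav) setLetter (.branch (flag N b)
      (.push (.inl N.inputStack) (fun s => N.inputSymbol s.2.1)
        (.push (.inr .inp) (fun s => s.2.1) (jump .load)))
      (jump .unload))
  | .inr (.inl .unload) => .pop (.inr .inp) setLetter (.branch (flag N b)
      (.push (.inr .sav) (fun s => s.2.1) (jump .unload))
      (.load (fun s => (N.start, s.2)) (.goto fun _ => .inl N.main)))
  -- A forced move uses no digit. Otherwise the next digit is moved from `ch` to `us` and selects
  -- the statement; if the digits are exhausted or the index is too large, the current trial is
  -- abandoned.
  | .inl l => if h : ∃ q, N.program l = [q] then liftStmt (exit N b) h.choose else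
      .pop (.inr .ch) setDigit (.branch (flag N b)
        (.push (.inr .us) (fun s => s.2.2.2) (.goto fun s => .inr (.inr (l, s.2.2.2))))
        (jump .clean))
  | .inr (.inr (l, d)) => match (N.program l)[d.1]? with
      | some q => liftStmt (exit N b) q
      | none => jump .clean
  | .inr (.inl .clean) => .load (fun _ => (N.start, default, false, 0))
      (popAll (fun s => setFlag s true) (stackList N)
        (.branch (flag N b) (jump .clean) (jump .rewind)))
  | .inr (.inl .rewind) => .pop (.inr .us) setDigit (.branch (flag N b)
      (.push (.inr .ch) (fun s => s.2.2.2) (jump .rewind)) (jump .inc))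
  | .inr (.inl .inc) => .pop (.inr .ch) setDigit (.branch (flag N b)
      (.branch (fun s => decide (s.2.2.2 = Fin.last b))
        (.push (.inr .us) (fun _ => 0) (jump .inc))
        (.push (.inr .ch) (fun s => s.2.2.2 + 1) (jump .carry)))
      (.load (fun s => setFlag s false) .halt))
  | .inr (.inl .carry) => .pop (.inr .us) setDigit (.branch (flag N b)
      (.push (.inr .ch) (fun s => s.2.2.2) (jump .carry)) (jump .load))

end Search

variable [Inhabited α]

/-- The deterministic machine that simulates `N` for all sequences of `(n + C + 1) ^ k` choices,
where `n` is the length of the input. -/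
noncomputable abbrev search : StackMachine α where
  K := N.K ⊕ SearchStack
  Γ := SumFam N.Γ (SearchSymbol α b)
  finiteΓ j := by
    have := N.finite_alphabet
    rcases j with _ | _ | _ | _ | _ | _ | _ | _ <;> dsimp only [SumFam, SearchSymbol] <;> infer_instance
  Λ := N.Λ ⊕ (SearchLabel ⊕ N.Λ × Fin (b + 1))
  σ := N.σ × (α × Bool × Fin (b + 1))
  finiteσ := by have := N.finite_alphabet; infer_instance
  inputStack := .inr .inp
  inputSymbol := Function.Embedding.refl _
  main := .inr (.inl .init)
  start := (N.start, default, false, 0)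
  program l := [Search.program N b C k l]
  -- The flag separates the two ways to halt: cleaning resets the simulated state to `N.start`,
  -- which may be accepting, so the final rejection clears the flag.
  acceptStates := {s | s.1 ∈ N.acceptStates ∧ s.2.2.1 = true}

namespace Search

/-- The configurations at the labels of the search. -/
abbrev cfg (l : SearchLabel) (v : (search N b C k).σ) (S : ∀ j, List (N.Γ j)) (s : Store α b) :
    (search N b C k).Config := ⟨some (.inr (.inl l)), v, joinStk S s.stk⟩

/-- The search runs from `c` to `d` and uses space at most `B` before `d`. -/
def Run (B : ℕ) (c d : (search N b C k).Config) : Prop := ∃ t, (search N b C k).DetRun B t c d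

variable {N b C k}

theorem Run.refl {B : ℕ} (c : (search N b C k).Config) : Run N b C k B c c := ⟨0, .refl _⟩

theorem Run.trans {B : ℕ} {c d e : (search N b C k).Config} (h : Run N b C k B c d)
    (h' : Run N b C k B d e) : Run N b C k B c e := by
  obtain ⟨s, hs⟩ := h
  obtain ⟨t, ht⟩ := h'
  exact ⟨s + t, hs.trans ht⟩

theorem Run.step {B : ℕ} {l : (search N b C k).Λ} {v : (search N b C k).σ}
    {S : ∀ j, List (N.Γ j)} {s : Store α b} {d : (search N b C k).Config}
    (hB : ∑ j, (S j).length + s.size ≤ B)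
    (h : Run N b C k B (stepAux (program N b C k l) v (joinStk S s.stk)) d) :
    Run N b C k B ⟨some l, v, joinStk S s.stk⟩ d := by
  obtain ⟨t, ht⟩ := h
  refine ⟨t + 1, .step rfl ?_ ht⟩
  dsimp only [space]
  rwa [sum_length_joinStk, s.sum_stk]

theorem halted_space {B : ℕ} {v : (search N b C k).σ} {S : ∀ j, List (N.Γ j)} {s : Store α b}
    (hB : ∑ j, (S j).length + s.size ≤ B) :
    (search N b C k).space ⟨none, v, joinStk S s.stk⟩ ≤ B := by
  dsimp only [space]
  rwa [sum_length_joinStk, s.sum_stk]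

variable (N b C k) in
/-- The search runs from `c` to the label `l` with the given contents of the stacks. -/
def RunTo (B : ℕ) (c : (search N b C k).Config) (l : SearchLabel) (S : ∀ j, List (N.Γ j))
    (s : Store α b) : Prop := ∃ v, Run N b C k B c (cfg N b C k l v S s)

theorem RunTo.refl {B : ℕ} (l : SearchLabel) (v : (search N b C k).σ) (S : ∀ j, List (N.Γ j))
    (s : Store α b) : RunTo N b C k B (cfg N b C k l v S s) l S s := ⟨v, .refl _⟩

theorem RunTo.trans {B : ℕ} {c : (search N b C k).Config} {l l' : SearchLabel}
    {S S' : ∀ j, List (N.Γ j)} {s s' : Store α b} (h : RunTo N b C k B c l S s)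
    (h' : ∀ v, RunTo N b C k B (cfg N b C k l v S s) l' S' s') : RunTo N b C k B c l' S' s' := by
  obtain ⟨v, hv⟩ := h
  obtain ⟨v', hv'⟩ := h' v
  exact ⟨v', hv.trans hv'⟩

theorem RunTo.step {B : ℕ} {l : (search N b C k).Λ} {l' : SearchLabel} {v : (search N b C k).σ}
    {S S' : ∀ j, List (N.Γ j)} {s s' : Store α b} (hB : ∑ j, (S j).length + s.size ≤ B)
    (h : RunTo N b C k B (stepAux (program N b C k l) v (joinStk S s.stk)) l' S' s') :
    RunTo N b C k B ⟨some l, v, joinStk S s.stk⟩ l' S' s' := by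
  obtain ⟨v', hv'⟩ := h
  exact ⟨v', .step hB hv'⟩

theorem run_init {B : ℕ} (v : (search N b C k).σ) (S : ∀ j, List (N.Γ j)) (s : Store α b)
    (hB : ∑ j, (S j).length + s.size ≤ B) : Run N b C k B (cfg N b C k .init v S s)
      (cfg N b C k .scan v S { s with
        cnt := List.replicate (C + 1) () ++ s.cnt
        stg := List.replicate k () ++ s.stg
        ch := 0 :: s.ch }) := by
  refine .step hB ?_
  simp only [program, stepAux_pushN, jump, stepAux]
  simp
  exact .refl _

theorem run_scan {B : ℕ} (v : (search N b C k).σ) (S : ∀ j, List (N.Γ j)) (inp sav : List α)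
    (cnt tmp stg : List Unit) (ch us : List (Fin (b + 1)))
    (hB : ∑ j, (S j).length + (Store.mk inp sav cnt tmp stg ch us).size + inp.length ≤ B) :
    RunTo N b C k B (cfg N b C k .scan v S ⟨inp, sav, cnt, tmp, stg, ch, us⟩) .stage S
      ⟨[], inp.reverse ++ sav, List.replicate inp.length () ++ cnt, tmp, stg, ch, us⟩ := by
  induction inp generalizing v sav cnt with
  | nil =>
    refine .step (by omega) ?_
    simpa [program, setLetter, flag, jump] using RunTo.refl _ _ _ _
  | cons x inp ih =>
    simp only [Store.size, List.length_cons] at hB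
    refine .step (by simp only [Store.size, List.length_cons]; omega) ?_
    simpa [program, setLetter, flag, jump, List.replicate_succ'] using
      ih (v.1, x, true, v.2.2.2) (x :: sav) (() :: cnt)
        (by simp only [Store.size, List.length_cons]; omega)

theorem run_inner {B : ℕ} (v : (search N b C k).σ) (S : ∀ j, List (N.Γ j)) (inp sav : List α)
    (cnt tmp stg : List Unit) (ch us : List (Fin (b + 1)))
    (hB : ∑ j, (S j).length + (Store.mk inp sav cnt tmp stg ch us).size + cnt.length ≤ B) :
    RunTo N b C k B (cfg N b C k .inner v S ⟨inp, sav, cnt, tmp, stg, ch, us⟩) .restore S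
      ⟨inp, sav, [], cnt.reverse ++ tmp, stg, ch, List.replicate cnt.length 0 ++ us⟩ := by
  induction cnt generalizing v tmp us with
  | nil =>
    refine .step (by omega) ?_
    simpa [program, setFlag, flag, jump] using RunTo.refl _ _ _ _
  | cons x cnt ih =>
    simp only [Store.size, List.length_cons] at hB
    refine .step (by simp only [Store.size, List.length_cons]; omega) ?_
    simpa [program, setFlag, flag, jump, List.replicate_succ'] using
      ih (v.1, v.2.1, true, v.2.2.2) (() :: tmp) (0 :: us)
        (by simp only [Store.size, List.length_cons]; omega)

theorem run_restore {B : ℕ} (v : (search N b C k).σ) (S : ∀ j, List (N.Γ j)) (inp sav : List α)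
    (cnt tmp stg : List Unit) (ch us : List (Fin (b + 1)))
    (hB : ∑ j, (S j).length + (Store.mk inp sav cnt tmp stg ch us).size ≤ B) :
    RunTo N b C k B (cfg N b C k .restore v S ⟨inp, sav, cnt, tmp, stg, ch, us⟩) .outer S
      ⟨inp, sav, tmp.reverse ++ cnt, [], stg, ch, us⟩ := by
  induction tmp generalizing v cnt with
  | nil =>
    refine .step (by omega) ?_
    simpa [program, setFlag, flag, jump] using RunTo.refl _ _ _ _
  | cons x tmp ih =>
    simp only [Store.size, List.length_cons] at hB
    refine .step (by simp only [Store.size, List.length_cons]; omega) ?_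
    simpa [program, setFlag, flag, jump] using
      ih (v.1, v.2.1, true, v.2.2.2) (() :: cnt)
        (by simp only [Store.size, List.length_cons]; omega)

/-- Multiplication in unary: each symbol of `ch` causes one pass over `cnt`, which adds `cnt.length`
zeros to `us`, and `cnt` is then restored from `tmp`. -/
theorem run_outer {B : ℕ} (v : (search N b C k).σ) (S : ∀ j, List (N.Γ j)) (inp sav : List α)
    (cnt stg : List Unit) (ch us : List (Fin (b + 1)))
    (hB : ∑ j, (S j).length + (Store.mk inp sav cnt [] stg ch us).size +
      ch.length * cnt.length ≤ B) :
    RunTo N b C k B (cfg N b C k .outer v S ⟨inp, sav, cnt, [], stg, ch, us⟩) .back S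
      ⟨inp, sav, cnt, [], stg, [], List.replicate (ch.length * cnt.length) 0 ++ us⟩ := by
  induction ch generalizing v us with
  | nil =>
    refine .step (by omega) ?_
    simpa [program, setFlag, flag, jump] using RunTo.refl _ _ _ _
  | cons x ch ih =>
    simp only [Store.size, List.length_cons, Nat.succ_mul] at hB
    refine .step (by simp only [Store.size, List.length_cons]; omega) ?_
    have h1 := run_inner (C := C) (k := k) (B := B) (v.1, v.2.1, true, v.2.2.2) S inp sav cnt [] stg ch us
      (by simp only [Store.size, List.length_nil] at hB ⊢; omega)
    have h2 := fun v => run_restore (C := C) (k := k) (B := B) v S inp sav [] (cnt.reverse ++ []) stg ch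
      (List.replicate cnt.length 0 ++ us) (by simp [Store.size] at hB ⊢; omega)
    have h3 := fun v => ih v (List.replicate cnt.length 0 ++ us)
      (by simp [Store.size] at hB ⊢; omega)
    simp only [List.append_nil, List.reverse_reverse] at h1 h2
    have h := (h1.trans h2).trans h3
    rw [← List.append_assoc, ← List.replicate_add, ← Nat.succ_mul] at h
    simpa [program, setFlag, flag, jump] using h

theorem run_back {B : ℕ} (v : (search N b C k).σ) (S : ∀ j, List (N.Γ j)) (inp sav : List α)
    (cnt tmp stg : List Unit) (ch us : List (Fin (b + 1)))
    (hB : ∑ j, (S j).length + (Store.mk inp sav cnt tmp stg ch us).size ≤ B) :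
    RunTo N b C k B (cfg N b C k .back v S ⟨inp, sav, cnt, tmp, stg, ch, us⟩) .stage S
      ⟨inp, sav, cnt, tmp, stg, List.replicate us.length 0 ++ ch, []⟩ := by
  induction us generalizing v ch with
  | nil =>
    refine .step (by omega) ?_
    simpa [program, setFlag, flag, jump] using RunTo.refl _ _ _ _
  | cons x us ih =>
    simp only [Store.size, List.length_cons] at hB
    refine .step (by simp only [Store.size, List.length_cons]; omega) ?_
    simpa [program, setFlag, flag, jump, List.replicate_succ'] using
      ih (v.1, v.2.1, true, v.2.2.2) (0 :: ch)
        (by simp only [Store.size, List.length_cons]; omega)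

/-- Each symbol of `stg` multiplies the length of `ch` by `cnt.length`. The factor 2 in the space
bound leaves room for the old and the new string side by side, neither longer than the final one;
this uses that `cnt` is not empty. -/
theorem run_stage {B : ℕ} (v : (search N b C k).σ) (S : ∀ j, List (N.Γ j)) (inp sav : List α)
    (cnt stg : List Unit) (p : ℕ) (hcnt : 1 ≤ cnt.length)
    (hB : ∑ j, (S j).length + inp.length + sav.length + cnt.length + stg.length +
      2 * (p * cnt.length ^ stg.length) ≤ B) :
    RunTo N b C k B (cfg N b C k .stage v S ⟨inp, sav, cnt, [], stg, List.replicate p 0, []⟩)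
      .load S ⟨inp, sav, cnt, [], [], List.replicate (p * cnt.length ^ stg.length) 0, []⟩ := by
  induction stg generalizing v p with
  | nil =>
    refine .step (by simp [Store.size] at hB ⊢; omega) ?_
    simpa [program, setFlag, flag, jump] using RunTo.refl _ _ _ _
  | cons x stg ih =>
    have hp : p ≤ p * cnt.length := Nat.le_mul_of_pos_right _ hcnt
    have hpow : p * cnt.length ≤ p * cnt.length * cnt.length ^ stg.length :=
      Nat.le_mul_of_pos_right _ (Nat.pow_pos hcnt)
    have he : p * cnt.length ^ (stg.length + 1) = p * cnt.length * cnt.length ^ stg.length := by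
      ring
    simp only [List.length_cons, he] at hB ⊢
    refine .step (by simp [Store.size]; omega) ?_
    have h1 := run_outer (C := C) (k := k) (B := B) (v.1, v.2.1, true, v.2.2.2) S inp sav cnt stg
      (List.replicate p 0) [] (by simp [Store.size]; omega)
    have h2 := fun v => run_back (b := b) (C := C) (k := k) (B := B) v S inp sav cnt [] stg []
      (List.replicate (p * cnt.length) 0) (by simp [Store.size]; omega)
    have h3 := fun v => ih v (p * cnt.length) (by omega)
    simp only [List.append_nil, List.length_replicate] at h1 h2
    simpa [program, setFlag, flag, jump] using (h1.trans h2).trans h3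

/-- Loading consumes the saved input, so a second copy is made on `inp`, from which it is saved
again for the next trial. -/
theorem run_load {B : ℕ} (v : (search N b C k).σ) (S : ∀ j, List (N.Γ j)) (inp sav : List α)
    (cnt tmp stg : List Unit) (ch us : List (Fin (b + 1)))
    (hB : ∑ j, (S j).length + (Store.mk inp sav cnt tmp stg ch us).size + sav.length ≤ B) :
    RunTo N b C k B (cfg N b C k .load v S ⟨inp, sav, cnt, tmp, stg, ch, us⟩) .unload
      (Function.update S N.inputStack (sav.reverse.map N.inputSymbol ++ S N.inputStack))
      ⟨sav.reverse ++ inp, [], cnt, tmp, stg, ch, us⟩ := by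
  induction sav generalizing v S inp with
  | nil =>
    refine .step (by omega) ?_
    simpa [program, setLetter, flag, jump] using RunTo.refl _ _ _ _
  | cons x sav ih =>
    simp only [Store.size, List.length_cons] at hB
    refine .step (by simp only [Store.size, List.length_cons]; omega) ?_
    have hS := sum_length_update_cons S N.inputStack (N.inputSymbol x)
    simpa [program, setLetter, flag, jump] using
      ih (v.1, x, true, v.2.2.2) (Function.update S N.inputStack
        (N.inputSymbol x :: S N.inputStack)) (x :: inp)
        (by simp only [Store.size, List.length_cons]; omega)

theorem run_unload {B : ℕ} (v : (search N b C k).σ) (S : ∀ j, List (N.Γ j)) (inp sav : List α)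
    (cnt tmp stg : List Unit) (ch us : List (Fin (b + 1)))
    (hB : ∑ j, (S j).length + (Store.mk inp sav cnt tmp stg ch us).size ≤ B) :
    ∃ y, Run N b C k B (cfg N b C k .unload v S ⟨inp, sav, cnt, tmp, stg, ch, us⟩)
      ⟨some (.inl N.main), (N.start, y), joinStk S
        (Store.mk [] (inp.reverse ++ sav) cnt tmp stg ch us).stk⟩ := by
  induction inp generalizing v sav with
  | nil =>
    refine ⟨(default, false, v.2.2.2), .step (by omega) ?_⟩
    simpa [program, setLetter, flag, jump] using Run.refl _
  | cons x inp ih =>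
    simp only [Store.size, List.length_cons] at hB
    obtain ⟨y, hy⟩ := ih (v.1, x, true, v.2.2.2) (x :: sav)
      (by simp only [Store.size, List.length_cons]; omega)
    refine ⟨y, .step (by simp only [Store.size, List.length_cons]; omega) ?_⟩
    simpa [program, setLetter, flag, jump] using hy

theorem run_rewind {B : ℕ} (v : (search N b C k).σ) (S : ∀ j, List (N.Γ j)) (inp sav : List α)
    (cnt tmp stg : List Unit) (ch us : List (Fin (b + 1)))
    (hB : ∑ j, (S j).length + (Store.mk inp sav cnt tmp stg ch us).size ≤ B) :
    RunTo N b C k B (cfg N b C k .rewind v S ⟨inp, sav, cnt, tmp, stg, ch, us⟩) .inc S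
      ⟨inp, sav, cnt, tmp, stg, us.reverse ++ ch, []⟩ := by
  induction us generalizing v ch with
  | nil =>
    refine .step (by omega) ?_
    simpa [program, setDigit, flag, jump] using RunTo.refl _ _ _ _
  | cons x us ih =>
    simp only [Store.size, List.length_cons] at hB
    refine .step (by simp only [Store.size, List.length_cons]; omega) ?_
    simpa [program, setDigit, flag, jump] using
      ih (v.1, v.2.1, true, x) (x :: ch)
        (by simp only [Store.size, List.length_cons]; omega)

theorem run_carry {B : ℕ} (v : (search N b C k).σ) (S : ∀ j, List (N.Γ j)) (inp sav : List α)
    (cnt tmp stg : List Unit) (ch us : List (Fin (b + 1)))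
    (hB : ∑ j, (S j).length + (Store.mk inp sav cnt tmp stg ch us).size ≤ B) :
    RunTo N b C k B (cfg N b C k .carry v S ⟨inp, sav, cnt, tmp, stg, ch, us⟩) .load S
      ⟨inp, sav, cnt, tmp, stg, us.reverse ++ ch, []⟩ := by
  induction us generalizing v ch with
  | nil =>
    refine .step (by omega) ?_
    simpa [program, setDigit, flag, jump] using RunTo.refl _ _ _ _
  | cons x us ih =>
    simp only [Store.size, List.length_cons] at hB
    refine .step (by simp only [Store.size, List.length_cons]; omega) ?_
    simpa [program, setDigit, flag, jump] using
      ih (v.1, v.2.1, true, x) (x :: ch)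
        (by simp only [Store.size, List.length_cons]; omega)

/-- The next sequence of digits, least significant digit first. -/
def next : List (Fin (b + 1)) → Option (List (Fin (b + 1)))
  | [] => none
  | d :: ds => if d = Fin.last b then (next ds).map (0 :: ·) else some ((d + 1) :: ds)

/-- The value of a sequence of digits. -/
def value : List (Fin (b + 1)) → ℕ
  | [] => 0
  | d :: ds => d + (b + 1) * value ds

theorem value_lt (ds : List (Fin (b + 1))) : value ds < (b + 1) ^ ds.length := by
  induction ds with
  | nil => simp [value]
  | cons d ds ih =>
    simp only [value, List.length_cons, pow_succ']
    have := d.isLt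
    nlinarith

theorem value_injective {ds es : List (Fin (b + 1))} (hl : ds.length = es.length)
    (h : value ds = value es) : ds = es := by
  induction ds generalizing es with
  | nil => exact (List.length_eq_zero_iff.1 hl.symm).symm
  | cons d ds ih =>
    obtain _ | ⟨e, es⟩ := es
    · simp at hl
    · simp only [value] at h
      have h1 := congrArg (· % (b + 1)) h
      have h2 := congrArg (· / (b + 1)) h
      simp only [Nat.add_mul_mod_self_left, Nat.mod_eq_of_lt d.isLt, Nat.mod_eq_of_lt e.isLt] at h1
      simp only [Nat.add_mul_div_left _ _ (Nat.succ_pos b), Nat.div_eq_of_lt d.isLt,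
        Nat.div_eq_of_lt e.isLt, zero_add] at h2
      rw [Fin.ext h1, ih (by simpa using hl) h2]

theorem value_replicate (n : ℕ) : value (List.replicate n (0 : Fin (b + 1))) = 0 := by
  induction n with
  | zero => rfl
  | succ n ih => simp [List.replicate_succ, value, ih]

theorem value_next {ds es : List (Fin (b + 1))} (h : next ds = some es) :
    es.length = ds.length ∧ value es = value ds + 1 := by
  induction ds generalizing es with
  | nil => simp [next] at h
  | cons d ds ih =>
    by_cases hd : d = Fin.last b
    · simp only [next, hd, if_true, Option.map_eq_some_iff] at h
      obtain ⟨fs, hf, rfl⟩ := h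
      obtain ⟨h1, h2⟩ := ih hf
      simp only [List.length_cons, h1, true_and, value, h2, hd, Fin.val_zero, Fin.val_last]
      ring
    · simp only [next, hd, if_false, Option.some.injEq] at h
      subst h
      have : ((d + 1 : Fin (b + 1)) : ℕ) = d + 1 := Fin.val_add_one_of_lt (Fin.lt_last_iff_ne_last.2 hd)
      simp only [List.length_cons, value, this, true_and]
      ring

theorem value_of_next_eq_none {ds : List (Fin (b + 1))} (h : next ds = none) :
    value ds + 1 = (b + 1) ^ ds.length := by
  induction ds with
  | nil => simp [value]
  | cons d ds ih =>
    by_cases hd : d = Fin.last b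
    · simp only [next, hd, if_true, Option.map_eq_none_iff] at h
      have := ih h
      simp only [value, hd, Fin.val_last, List.length_cons, pow_succ', ← this]
      ring
    · simp [next, hd] at h

/-- The `z` zeros on `us` are the maximal digits already passed by the carry; they return to the
front once a digit that can be increased has been found. -/
theorem run_inc_of_some {B : ℕ} (v : (search N b C k).σ) (S : ∀ j, List (N.Γ j))
    (inp sav : List α) (cnt tmp stg : List Unit) (ch ch' : List (Fin (b + 1))) (z : ℕ)
    (hB : ∑ j, (S j).length + (Store.mk inp sav cnt tmp stg ch (List.replicate z 0)).size ≤ B)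
    (h : next ch = some ch') :
    RunTo N b C k B (cfg N b C k .inc v S ⟨inp, sav, cnt, tmp, stg, ch, List.replicate z 0⟩) .load
      S ⟨inp, sav, cnt, tmp, stg, List.replicate z 0 ++ ch', []⟩ := by
  induction ch generalizing v z ch' with
  | nil => simp [next] at h
  | cons d ch ih =>
    refine .step hB ?_
    simp only [Store.size, List.length_cons, List.length_replicate] at hB
    by_cases hd : d = Fin.last b
    · simp only [next, hd, if_true, Option.map_eq_some_iff] at h
      obtain ⟨ch', h, rfl⟩ := h
      have := ih (v.1, v.2.1, true, d) ch' (z + 1)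
        (by simp only [Store.size, List.length_replicate]; omega) h
      rw [show List.replicate (z + 1) (0 : Fin (b + 1)) ++ ch' = List.replicate z 0 ++ 0 :: ch' by
        simp [List.replicate_succ']] at this
      simpa [program, setDigit, flag, jump, hd, List.replicate_succ] using this
    · simp only [next, hd, if_false, Option.some.injEq] at h
      subst h
      have := run_carry (C := C) (k := k) (B := B) (v.1, v.2.1, true, d) S inp sav cnt tmp stg ((d + 1) :: ch)
        (List.replicate z 0)
        (by simp only [Store.size, List.length_replicate, List.length_cons]; omega)
      simpa [program, setDigit, flag, jump, hd] using this

theorem run_inc_of_none {B : ℕ} (v : (search N b C k).σ) (S : ∀ j, List (N.Γ j))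
    (inp sav : List α) (cnt tmp stg : List Unit) (ch : List (Fin (b + 1))) (z : ℕ)
    (hB : ∑ j, (S j).length + (Store.mk inp sav cnt tmp stg ch (List.replicate z 0)).size ≤ B)
    (h : next ch = none) :
    ∃ d, Run N b C k B (cfg N b C k .inc v S ⟨inp, sav, cnt, tmp, stg, ch, List.replicate z 0⟩) d ∧
      (search N b C k).Halted d ∧ (search N b C k).space d ≤ B ∧
      d.var ∉ (search N b C k).acceptStates := by
  induction ch generalizing v z with
  | nil =>
    refine ⟨⟨none, setFlag (setDigit v none) false, joinStk S
      (Store.mk inp sav cnt tmp stg [] (List.replicate z 0)).stk⟩, .step hB ?_, rfl,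
      halted_space hB, by simp [setFlag]⟩
    simpa [program, setDigit, setFlag, flag, jump] using Run.refl _
  | cons e ch ih =>
    by_cases hd : e = Fin.last b
    · simp only [next, hd, if_true, Option.map_eq_none_iff] at h
      obtain ⟨d, hr, hd'⟩ := ih (v.1, v.2.1, true, e) (z + 1)
        (by simp only [Store.size, List.length_replicate, List.length_cons] at hB ⊢; omega) h
      refine ⟨d, .step hB ?_, hd'⟩
      simpa [program, setDigit, flag, jump, hd, List.replicate_succ] using hr
    · simp [next, hd] at h

end Search

end StackMachine

/-! ### Strings of choices and the correctness of the search -/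

namespace StackMachine

open Turing.TM2

variable {α : Type} {N : StackMachine α}

variable (N) in
/-- From `c` the machine is forced to a configuration that has halted or in which there is a choice
to be made. -/
def Settles (c : N.Config) : Prop :=
  ∃ B n d, N.DetRun B n c d ∧ (N.Halted d ∨ ∃ l, d.l = some l ∧ ¬ ∃ q, N.program l = [q])

variable (N) in
/-- The machine accepts from the given configuration if its choices are those of a given
sequence. -/
inductive AcceptsWith {b : ℕ} : List (Fin (b + 1)) → N.Config → Prop
  | halt {ds : List (Fin (b + 1))} {v : N.σ} {S : ∀ k, List (N.Γ k)} (hv : v ∈ N.acceptStates) :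
      AcceptsWith ds ⟨none, v, S⟩
  | det {ds : List (Fin (b + 1))} {l : N.Λ} {v : N.σ} {S : ∀ k, List (N.Γ k)}
      {q : Stmt N.Γ N.Λ N.σ} (hq : N.program l = [q]) (h : AcceptsWith ds (stepAux q v S)) :
      AcceptsWith ds ⟨some l, v, S⟩
  | choice {d : Fin (b + 1)} {ds : List (Fin (b + 1))} {l : N.Λ} {v : N.σ}
      {S : ∀ k, List (N.Γ k)} {q : Stmt N.Γ N.Λ N.σ} (hl : ¬ ∃ q, N.program l = [q])
      (hq : (N.program l)[d.1]? = some q) (h : AcceptsWith ds (stepAux q v S)) :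
      AcceptsWith (d :: ds) ⟨some l, v, S⟩

section AcceptsWith

variable {b : ℕ}

theorem acceptsWith_iff_of_program_eq {ds : List (Fin (b + 1))} {l : N.Λ} {v : N.σ}
    {S : ∀ k, List (N.Γ k)} {q : Stmt N.Γ N.Λ N.σ} (hq : N.program l = [q]) :
    N.AcceptsWith ds ⟨some l, v, S⟩ ↔ N.AcceptsWith ds (stepAux q v S) := by
  refine ⟨fun h => ?_, .det hq⟩
  cases h with
  | det hq' h =>
    obtain rfl : q = _ := by simpa [hq] using hq'
    exact h
  | choice hl => exact (hl ⟨q, hq⟩).elim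

theorem not_acceptsWith_nil {l : N.Λ} {v : N.σ} {S : ∀ k, List (N.Γ k)}
    (hl : ¬ ∃ q, N.program l = [q]) :
    ¬ N.AcceptsWith ([] : List (Fin (b + 1))) ⟨some l, v, S⟩ := by
  intro h
  cases h with
  | det hq => exact hl ⟨_, hq⟩

theorem not_acceptsWith_cons {d : Fin (b + 1)} {ds : List (Fin (b + 1))} {l : N.Λ} {v : N.σ}
    {S : ∀ k, List (N.Γ k)} (hl : ¬ ∃ q, N.program l = [q]) (hd : (N.program l)[d.1]? = none) :
    ¬ N.AcceptsWith (d :: ds) ⟨some l, v, S⟩ := by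
  intro h
  cases h with
  | det hq => exact hl ⟨_, hq⟩
  | choice _ hq => simp [hd] at hq

theorem acceptsWith_cons_iff {d : Fin (b + 1)} {ds : List (Fin (b + 1))} {l : N.Λ} {v : N.σ}
    {S : ∀ k, List (N.Γ k)} {q : Stmt N.Γ N.Λ N.σ} (hl : ¬ ∃ q, N.program l = [q])
    (hd : (N.program l)[d.1]? = some q) :
    N.AcceptsWith (d :: ds) ⟨some l, v, S⟩ ↔ N.AcceptsWith ds (stepAux q v S) := by
  refine ⟨fun h => ?_, .choice hl hd⟩
  cases h with
  | det hq => exact (hl ⟨_, hq⟩).elim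
  | choice _ hq h =>
    obtain rfl : q = _ := by simpa [hd] using hq
    exact h

theorem AcceptsWith.acceptsFrom {ds : List (Fin (b + 1))} {c : N.Config}
    (h : N.AcceptsWith ds c) : N.AcceptsFrom c := by
  induction h with
  | halt hv => exact ⟨_, .refl _, rfl, hv⟩
  | det hq _ ih =>
    obtain ⟨d, hd, ha⟩ := ih
    exact ⟨d, .head (step_iff.2 ⟨_, by simp [hq], rfl⟩) hd, ha⟩
  | choice _ hq _ ih =>
    obtain ⟨d, hd, ha⟩ := ih
    exact ⟨d, .head (step_iff.2 ⟨_, List.mem_of_getElem? hq, rfl⟩) hd, ha⟩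

/-- Record the index of the chosen statement at each choice. Digits left over at the end are never
read, so the string can be padded to length exactly `T`. -/
theorem CostReaches.exists_acceptsWith (hb : ∀ l, (N.program l).length ≤ b + 1) {t T : ℕ}
    {c d : N.Config} (h : N.CostReaches N.choiceCost t c d) (hd : N.Accepting d) (hT : t ≤ T) :
    ∃ ds : List (Fin (b + 1)), ds.length = T ∧ N.AcceptsWith ds c := by
  induction h generalizing T with
  | refl c =>
    obtain ⟨_ | l, v, S⟩ := c
    · exact ⟨List.replicate T 0, by simp, .halt hd.2⟩
    · exact absurd hd.1 (by simp [Halted])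
  | @step n l q v S d hq h ih =>
    by_cases hl : ∃ q, N.program l = [q]
    · obtain ⟨q', hq'⟩ := hl
      obtain rfl : q = q' := by simpa [hq'] using hq
      rw [choiceCost, if_pos ⟨q, hq'⟩, zero_add] at hT
      obtain ⟨ds, hds, ha⟩ := ih hd hT
      exact ⟨ds, hds, .det hq' ha⟩
    · rw [choiceCost, if_neg hl] at hT
      obtain ⟨T, rfl⟩ : ∃ T', T = T' + 1 := ⟨T - 1, by omega⟩
      obtain ⟨ds, hds, ha⟩ := ih (T := T) hd (by omega)
      obtain ⟨i, hi⟩ := List.mem_iff_getElem?.1 hq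
      have hib : i < b + 1 := (List.getElem?_eq_some_iff.1 hi).1.trans_le (hb l)
      exact ⟨⟨i, hib⟩ :: ds, by simp [hds], .choice hl hi ha⟩

end AcceptsWith

namespace Search

variable [Inhabited α] {b C k : ℕ}

theorem program_of_eq {l : N.Λ} {q : Stmt N.Γ N.Λ N.σ} (hq : N.program l = [q]) :
    program N b C k (.inl l) = liftStmt (exit N b) q := by
  have h : ∃ q, N.program l = [q] := ⟨q, hq⟩
  rw [program, dif_pos h]
  congr 1
  exact (List.singleton_inj.1 (hq.symm.trans h.choose_spec)).symm

/-- The configuration of the search that corresponds to a configuration of `N`. -/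
noncomputable abbrev simCfg (s : Store α b) (y : α × Bool × Fin (b + 1)) (c : N.Config) :
    (search N b C k).Config := liftCfg s.stk (exit N b) y c

/-- Forced steps have choice cost 0, so `t` stays the same along the whole run and `hsp` at this `t`
bounds the space of all its configurations. -/
theorem run_lift {B Sp t : ℕ} {c₀ c d : N.Config} {B' m : ℕ}
    (hsp : ∀ c, N.CostReaches N.choiceCost t c₀ c → N.space c ≤ Sp)
    (h : N.DetRun B' m c d) (hc : N.CostReaches N.choiceCost t c₀ c) (s : Store α b)
    (y : α × Bool × Fin (b + 1)) (hB : Sp + s.size ≤ B) (ds : List (Fin (b + 1))) :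
    Run N b C k B (simCfg s y c) (simCfg s y d) ∧ N.CostReaches N.choiceCost t c₀ d ∧
      (N.AcceptsWith ds c ↔ N.AcceptsWith ds d) := by
  induction h with
  | refl => exact ⟨.refl _, hc, Iff.rfl⟩
  | @step n l q v S d hq hB' h ih =>
    have hc' : N.CostReaches N.choiceCost t c₀ (stepAux q v S) := by
      have h0 : N.choiceCost l = 0 := if_pos ⟨q, hq⟩
      have := hc.trans (.step (wt := N.choiceCost) (v := v) (S := S) (q := q) (by simp [hq])
        (.refl _))
      simpa [h0] using this
    obtain ⟨h1, h2, h3⟩ := ih hc'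
    refine ⟨.step (l := .inl l) ((Nat.add_le_add_right (hsp _ hc) _).trans hB) ?_, h2, ?_⟩
    · rw [program_of_eq hq, stepAux_liftStmt]
      exact h1
    · rw [acceptsWith_iff_of_program_eq hq, h3]

theorem simCfg_of_mem {v : N.σ} (hv : v ∈ N.acceptStates) (S : ∀ j, List (N.Γ j))
    (s : Store α b) (y : α × Bool × Fin (b + 1)) :
    (simCfg s y ⟨none, v, S⟩ : (search N b C k).Config) =
      ⟨none, setFlag (v, y) true, joinStk S s.stk⟩ := by
  simp [liftCfg, exit, hv]

theorem simCfg_of_notMem {v : N.σ} (hv : v ∉ N.acceptStates) (S : ∀ j, List (N.Γ j))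
    (s : Store α b) (y : α × Bool × Fin (b + 1)) :
    (simCfg s y ⟨none, v, S⟩ : (search N b C k).Config) = cfg N b C k .clean (v, y) S s := by
  simp [liftCfg, exit, hv, jump]

variable (N b C k) in
/-- The result of the simulation of `N` from the configuration `c`. -/
def Simulates (B Sp : ℕ) (c : N.Config) (y : α × Bool × Fin (b + 1)) (inp sav : List α)
    (cnt tmp stg : List Unit) (ch us : List (Fin (b + 1))) : Prop :=
  (N.AcceptsWith ch c ∧ ∃ d,
      Run N b C k B (simCfg ⟨inp, sav, cnt, tmp, stg, ch, us⟩ y c) d ∧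
      (search N b C k).Halted d ∧ (search N b C k).space d ≤ B ∧
      d.var ∈ (search N b C k).acceptStates) ∨
    (¬ N.AcceptsWith ch c ∧ ∃ S ch' us',
      RunTo N b C k B (simCfg ⟨inp, sav, cnt, tmp, stg, ch, us⟩ y c) .clean S
        ⟨inp, sav, cnt, tmp, stg, ch', us'⟩ ∧
      us'.reverse ++ ch' = us.reverse ++ ch ∧ ∑ j, (S j).length ≤ Sp)

theorem simulates_halted {B Sp : ℕ} {v : N.σ} {S : ∀ j, List (N.Γ j)}
    {y : α × Bool × Fin (b + 1)} {inp sav : List α} {cnt tmp stg : List Unit}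
    {ch us : List (Fin (b + 1))} (hS : ∑ j, (S j).length ≤ Sp)
    (hB : Sp + (Store.mk inp sav cnt tmp stg ch us).size ≤ B) :
    Simulates N b C k B Sp ⟨none, v, S⟩ y inp sav cnt tmp stg ch us := by
  by_cases hv : v ∈ N.acceptStates
  · refine .inl ⟨.halt hv, ?_⟩
    rw [simCfg_of_mem hv]
    exact ⟨_, .refl _, rfl, halted_space ((Nat.add_le_add_right hS _).trans hB), hv, rfl⟩
  · refine .inr ⟨fun h => ?_, S, ch, us, ?_, rfl, hS⟩
    · cases h with
      | halt hv' => exact hv hv'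
    · rw [simCfg_of_notMem hv]
      exact .refl ..

theorem Simulates.of_run {B Sp : ℕ} {c d : N.Config} {y : α × Bool × Fin (b + 1)}
    {inp sav : List α} {cnt tmp stg : List Unit} {ch us : List (Fin (b + 1))}
    (hrun : Run N b C k B (simCfg ⟨inp, sav, cnt, tmp, stg, ch, us⟩ y c)
      (simCfg ⟨inp, sav, cnt, tmp, stg, ch, us⟩ y d))
    (hiff : N.AcceptsWith ch c ↔ N.AcceptsWith ch d)
    (h : Simulates N b C k B Sp d y inp sav cnt tmp stg ch us) :
    Simulates N b C k B Sp c y inp sav cnt tmp stg ch us := by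
  obtain ⟨ha, e, he, h⟩ | ⟨ha, S, ch', us', ⟨v, hr⟩, h⟩ := h
  · exact .inl ⟨hiff.2 ha, e, hrun.trans he, h⟩
  · exact .inr ⟨mt hiff.1 ha, S, ch', us', ⟨v, hrun.trans hr⟩, h⟩

theorem program_of_choice {l : N.Λ} (hl : ¬ ∃ q, N.program l = [q]) :
    program N b C k (.inl l) = .pop (.inr .ch) setDigit (.branch (flag N b)
        (.push (.inr .us) (fun s => s.2.2.2) (.goto fun s => .inr (.inr (l, s.2.2.2))))
        (jump .clean)) := by
  rw [program, dif_neg hl]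

/-- Induction on the unread digits: `N` first settles; then it has halted, or it is at a choice that
consumes the next digit and increases `t` by one. As `t + ch.length` never exceeds `T`, the space
hypothesis applies throughout. -/
theorem simulates {B Sp T : ℕ} {c₀ : N.Config}
    (hsp : ∀ t ≤ T, ∀ c, N.CostReaches N.choiceCost t c₀ c → N.space c ≤ Sp)
    (hset : ∀ t c, N.CostReaches N.choiceCost t c₀ c → N.Settles c) {t : ℕ} {c : N.Config}
    (hc : N.CostReaches N.choiceCost t c₀ c) (inp sav : List α) (cnt tmp stg : List Unit)
    (ch us : List (Fin (b + 1))) (y : α × Bool × Fin (b + 1)) (ht : t + ch.length ≤ T)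
    (hB : Sp + (Store.mk inp sav cnt tmp stg ch us).size ≤ B) :
    Simulates N b C k B Sp c y inp sav cnt tmp stg ch us := by
  induction ch generalizing t c us y with
  | nil =>
    obtain ⟨B', n, d, hd, hd'⟩ := hset t c hc
    obtain ⟨h1, h2, h3⟩ := run_lift (C := C) (k := k) (hsp t (by omega)) hd hc
      ⟨inp, sav, cnt, tmp, stg, [], us⟩ y hB []
    refine .of_run h1 h3 ?_
    have hspd := hsp t (by omega) d h2
    obtain ⟨_ | l, v, S⟩ := d
    · exact simulates_halted hspd hB
    · have hl : ¬ ∃ q, N.program l = [q] := by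
        obtain hd' | ⟨_, hl, hd'⟩ := hd'
        · simp [Halted] at hd'
        · cases hl; exact hd'
      refine .inr ⟨not_acceptsWith_nil hl, S, [], us, ?_, rfl, hspd⟩
      refine .step (l := .inl l) ((Nat.add_le_add_right hspd _).trans hB) ?_
      rw [program_of_choice hl]
      simpa [setDigit, flag, jump] using RunTo.refl _ _ _ _
  | cons e ch ih =>
    obtain ⟨B', n, d, hd, hd'⟩ := hset t c hc
    obtain ⟨h1, h2, h3⟩ := run_lift (C := C) (k := k) (hsp t (by omega)) hd hc
      ⟨inp, sav, cnt, tmp, stg, e :: ch, us⟩ y hB (e :: ch)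
    refine .of_run h1 h3 ?_
    have hspd := hsp t (by omega) d h2
    obtain ⟨_ | l, v, S⟩ := d
    · exact simulates_halted hspd hB
    have hl : ¬ ∃ q, N.program l = [q] := by
      obtain hd' | ⟨_, hl, hd'⟩ := hd'
      · simp [Halted] at hd'
      · cases hl; exact hd'
    have hstep : Run N b C k B
        (simCfg ⟨inp, sav, cnt, tmp, stg, e :: ch, us⟩ y ⟨some l, v, S⟩)
        ⟨some (.inr (.inr (l, e))), (v, y.1, true, e),
          joinStk S (Store.mk inp sav cnt tmp stg ch (e :: us)).stk⟩ := by
      refine .step (l := .inl l) ((Nat.add_le_add_right hspd _).trans hB) ?_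
      rw [program_of_choice hl]
      simpa [setDigit, flag, jump] using Run.refl _
    have hB' : Sp + (Store.mk inp sav cnt tmp stg ch (e :: us)).size ≤ B := by
      simp only [Store.size, List.length_cons] at hB ⊢
      omega
    cases hq : (N.program l)[e.1]? with
    | none =>
      refine .inr ⟨not_acceptsWith_cons hl hq, S, ch, e :: us,
        ⟨(v, y.1, true, e), hstep.trans (.step ((Nat.add_le_add_right hspd _).trans hB') ?_)⟩,
        by simp, hspd⟩
      simpa [program, hq, jump] using Run.refl _
    | some q =>
      have hstep' : Run N b C k B
          (simCfg ⟨inp, sav, cnt, tmp, stg, e :: ch, us⟩ y ⟨some l, v, S⟩)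
          (simCfg ⟨inp, sav, cnt, tmp, stg, ch, e :: us⟩ (y.1, true, e) (stepAux q v S)) := by
        refine hstep.trans (.step ((Nat.add_le_add_right hspd _).trans hB') ?_)
        rw [show program N b C k (.inr (.inr (l, e))) = liftStmt (exit N b) q by
          simp [program, hq], stepAux_liftStmt]
        exact .refl _
      have hc' : N.CostReaches N.choiceCost (t + 1) c₀ (stepAux q v S) := by
        have h0 : N.choiceCost l = 1 := if_neg hl
        have := h2.trans (.step (wt := N.choiceCost) (v := v) (S := S)
          (List.mem_of_getElem? hq) (.refl _))
        simpa [h0] using this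
      have hiff := acceptsWith_cons_iff (v := v) (S := S) (ds := ch) hl hq
      obtain ⟨ha, d, hd, h⟩ | ⟨ha, S', ch', us', ⟨v', hr⟩, hch, h⟩ :=
        ih hc' (e :: us) (y.1, true, e) (by simp at ht; omega) hB'
      · exact .inl ⟨hiff.2 ha, d, hstep'.trans hd, h⟩
      · exact .inr ⟨mt hiff.1 ha, S', ch', us', ⟨v', hstep'.trans hr⟩, by simpa using hch, h⟩

theorem run_clean {B Sp : ℕ} (v : (search N b C k).σ) {S : ∀ j, List (N.Γ j)} {s : Store α b}
    (hS : ∑ j, (S j).length ≤ Sp) (hB : Sp + s.size ≤ B) :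
    RunTo N b C k B (cfg N b C k .clean v S s) .rewind (fun _ => []) s := by
  classical
  obtain ⟨t, -, hr⟩ := DetRun.clean (M := search N b C k) (cl := .inr (.inl .clean))
    (nx := .inr (.inl .rewind)) (ks := stackList N) (mark := fun s => setFlag s true)
    (flag := flag N b) (clear := fun _ => (N.start, default, false, 0)) rfl
    ((Finset.nodup_toList _).map Sum.inl_injective) (fun _ => rfl) (fun _ => rfl) (fun _ => rfl)
    (fun _ => rfl) (B := B) (n := Sp) (v := v) (S := joinStk S s.stk) (fun j hj => by
      obtain ⟨j, -, rfl⟩ := List.mem_map.1 hj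
      exact (Finset.single_le_sum (f := fun j => (S j).length) (fun _ _ => Nat.zero_le _)
        (Finset.mem_univ j)).trans hS) (by
      rw [sum_length_joinStk, s.sum_stk]
      omega)
  refine ⟨(N.start, default, false, 0), t, ?_⟩
  convert hr using 2
  funext j
  cases j <;> simp [stackList]

/-- One trial. Wherever the simulation stops, the digits on `us`, reversed, followed by those on
`ch` still form the original string, so rewinding restores it and the next trial starts with the
same store. -/
theorem run_iteration {B Sp T : ℕ} {w : List α}
    (hsp : ∀ t ≤ T, ∀ c, N.CostReaches N.choiceCost t (N.initial w) c → N.space c ≤ Sp)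
    (hset : ∀ t c, N.CostReaches N.choiceCost t (N.initial w) c → N.Settles c)
    (cnt : List Unit) (hB : Sp + 3 * w.length + cnt.length + T ≤ B)
    (ch : List (Fin (b + 1))) (hch : ch.length = T) (v : (search N b C k).σ) :
    (N.AcceptsWith ch (N.initial w) ∧ ∃ d, Run N b C k B
        (cfg N b C k .load v (fun _ => []) ⟨[], w.reverse, cnt, [], [], ch, []⟩) d ∧
      (search N b C k).Halted d ∧ (search N b C k).space d ≤ B ∧
      d.var ∈ (search N b C k).acceptStates) ∨
    (¬ N.AcceptsWith ch (N.initial w) ∧ RunTo N b C k B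
        (cfg N b C k .load v (fun _ => []) ⟨[], w.reverse, cnt, [], [], ch, []⟩) .inc (fun _ => [])
        ⟨[], w.reverse, cnt, [], [], ch, []⟩) := by
  have h1 := run_load (C := C) (k := k) (B := B) v (fun _ => []) [] w.reverse cnt [] [] ch []
    (by simp [Store.size]; omega)
  obtain ⟨v1, h1⟩ := h1
  have hsum : ∑ j, (Function.update (fun _ => []) N.inputStack (w.map N.inputSymbol) j :
      List (N.Γ j)).length = w.length := by
    have := sum_length_update (fun j => ([] : List (N.Γ j))) N.inputStack (w.map N.inputSymbol)
    simpa using this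
  simp only [List.append_nil, List.reverse_reverse] at h1
  obtain ⟨y, h2⟩ := run_unload (C := C) (k := k) (B := B) v1
    (Function.update (fun _ => []) N.inputStack (w.map N.inputSymbol)) w [] cnt [] [] ch []
    (by simp only [hsum, Store.size, List.length_nil]; omega)
  rw [List.append_nil] at h2
  have h12 := h1.trans h2
  have hsim := simulates (b := b) (C := C) (k := k) (B := B) hsp hset (.refl _) [] w.reverse cnt
    [] [] ch [] y (by omega) (by simp [Store.size]; omega)
  obtain ⟨ha, d, hd, h⟩ | ⟨ha, S, ch', us', hr, hcu, hS⟩ := hsim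
  · exact .inl ⟨ha, d, h12.trans hd, h⟩
  · have hlen : us'.length + ch'.length = T := by
      have := congrArg List.length hcu
      simpa [hch] using this
    have hB' : Sp + (Store.mk [] w.reverse cnt [] [] ch' us').size ≤ B := by
      simp [Store.size]; omega
    obtain ⟨v', hr⟩ := hr
    have h3 : RunTo N b C k B
        (cfg N b C k .load v (fun _ => []) ⟨[], w.reverse, cnt, [], [], ch, []⟩) .clean S
        ⟨[], w.reverse, cnt, [], [], ch', us'⟩ := ⟨v', h12.trans hr⟩
    have h4 := (h3.trans fun v => run_clean v hS hB').trans fun v =>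
      run_rewind v (fun _ => []) [] w.reverse cnt [] [] ch' us' (by simp; omega)
    rw [hcu] at h4
    exact .inr ⟨ha, h4⟩

/-- Here `m` is the number of strings of larger value still to be tried, and the search terminates
because it decreases. A string of length `T` is determined by its value, so after a failed trial
only strictly larger values matter. -/
theorem run_search {B Sp T : ℕ} {w : List α}
    (hsp : ∀ t ≤ T, ∀ c, N.CostReaches N.choiceCost t (N.initial w) c → N.space c ≤ Sp)
    (hset : ∀ t c, N.CostReaches N.choiceCost t (N.initial w) c → N.Settles c)
    (cnt : List Unit) (hB : Sp + 3 * w.length + cnt.length + T ≤ B) (m : ℕ)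
    (ch : List (Fin (b + 1))) (hch : ch.length = T) (hm : value ch + m + 1 = (b + 1) ^ T)
    (v : (search N b C k).σ) :
    ∃ d, Run N b C k B
        (cfg N b C k .load v (fun _ => []) ⟨[], w.reverse, cnt, [], [], ch, []⟩) d ∧
      (search N b C k).Halted d ∧ (search N b C k).space d ≤ B ∧
      (d.var ∈ (search N b C k).acceptStates ↔
        ∃ es : List (Fin (b + 1)), es.length = T ∧ value ch ≤ value es ∧
          N.AcceptsWith es (N.initial w)) := by
  induction m generalizing ch v with
  | zero =>
    obtain ⟨ha, d, hd, hh, hs, hv⟩ | ⟨ha, v', hr⟩ :=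
      run_iteration (C := C) (k := k) hsp hset cnt hB ch hch v
    · exact ⟨d, hd, hh, hs, iff_of_true hv ⟨ch, hch, le_rfl, ha⟩⟩
    · have hn : next ch = none := by
        by_contra hn
        obtain ⟨es, hes⟩ := Option.ne_none_iff_exists'.1 hn
        obtain ⟨h1, h2⟩ := value_next hes
        have := value_lt es
        rw [h1, hch] at this
        omega
      obtain ⟨d, hd, hh, hs, hv⟩ := run_inc_of_none (C := C) (k := k) (B := B) v' (fun _ => []) []
        w.reverse cnt [] [] ch 0 (by simp [Store.size]; omega) hn
      refine ⟨d, hr.trans hd, hh, hs, iff_of_false hv ?_⟩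
      rintro ⟨es, hes, hle, hes'⟩
      have h1 := value_lt es
      rw [hes] at h1
      rw [value_injective (hes.trans hch.symm) (by omega)] at hes'
      exact ha hes'
  | succ m ih =>
    obtain ⟨ha, d, hd, hh, hs, hv⟩ | ⟨ha, hr⟩ :=
      run_iteration (C := C) (k := k) hsp hset cnt hB ch hch v
    · exact ⟨d, hd, hh, hs, iff_of_true hv ⟨ch, hch, le_rfl, ha⟩⟩
    · obtain ⟨ch', hn⟩ : ∃ ch', next ch = some ch' := by
        by_contra! hn
        have := value_of_next_eq_none (Option.eq_none_iff_forall_ne_some.2 hn)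
        rw [hch] at this
        omega
      obtain ⟨h1, h2⟩ := value_next hn
      obtain ⟨v', hr'⟩ := hr.trans fun v => run_inc_of_some v (fun _ => []) [] w.reverse
        cnt [] [] ch ch' 0 (by simp [Store.size]; omega) hn
      obtain ⟨d, hd, hh, hs, hv⟩ := ih ch' (h1.trans hch) (by omega) v'
      refine ⟨d, hr'.trans hd, hh, hs, hv.trans ⟨?_, ?_⟩⟩
      · rintro ⟨es, hes, hle, hes'⟩
        exact ⟨es, hes, by omega, hes'⟩
      · rintro ⟨es, hes, hle, hes'⟩
        refine ⟨es, hes, ?_, hes'⟩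
        by_contra hlt
        rw [value_injective (hes.trans hch.symm) (by omega)] at hes'
        exact ha hes'

theorem initial_eq (w : List α) : (search N b C k).initial w =
    cfg N b C k .init (N.start, default, false, 0) (fun _ => [])
      ⟨w, [], [], [], [], [], []⟩ := by
  rw [initial]
  congr 1
  rw [eq_joinStk (Function.update _ _ _)]
  congr 1
  funext j
  rcases j with _ | _ | _ | _ | _ | _ | _
  · exact List.map_id w
  all_goals rfl

theorem run_initial {B Sp : ℕ} {w : List α}
    (hsp : ∀ t ≤ (w.length + C + 1) ^ k, ∀ c, N.CostReaches N.choiceCost t (N.initial w) c →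
      N.space c ≤ Sp)
    (hset : ∀ t c, N.CostReaches N.choiceCost t (N.initial w) c → N.Settles c)
    (hB : Sp + 3 * w.length + (w.length + C + 1) + k + 2 * (w.length + C + 1) ^ k + 1 ≤ B) :
    ∃ d, Run N b C k B ((search N b C k).initial w) d ∧
      (search N b C k).Halted d ∧ (search N b C k).space d ≤ B ∧
      (d.var ∈ (search N b C k).acceptStates ↔
        ∃ es : List (Fin (b + 1)), es.length = (w.length + C + 1) ^ k ∧
          N.AcceptsWith es (N.initial w)) := by
  rw [initial_eq]
  have h1 := run_init (B := B) (b := b) (C := C) (k := k) (N.start, default, false, 0)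
    (fun _ => []) ⟨w, [], [], [], [], [], []⟩ (by simp [Store.size]; omega)
  have h2 := run_scan (B := B) (C := C) (k := k) (N.start, default, false, 0) (fun _ => []) w []
    (List.replicate (C + 1) () ++ []) [] (List.replicate k () ++ []) [(0 : Fin (b + 1))] []
    (by simp [Store.size]; omega)
  obtain ⟨v, h3⟩ := h2.trans fun v => run_stage (b := b) (B := B) v (fun _ => []) []
    (w.reverse ++ []) (List.replicate w.length () ++ (List.replicate (C + 1) () ++ []))
    (List.replicate k () ++ []) 1 (by simp; omega)
    (by simp [← add_assoc]; omega)
  obtain ⟨d, hd, hh, hs, hv⟩ := run_search (C := C) (k := k) (B := B) hsp hset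
    (List.replicate w.length () ++ (List.replicate (C + 1) () ++ [])) (by simp; omega)
    -- The string of zeros has value 0, so all other strings are still to come.
    ((b + 1) ^ ((w.length + C + 1) ^ k) - 1)
    (List.replicate ((w.length + C + 1) ^ k) (0 : Fin (b + 1))) (by simp)
    (by
      have : 0 < (b + 1) ^ ((w.length + C + 1) ^ k) := by positivity
      rw [value_replicate]
      omega) v
  refine ⟨d, h1.trans (h3.trans ?_), hh, hs, hv.trans ?_⟩
  · simpa [← add_assoc] using hd
  · simp [value_replicate]

end Search

end StackMachine

open StackMachine in
/-- A language is in **PSPACE** if it is accepted by a nondeterministic machine that makes at most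
polynomially many choices on the accepted words, settles after each choice, and whose space is
bounded by a polynomial in the length of the input and the number of choices. -/
theorem InPSPACE.of_choices {α : Type} [Inhabited α] {L : Set (List α)} (N : StackMachine α)
    {T : ℕ → ℕ} (hT : PolyBdd T) (p : Polynomial ℕ)
    (hsp : ∀ w t c, N.CostReaches N.choiceCost t (N.initial w) c →
      N.space c ≤ p.eval (w.length + t))
    (hset : ∀ w t c, N.CostReaches N.choiceCost t (N.initial w) c → N.Settles c)
    (hsound : ∀ w, N.Accepts w → w ∈ L)
    (hcomplete : ∀ w ∈ L, ∃ d, N.CostWithin N.choiceCost (T w.length) (N.initial w) d ∧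
      N.Accepting d) : InPSPACE L := by
  obtain ⟨C, k, hCk⟩ := hT.exists_pow
  -- Digits from 0 to `b` suffice to name the alternatives at every label.
  obtain ⟨b, hb⟩ : ∃ b, ∀ l, (N.program l).length ≤ b + 1 := by
    cases nonempty_fintype N.Λ
    refine ⟨∑ l, (N.program l).length, fun l => Nat.le_succ_of_le ?_⟩
    exact Finset.single_le_sum (f := fun l => (N.program l).length) (fun _ _ => Nat.zero_le _)
      (Finset.mem_univ l)
  let P : ℕ → ℕ := fun n => (n + C + 1) ^ k
  have hP : PolyBdd P := ((PolyBdd.id.add (.const C)).add (.const 1)).pow k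
  obtain ⟨q, hq⟩ : PolyBdd fun n => p.eval (n + P n) + 3 * n + (n + C + 1) + k + 2 * P n + 1 :=
    (((((PolyBdd.eval_comp p (PolyBdd.id.add hP)).add ((PolyBdd.const 3).mul .id)).add
      ((PolyBdd.id.add (.const C)).add (.const 1))).add (.const k)).add
      ((PolyBdd.const 2).mul hP)).add (.const 1)
  have hrun : ∀ w : List α, ∃ d, Search.Run N b C k (q.eval w.length)
      ((search N b C k).initial w) d ∧
      (search N b C k).Halted d ∧ (search N b C k).space d ≤ q.eval w.length ∧
      (d.var ∈ (search N b C k).acceptStates ↔ w ∈ L) := by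
    intro w
    obtain ⟨d, hd, hh, hs, hv⟩ := Search.run_initial (N := N) (b := b) (C := C) (k := k)
      (B := q.eval w.length) (Sp := p.eval (w.length + P w.length)) (w := w)
      (fun t ht c hc => (hsp w t c hc).trans (p.eval_mono_nat (Nat.add_le_add_left ht _)))
      (hset w) (hq w.length)
    refine ⟨d, hd, hh, hs, hv.trans ⟨?_, fun hw => ?_⟩⟩
    · rintro ⟨es, -, h⟩
      exact hsound w h.acceptsFrom
    · obtain ⟨d, ⟨t, ht, hd⟩, ha⟩ := hcomplete w hw
      exact hd.exists_acceptsWith hb ha (ht.trans (hCk _))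
  refine ⟨search N b C k, q, fun l => ⟨_, rfl⟩, fun w => ?_, fun w c hc => ?_, fun w => ?_⟩
  · obtain ⟨d, ⟨t, hd⟩, hh, -⟩ := hrun w
    exact ⟨d, hd.reaches, hh⟩
  · obtain ⟨d, ⟨t, hd⟩, hh, hs, -⟩ := hrun w
    obtain h | h := hd.space_le_or_reaches hc
    · exact h
    · rwa [hh.eq_of_reaches h]
  · obtain ⟨d, ⟨t, hd⟩, hh, -, hv⟩ := hrun w
    rw [accepts_iff_acceptsFrom, hd.acceptsFrom_iff, hh.acceptsFrom_iff, hv]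

/-! ### Settling and space of the guessing machine, and the result for **PSPACE** -/

namespace StackMachine

open Turing.TM2

theorem DetRun.settles {α : Type} {M : StackMachine α} {B n : ℕ} {c d : M.Config}
    (h : M.DetRun B n c d) (hd : M.Settles d) : M.Settles c := by
  obtain ⟨B', n', e, he, h'⟩ := hd
  exact ⟨max B B', n + n', e, (h.mono (le_max_left _ _)).trans (he.mono (le_max_right _ _)), h'⟩

namespace Guess

variable {α : Type} [Fintype α] {M : StackMachine (α × Bool)}
  {G : Type*} [Group G] {φ : FreeGroup α →* G}

theorem not_program_eq_of_choiceCost {l : (guess M).Λ} (h : (guess M).choiceCost l = 1) :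
    ¬ ∃ q, (guess M).program l = [q] := fun h' => by
  rw [choiceCost, if_pos h'] at h
  exact zero_ne_one h

theorem settles_of_choiceCost {l : (guess M).Λ} {v : (guess M).σ}
    {S : ∀ k, List ((guess M).Γ k)} (h : (guess M).choiceCost l = 1) :
    (guess M).Settles ⟨some l, v, S⟩ :=
  ⟨0, 0, _, .refl _, .inr ⟨l, rfl, not_program_eq_of_choiceCost h⟩⟩

theorem settles_clean (v : (guess M).σ) (S : ∀ k, List (M.Γ k)) (L R : GroupWord α) :
    (guess M).Settles ⟨some (.inr .clean), v, joinStk S (wordStk L R)⟩ := by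
  obtain ⟨t, -, hr⟩ := DetRun.clean (M := guess M) (cl := .inr .clean) (nx := .inr .main)
    (ks := stackList M) (mark := fun s => (s.1, true)) (flag := fun s => s.2)
    (clear := fun _ => (M.start, false)) rfl (nodup_stackList M) (fun _ => rfl) (fun _ => rfl)
    (fun _ => rfl) (fun _ => rfl) (n := ∑ k, (joinStk S (wordStk L R) k).length) (v := v)
    (S := joinStk S (wordStk L R))
    (fun k _ => Finset.single_le_sum (f := fun k => (joinStk S (wordStk L R) k).length)
      (fun _ _ => Nat.zero_le _) (Finset.mem_univ k)) le_rfl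
  exact hr.settles (settles_of_choiceCost choiceCost_main)

theorem DetRun.liftCfg {B n : ℕ} {c d : M.Config} (h : M.DetRun B n c d) (L R : GroupWord α) :
    (guess M).DetRun (B + (L.length + R.length)) n (liftCfg (wordStk L R) (exit M) false c)
      (liftCfg (wordStk L R) (exit M) false d) := by
  induction h with
  | refl => exact .refl _
  | @step n l q v S d hq hB h ih =>
    refine .step (q := liftStmt (exit M) q) ?_ ?_ ?_
    · simp [program, hq]
    · rw [space, sum_length_joinStk, sum_wordStk]
      exact Nat.add_le_add_right hB _
    · rwa [stepAux_liftStmt]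

/-- Only the runs of `M` and the cleaning loop matter. Every configuration on the run of the
deterministic `M` on `r` is forced to the same halting configuration; after it `guess` has halted or
cleans up and arrives at the main label, where there is a choice. -/
theorem Inv.settles [Nonempty α] {w : GroupWord α} {t : ℕ} {c : (guess M).Config}
    (h : Inv M φ w t c) (hM : M.IsDeterministic)
    (hhalt : ∀ w, ∃ c, M.Reaches (M.initial w) c ∧ M.Halted c) {p : ℕ → ℕ}
    (hsp : ∀ w c, M.Reaches (M.initial w) c → M.space c ≤ p w.length) :
    (guess M).Settles c := by
  cases h with
  | main => exact settles_of_choiceCost choiceCost_main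
  | gen => exact settles_of_choiceCost (choiceCost_gen _)
  | clean => exact settles_clean _ _ _ _
  | halt => exact ⟨0, 0, _, .refl _, .inl rfl⟩
  | @run r L R l v S hr hc =>
    obtain ⟨d, hd, hh⟩ := hhalt r
    obtain ⟨n, hn⟩ := hM.exists_detRun hd (hsp r)
    have hcd : M.Reaches ⟨some l, v, S⟩ d := by
      obtain h | h := hn.reaches_or_reaches hc
      · exact h
      · rw [hh.eq_of_reaches h]; exact .refl _
    obtain ⟨n, hn⟩ := hM.exists_detRun hcd fun e he => hsp r e (hc.trans he)
    refine (DetRun.liftCfg hn L R).settles ?_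
    obtain ⟨_ | l', v', S'⟩ := d
    · by_cases hv : v' ∈ M.acceptStates
      · simp only [StackMachine.liftCfg, exit, stepAux, hv, decide_true, cond_true]
        exact settles_clean _ _ _ _
      · simp only [StackMachine.liftCfg, exit, stepAux, hv, decide_false, cond_false]
        exact ⟨0, 0, _, .refl _, .inl rfl⟩
    · exact absurd hh (by simp [Halted])

omit [Fintype α] in
theorem StkLe.sum_le {t : ℕ} {S : ∀ k, List (M.Γ k)} (h : StkLe M t S) {p : ℕ → ℕ}
    (hp : Monotone p) (hsp : ∀ w c, M.Reaches (M.initial w) c → M.space c ≤ p w.length) :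
    ∑ k, (S k).length ≤ p t := by
  obtain ⟨r, hr, c, hc, h⟩ := h
  exact (Finset.sum_le_sum fun k _ => h k).trans ((hsp r c hc).trans (hp hr))

/-- The inputs handed to `M` have length at most `t`, which gives the first summand; the second one
bounds the guessed word. -/
theorem Inv.space_le {w : GroupWord α} {t : ℕ} {c : (guess M).Config}
    (h : Inv M φ w t c) {p : ℕ → ℕ} (hp : Monotone p)
    (hsp : ∀ w c, M.Reaches (M.initial w) c → M.space c ≤ p w.length) :
    (guess M).space c ≤ p t + (w.length + 2 * t) := by
  cases h with
  | main hlen =>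
    rw [space, sum_length_joinStk, sum_wordStk]
    exact Nat.add_le_add ((stkLe_nil M t).sum_le hp hsp) hlen
  | clean hS hlen =>
    rw [space, sum_length_joinStk, sum_wordStk]
    exact Nat.add_le_add (hS.sum_le hp hsp) hlen
  | halt hS hlen =>
    rw [space, sum_length_joinStk, sum_wordStk]
    exact Nat.add_le_add (hS.sum_le hp hsp) hlen
  | run hr hc hlen =>
    rw [space, sum_length_joinStk, sum_wordStk]
    exact Nat.add_le_add (StkLe.sum_le ⟨_, hr, _, hc, fun _ => le_rfl⟩ hp hsp) hlen
  | @gen s r L R hr hlen =>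
    rw [space, sum_length_joinStk, sum_wordStk]
    refine Nat.add_le_add (StkLe.sum_le ⟨_, hr, _, .refl _, fun _ => le_rfl⟩ hp hsp) ?_
    cases s <;> simp <;> omega

end Guess

end StackMachine

-- Charging only choices makes the possibly very long runs of the deterministic machine `M` free, so
-- the number of choices is polynomial, and `InPSPACE.of_choices` applies.
open StackMachine in
theorem InPSPACE.of_products {α : Type} [Fintype α] [Nonempty α] {G : Type*} [Group G]
    {φ : FreeGroup α →* G} {R : Set (GroupWord α)} (hR : InPSPACE R)
    (hφ : ∀ r ∈ R, φ (.mk r) = 1) {b : ℕ → ℕ} (hb : PolyBdd b)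
    (hprod : ∀ W : GroupWord α, φ (.mk W) = 1 → ∃ cs : List (GroupWord α × GroupWord α × Bool),
      cs.length ≤ b W.length ∧
      (∀ c ∈ cs, c.1.length ≤ b W.length ∧ c.2.1.length ≤ b W.length ∧ c.2.1 ∈ R) ∧
      (cs.map fun c => FreeGroup.mk (Guess.conjWord c.1 c.2.1 c.2.2)).prod = FreeGroup.mk W) :
    InPSPACE {W : GroupWord α | φ (.mk W) = 1} := by
  obtain ⟨M, p, hdet, hhalt, hsp, hacc⟩ := hR
  have hM : ∀ r, M.Accepts r → φ (.mk r) = 1 := fun r hr => hφ r ((hacc r).2 hr)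
  have : Inhabited (α × Bool) := ⟨(Classical.arbitrary α, true)⟩
  -- Steps of `M` cost nothing here; `p (b n)` bounds the stacks that have to be emptied after its
  -- run.
  let P : ℕ → ℕ := fun n => p.eval (b n) + 1
  let X : ℕ → ℕ := fun n => n + b n * (3 * b n)
  have hP : PolyBdd P := (PolyBdd.eval_comp p hb).add (.const 1)
  have hX : PolyBdd X := PolyBdd.id.add (hb.mul ((PolyBdd.const 3).mul hb))
  have hT : PolyBdd fun n => b n * (4 * b n + 2 + P n) + (3 * X n + 1) * X n + 1 :=
    ((hb.mul ((((PolyBdd.const 4).mul hb).add (.const 2)).add hP)).add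
      ((((PolyBdd.const 3).mul hX).add (.const 1)).mul hX)).add (.const 1)
  have hinv : ∀ (w : GroupWord α) (t c),
      (guess M).CostReaches (guess M).choiceCost t ((guess M).initial w) c →
      Guess.Inv M φ w t c := fun w t c h => by
    simpa using (Guess.inv_initial w).costReaches hM h
  refine InPSPACE.of_choices (guess M) hT (p + 2 * Polynomial.X) (fun w t c h => ?_)
    (fun w t c h => (hinv w t c h).settles hdet hhalt (p := fun n => p.eval n) hsp)
    (fun w => Guess.map_mk_of_accepts hM) fun W hW => ?_
  · refine ((hinv w t c h).space_le p.eval_mono_nat hsp).trans ?_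
    have := p.eval_mono_nat (Nat.le_add_left t w.length)
    simp only [Polynomial.eval_add, Polynomial.eval_mul, Polynomial.eval_ofNat,
      Polynomial.eval_X] at this ⊢
    omega
  · obtain ⟨cs, hlen, hcs, hcW⟩ := hprod W hW
    have hwt := (guess M).choiceCost_le_one
    obtain ⟨d, hd, ha⟩ := Guess.cost_accept (M := M) hwt
      (b := b W.length) (P := P W.length) cs (fun c hc => ⟨(hcs c hc).1, (hcs c hc).2.1⟩)
      (fun c hc L R => by
        obtain ⟨d, hd, ha⟩ := (hacc _).1 (hcs c hc).2.2
        have hlen := ((hsp _ d hd).trans (p.eval_mono_nat (hcs c hc).2.1))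
        obtain ⟨n, hd⟩ := hd
        refine (Guess.cost_run hwt (ω := 0) (fun l => ?_) hd ha
          (b := p.eval (b W.length)) (fun k => (length_le_space d k).trans hlen) L R).mono ?_
        · obtain ⟨q, hq⟩ := hdet l
          rw [choiceCost, if_pos ⟨liftStmt (Guess.exit M) q, by simp [Guess.program, hq]⟩]
        · simp [P]) W hcW
    rw [← Guess.initial_eq] at hd
    refine ⟨d, hd.mono ?_, ha⟩
    have hX' : W.length + cs.length * (3 * b W.length) ≤ X W.length :=
      Nat.add_le_add_left (Nat.mul_le_mul_right _ hlen) _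
    exact Nat.add_le_add (Nat.add_le_add (Nat.mul_le_mul_right _ hlen)
      (Nat.mul_le_mul (Nat.add_le_add_right (Nat.mul_le_mul_left 3 hX') 1) hX')) le_rfl

/-! ## Diagrams and products of conjugates of relators -/

namespace VanKampenDiagram

open StackMachine

variable {α : Type} {R : Set (GroupWord α)} (Δ : VanKampenDiagram R)

/-- The inverse of an oriented edge. -/
def inv (d : Δ.E × Bool) : Δ.E × Bool := (d.1, !d.2)

@[simp] theorem inv_inv (d : Δ.E × Bool) : Δ.inv (Δ.inv d) = d := by simp [inv]

theorem eq_or_eq_inv {d e : Δ.E × Bool} (h : e.1 = d.1) : e = d ∨ e = Δ.inv d := by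
  obtain ⟨d1, d2⟩ := d
  obtain ⟨e1, e2⟩ := e
  cases h
  cases d2 <;> cases e2 <;> simp [inv]

theorem dartLabel_inv (d : Δ.E × Bool) : Δ.dartLabel (Δ.inv d) = invLetter (Δ.dartLabel d) := by
  obtain ⟨e, _ | _⟩ := d <;> simp [dartLabel, inv, orientedLabel, invLetter]

theorem mk_dartLabel_inv (d : Δ.E × Bool) :
    FreeGroup.mk [Δ.dartLabel (Δ.inv d)] = (FreeGroup.mk [Δ.dartLabel d])⁻¹ := by
  rw [dartLabel_inv, FreeGroup.inv_mk]; rfl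

/-- The endpoint of an oriented edge. -/
def target (d : Δ.E × Bool) : Δ.V := Δ.origin (Δ.inv d)

theorem target_inv (d : Δ.E × Bool) : Δ.target (Δ.inv d) = Δ.origin d := by simp [target]

/-- The face to the left of an oriented edge. -/
noncomputable def face (d : Δ.E × Bool) : Option Δ.F := (Δ.boundary_unique d).choose

theorem mem_boundary {d : Δ.E × Bool} {f : Option Δ.F} : d ∈ Δ.boundary f ↔ Δ.face d = f :=
  ⟨fun h => ((Δ.boundary_unique d).choose_spec.2 f h).symm, fun h =>
    h ▸ (Δ.boundary_unique d).choose_spec.1⟩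

theorem face_next (d : Δ.E × Bool) : Δ.face (Δ.next d) = Δ.face d := by
  rw [← mem_boundary, ← List.mem_rotate (n := 1), ← Δ.boundary_next]
  exact List.mem_map_of_mem (Δ.mem_boundary.2 rfl)

theorem origin_next (d : Δ.E × Bool) : Δ.origin (Δ.next d) = Δ.target d :=
  ((Δ.origin_eq_iff _ _).2 ⟨1, by simp [inv]⟩).symm

/-- The list of oriented edges is a path from `u` to `v`. -/
def IsWalk : Δ.V → List (Δ.E × Bool) → Δ.V → Prop
  | u, [], v => u = v
  | u, d :: p, v => Δ.origin d = u ∧ IsWalk (Δ.target d) p v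

theorem isWalk_append {u v : Δ.V} {p q : List (Δ.E × Bool)} :
    Δ.IsWalk u (p ++ q) v ↔ ∃ w, Δ.IsWalk u p w ∧ Δ.IsWalk w q v := by
  induction p generalizing u with
  | nil => simp [IsWalk]
  | cons d p ih => simp [IsWalk, ih, and_assoc]

theorem isWalk_of_map_next {x y : Δ.E × Bool} {l : List (Δ.E × Bool)}
    (h : (x :: l).map Δ.next = l ++ [y]) : Δ.IsWalk (Δ.origin x) (x :: l) (Δ.origin y) := by
  induction l generalizing x with
  | nil =>
    have h : Δ.next x = y := by simpa using h
    exact ⟨rfl, by rw [← h]; exact (Δ.origin_next x).symm⟩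
  | cons z l ih =>
    rw [List.map_cons, List.cons_append, List.cons.injEq] at h
    refine ⟨rfl, ?_⟩
    rw [← origin_next, h.1]
    exact ih h.2

theorem exists_isWalk_boundary (f : Option Δ.F) : ∃ v, Δ.IsWalk v (Δ.boundary f) v := by
  have h := Δ.boundary_next f
  cases hb : Δ.boundary f with
  | nil => exact ⟨Δ.nonempty_vertices.some, rfl⟩
  | cons x l =>
    rw [hb, List.rotate_cons_succ, List.rotate_zero] at h
    exact ⟨_, Δ.isWalk_of_map_next h⟩

theorem boundary_ne_nil (hR : ∀ r ∈ R, r ≠ []) (f : Δ.F) : Δ.boundary (some f) ≠ [] := by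
  intro h
  obtain ⟨r, hr, h' | h'⟩ := Δ.relator f
  · exact hR r hr (by rw [← h', h]; rfl)
  · refine hR r hr ?_
    rw [← FreeGroup.invRev_invRev (L₁ := r), ← h', h]; rfl

/-- Any two vertices are joined by a path of edges outside `S`. -/
def ConnectedOff (S : Finset Δ.E) : Prop :=
  ∀ u v, Relation.ReflTransGen
    (fun x y => ∃ d : Δ.E × Bool, d.1 ∉ S ∧ Δ.origin d = x ∧ Δ.target d = y) u v

variable {Δ}

theorem ConnectedOff.exists_crossing {S : Finset Δ.E} (h : Δ.ConnectedOff S) {q : Δ.V → Prop}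
    {u v : Δ.V} (hu : q u) (hv : ¬ q v) :
    ∃ d, d.1 ∉ S ∧ q (Δ.origin d) ∧ ¬ q (Δ.target d) := by
  by_contra! hq
  refine hv ?_
  clear hv
  induction h u v with
  | refl => exact hu
  | tail _ h ih => obtain ⟨d, hd, rfl, rfl⟩ := h; exact hq d hd ih

variable (Δ)

/-- Connectedness of the dual graph. If no edge led out of `A`, then rotation around a vertex and
passage along an edge would both preserve the property that the face on the left is in `A`. Starting
from an edge of the outer boundary, connectedness would carry it to all oriented edges, hence to the
face `f`. -/
theorem exists_dual_crossing (hR : ∀ r ∈ R, r ≠ []) {A : Finset (Option Δ.F)} (hA : none ∈ A)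
    {f : Option Δ.F} (hf : f ∉ A) : ∃ d, Δ.face d ∈ A ∧ Δ.face (Δ.inv d) ∉ A := by
  by_contra! h
  have hstep : ∀ (n : ℕ) (d : Δ.E × Bool), Δ.face d ∈ A →
      Δ.face ((fun x => Δ.next (x.1, !x.2))^[n] d) ∈ A := by
    intro n
    induction n with
    | zero => exact fun d hd => hd
    | succ n ih =>
      intro d hd
      rw [Function.iterate_succ_apply]
      refine ih _ ?_
      rw [face_next]
      exact h d hd
  have horbit : ∀ d e, Δ.face d ∈ A → Δ.origin d = Δ.origin e → Δ.face e ∈ A := by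
    intro d e hd he
    obtain ⟨n, rfl⟩ := (Δ.origin_eq_iff d e).1 he
    exact hstep n d hd
  obtain _ | f := f
  · exact hf hA
  obtain ⟨d, hd⟩ := List.exists_mem_of_ne_nil _ (Δ.boundary_ne_nil hR f)
  obtain ⟨e, he⟩ := List.exists_mem_of_ne_nil _ (Δ.outer_nonempty ⟨d.1⟩)
  rw [mem_boundary] at hd he
  have hq : ∀ v, Relation.ReflTransGen
      (fun x y => ∃ d : Δ.E × Bool, Δ.origin d = x ∧ Δ.origin (d.1, !d.2) = y) (Δ.origin e) v →
      ∃ x, Δ.origin x = v ∧ Δ.face x ∈ A := by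
    intro v hv
    induction hv with
    | refl => exact ⟨e, rfl, he ▸ hA⟩
    | tail _ hs ih =>
      obtain ⟨y, hy, rfl⟩ := hs
      obtain ⟨x, hx, hxA⟩ := ih
      exact ⟨_, rfl, h y (horbit x y hxA (hx.trans hy.symm))⟩
  obtain ⟨x, hx, hxA⟩ := hq (Δ.origin d) (Δ.connected _ _)
  exact hf (hd ▸ horbit x d hxA hx)

/-- The edges outside `S` form a spanning tree if there are few enough of them, and closed paths in
it have trivial labels. -/
theorem mk_eq_one_of_isWalk {S : Finset Δ.E} (hS : Δ.ConnectedOff S)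
    (hcard : Fintype.card Δ.E + 1 = Fintype.card Δ.V + S.card) {v : Δ.V}
    {P : List (Δ.E × Bool)} (hP : Δ.IsWalk v P v) (hPS : ∀ d ∈ P, d.1 ∉ S) :
    FreeGroup.mk (P.map Δ.dartLabel) = 1 := by
  classical
  -- Grow a tree with edges `T` outside `S` and vertices `U`, together with a potential `φ` in the
  -- free group whose change along each tree edge is the label of that edge. Along a path in the
  -- tree the labels telescope.
  have key : ∀ n : ℕ, n + 1 ≤ Fintype.card Δ.V → ∃ (U : Finset Δ.V) (T : Finset Δ.E)
      (φ : Δ.V → FreeGroup α), U.card = n + 1 ∧ T.card = n ∧ Disjoint T S ∧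
      ∀ d : Δ.E × Bool, d.1 ∈ T → Δ.origin d ∈ U ∧
        φ (Δ.target d) = φ (Δ.origin d) * .mk [Δ.dartLabel d] := by
    intro n
    induction n with
    | zero =>
      exact fun _ => ⟨{v}, ∅, fun _ => 1, by simp, by simp, by simp, by simp⟩
    | succ n ih =>
      intro hn
      obtain ⟨U, T, φ, hU, hT, hTS, h⟩ := ih (by omega)
      obtain ⟨u, hu⟩ : U.Nonempty := by rw [← Finset.card_pos]; omega
      obtain ⟨w, hw⟩ : ∃ w, w ∉ U := by
        by_contra! hall
        have := Finset.card_le_card (fun x _ => hall x : Finset.univ ⊆ U)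
        rw [Finset.card_univ] at this
        omega
      obtain ⟨x, hxS, hx, hx'⟩ := hS.exists_crossing (q := fun v => v ∈ U) hu hw
      have hxT : x.1 ∉ T := fun hT => hx' (h (Δ.inv x) hT).1
      have hψ : ∀ v ∈ U, Function.update φ (Δ.target x) (φ (Δ.origin x) * .mk [Δ.dartLabel x]) v =
          φ v := fun v hv => Function.update_of_ne (by rintro rfl; exact hx' hv) _ _
      refine ⟨insert (Δ.target x) U, insert x.1 T,
        Function.update φ (Δ.target x) (φ (Δ.origin x) * .mk [Δ.dartLabel x]),
        by rw [Finset.card_insert_of_notMem hx', hU], by rw [Finset.card_insert_of_notMem hxT, hT],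
        by simp [hTS, hxS], fun d hd => ?_⟩
      obtain hd | hd := Finset.mem_insert.1 hd
      · obtain rfl | rfl := Δ.eq_or_eq_inv hd
        · exact ⟨by simp [hx], by rw [Function.update_self, hψ _ hx]⟩
        · refine ⟨by simp [target], ?_⟩
          rw [target_inv, hψ _ hx, show Δ.origin (Δ.inv x) = Δ.target x from rfl,
            Function.update_self, mk_dartLabel_inv, mul_inv_cancel_right]
      · have h1 := (h d hd).1
        have h2 : Δ.target d ∈ U := (h (Δ.inv d) hd).1
        exact ⟨Finset.mem_insert_of_mem h1, by rw [hψ _ h1, hψ _ h2, (h d hd).2]⟩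
  have hV : 0 < Fintype.card Δ.V := Fintype.card_pos_iff.2 ⟨v⟩
  obtain ⟨U, T, φ, -, hT, hTS, h⟩ := key (Fintype.card Δ.V - 1) (by omega)
  -- The tree that reaches all vertices has `|V| - 1` edges, which by `hcard` is the number of edges
  -- outside `S`.
  have hTS' : T = Sᶜ := by
    refine Finset.eq_of_subset_of_card_le (fun e he => ?_) ?_
    · exact Finset.mem_compl.2 (Finset.disjoint_left.1 hTS he)
    · rw [Finset.card_compl]
      omega
  have hwalk : ∀ (P : List (Δ.E × Bool)) (u : Δ.V), Δ.IsWalk u P v → (∀ d ∈ P, d.1 ∉ S) →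
      φ v = φ u * .mk (P.map Δ.dartLabel) := by
    intro P
    induction P with
    | nil =>
      rintro u rfl -
      simp [← FreeGroup.one_eq_mk]
    | cons d P ih =>
      rintro u ⟨rfl, hw⟩ hP
      rw [ih _ hw fun d hd => hP d (List.mem_cons_of_mem _ hd),
        (h d (by simpa [hTS'] using hP d List.mem_cons_self)).2, mul_assoc, FreeGroup.mul_mk]
      rfl
  exact mul_eq_left.1 (hwalk P v hP hPS).symm

/-- A set `A` of faces that has been merged with the outer face by removing the edges in `S`, and
the boundary path `P` of the result. -/
structure Merged (A : Finset (Option Δ.F)) (S : Finset Δ.E) (P : List (Δ.E × Bool)) : Prop where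
  none_mem : none ∈ A
  nodup : P.Nodup
  mem_iff : ∀ d, d ∈ P ↔ Δ.face d ∈ A ∧ d.1 ∉ S
  closed : ∃ v, Δ.IsWalk v P v
  card : S.card + 1 = A.card
  face_mem : ∀ d : Δ.E × Bool, d.1 ∈ S → Δ.face d ∈ A
  connected : Δ.ConnectedOff S

theorem merged_outer : Δ.Merged {none} ∅ (Δ.boundary none) where
  none_mem := by simp
  nodup := Δ.boundary_nodup _
  mem_iff d := by simp [mem_boundary]
  closed := Δ.exists_isWalk_boundary _
  card := by simp
  face_mem := by simp
  connected u v := by simpa [target, inv] using Δ.connected u v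

variable {Δ}

/-- An edge on a cycle can be removed without disconnecting the graph: the path `p` is a detour
around it. -/
theorem ConnectedOff.insert [DecidableEq Δ.E] {S : Finset Δ.E} (hS : Δ.ConnectedOff S)
    {d : Δ.E × Bool} {p : List (Δ.E × Bool)} (hp : Δ.IsWalk (Δ.origin d) p (Δ.target d))
    (hpS : ∀ e ∈ p, e.1 ∉ insert d.1 S) : Δ.ConnectedOff (insert d.1 S) := by
  let r : Δ.V → Δ.V → Prop := fun x y => ∃ e : Δ.E × Bool, e.1 ∉ Insert.insert d.1 S ∧
    Δ.origin e = x ∧ Δ.target e = y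
  have hsymm : Std.Symm r := ⟨by
    rintro _ _ ⟨e, he, rfl, rfl⟩
    exact ⟨Δ.inv e, he, rfl, Δ.target_inv e⟩⟩
  have hwalk : ∀ (p : List (Δ.E × Bool)) (u v : Δ.V), Δ.IsWalk u p v →
      (∀ e ∈ p, e.1 ∉ Insert.insert d.1 S) → Relation.ReflTransGen r u v := by
    intro p
    induction p with
    | nil => rintro u v rfl -; exact .refl
    | cons e p ih =>
      rintro u v ⟨rfl, hw⟩ hp
      exact .head ⟨e, hp e List.mem_cons_self, rfl, rfl⟩
        (ih _ _ hw fun x hx => hp x (List.mem_cons_of_mem _ hx))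
  have hd : Relation.ReflTransGen r (Δ.origin d) (Δ.target d) := hwalk _ _ _ hp hpS
  intro u v
  induction hS u v with
  | refl => exact .refl
  | tail _ h ih =>
    refine ih.trans ?_
    obtain ⟨e, he, rfl, rfl⟩ := h
    by_cases hed : e.1 = d.1
    · obtain rfl | rfl := Δ.eq_or_eq_inv hed
      · exact hd
      · rw [target_inv]
        exact Relation.ReflTransGen.stdSymm.symm _ _ hd
    · exact .single ⟨e, by simp [hed, he], rfl, rfl⟩

/-- The boundary of `f` traverses the edge of `d` backwards, so the rest of it, `B₂ ++ B₁`, leads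
from the origin of `d` to its target. It replaces `d` in the boundary path, and it is also the
detour that preserves connectedness. -/
theorem Merged.absorb [DecidableEq Δ.E] [DecidableEq Δ.F] {A : Finset (Option Δ.F)}
    {S : Finset Δ.E} {P₁ P₂ B₁ B₂ : List (Δ.E × Bool)} {d : Δ.E × Bool}
    (h : Δ.Merged A S (P₁ ++ d :: P₂)) {f : Δ.F} (hf : some f ∉ A)
    (hb : Δ.boundary (some f) = B₁ ++ Δ.inv d :: B₂) :
    Δ.Merged (insert (some f) A) (insert d.1 S) (P₁ ++ (B₂ ++ B₁) ++ P₂) := by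
  have hmem : ∀ e, Δ.face e = some f ↔ e = Δ.inv d ∨ e ∈ B₂ ++ B₁ := by
    intro e
    rw [← mem_boundary, hb]
    simp only [List.mem_append, List.mem_cons]
    tauto
  have hP : ∀ e, e ∈ P₁ ++ d :: P₂ ↔ e = d ∨ e ∈ P₁ ++ P₂ := by
    intro e; simp only [List.mem_append, List.mem_cons]; tauto
  have hd := (h.mem_iff d).1 (by simp)
  have hnd : (d :: (P₁ ++ P₂)).Nodup := List.nodup_middle.1 h.nodup
  have hnb : (Δ.inv d :: (B₁ ++ B₂)).Nodup := List.nodup_middle.1 (hb ▸ Δ.boundary_nodup _)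
  have hfd : Δ.face (Δ.inv d) = some f := (hmem _).2 (.inl rfl)
  -- Edges removed earlier have both sides in `A`, which does not contain `f`. Of the two
  -- orientations of the edge of `d`, one has its face in `A` and the other occurs only once on the
  -- boundary of `f`.
  have hQ : ∀ e ∈ B₂ ++ B₁, e.1 ∉ insert d.1 S := by
    intro e he hS
    have hfe := (hmem e).2 (.inr he)
    obtain hS | hS := Finset.mem_insert.1 hS
    · obtain rfl | rfl := Δ.eq_or_eq_inv hS
      · exact hf (hfe ▸ hd.1)
      · refine (List.nodup_cons.1 hnb).1 ?_
        simpa [or_comm] using he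
    · exact hf (hfe ▸ h.face_mem e hS)
  have hmem' : ∀ e, e ∈ P₁ ++ (B₂ ++ B₁) ++ P₂ ↔ e ∈ P₁ ++ P₂ ∨ e ∈ B₂ ++ B₁ := by
    intro e; simp only [List.mem_append]; tauto
  obtain ⟨u, hu⟩ := Δ.exists_isWalk_boundary (some f)
  rw [hb, isWalk_append] at hu
  obtain ⟨w, hB₁, rfl, hB₂⟩ := hu
  rw [target_inv] at hB₂
  have hwalk : Δ.IsWalk (Δ.origin d) (B₂ ++ B₁) (Δ.target d) :=
    Δ.isWalk_append.2 ⟨u, hB₂, hB₁⟩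
  refine ⟨by simp [h.none_mem], ?_, ?_, ?_, ?_, ?_, h.connected.insert hwalk hQ⟩
  · have h1 : (P₁ ++ P₂ ++ (B₂ ++ B₁)).Nodup := by
      rw [List.nodup_append']
      refine ⟨(List.nodup_cons.1 hnd).2, List.nodup_append_comm.1 (List.nodup_cons.1 hnb).2, ?_⟩
      intro e he he'
      exact hf ((hmem e).2 (.inr he') ▸ ((h.mem_iff e).1 ((hP e).2 (.inr he))).1)
    refine (List.Perm.nodup_iff ?_).1 h1
    rw [List.append_assoc, List.append_assoc]
    exact (List.perm_append_left_iff _).2 List.perm_append_comm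
  · intro e
    rw [hmem', Finset.mem_insert, Finset.mem_insert, not_or]
    constructor
    · rintro (he | he)
      · have h1 := (h.mem_iff e).1 ((hP e).2 (.inr he))
        refine ⟨.inr h1.1, fun hed => ?_, h1.2⟩
        obtain rfl | rfl := Δ.eq_or_eq_inv hed
        · exact (List.nodup_cons.1 hnd).1 he
        · exact hf (hfd ▸ h1.1)
      · have := hQ e he
        rw [Finset.mem_insert, not_or] at this
        exact ⟨.inl ((hmem e).2 (.inr he)), this⟩
    · rintro ⟨he | he, hed, heS⟩
      · obtain rfl | he := (hmem e).1 he
        · exact absurd rfl hed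
        · exact .inr he
      · obtain rfl | he := (hP e).1 ((h.mem_iff e).2 ⟨he, heS⟩)
        · exact absurd rfl hed
        · exact .inl he
  · obtain ⟨v, hv⟩ := h.closed
    obtain ⟨w', hP₁, rfl, hP₂⟩ := Δ.isWalk_append.1 hv
    exact ⟨v, Δ.isWalk_append.2 ⟨_, Δ.isWalk_append.2 ⟨_, hP₁, hwalk⟩, hP₂⟩⟩
  · rw [Finset.card_insert_of_notMem hf, Finset.card_insert_of_notMem hd.2, h.card]
  · intro e he
    obtain he | he := Finset.mem_insert.1 he
    · obtain rfl | rfl := Δ.eq_or_eq_inv he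
      · exact Finset.mem_insert_of_mem hd.1
      · rw [hfd]; exact Finset.mem_insert_self _ _
    · exact Finset.mem_insert_of_mem (h.face_mem e he)

theorem length_le_of_nodup {P : List (Δ.E × Bool)} (h : P.Nodup) : P.length ≤ 2 * Δ.numEdges := by
  have := h.length_le_card
  simpa [Fintype.card_prod, mul_comm, numEdges] using this

/-- Induction on the number `n` of faces not yet merged. For `n = 0` as many edges have been removed
as there are 2-cells, and Euler's formula makes the rest a spanning tree. -/
theorem Merged.exists_products (hR : ∀ r ∈ R, r ≠ []) {n : ℕ} {A : Finset (Option Δ.F)}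
    {S : Finset Δ.E} {P : List (Δ.E × Bool)} (h : Δ.Merged A S P)
    (hn : A.card + n = Fintype.card Δ.F + 1) :
    ∃ cs : List (GroupWord α × GroupWord α × Bool), cs.length = n ∧
      (∀ c ∈ cs, c.1.length ≤ 4 * Δ.numEdges ∧ c.2.1.length ≤ 2 * Δ.numEdges ∧ c.2.1 ∈ R) ∧
      (cs.map fun c => FreeGroup.mk (Guess.conjWord c.1 c.2.1 c.2.2)).prod =
        FreeGroup.mk (P.map Δ.dartLabel) := by
  classical
  induction n generalizing A S P with
  | zero =>
    refine ⟨[], rfl, by simp, ?_⟩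
    obtain ⟨v, hv⟩ := h.closed
    rw [Δ.mk_eq_one_of_isWalk h.connected ?_ hv fun d hd => ((h.mem_iff d).1 hd).2]
    · simp
    · have := Δ.euler
      have := h.card
      omega
  | succ n ih =>
    obtain ⟨f, hf⟩ : ∃ f, f ∉ A := by
      by_contra! hall
      have := Finset.card_le_card (fun x _ => hall x : Finset.univ ⊆ A)
      rw [Finset.card_univ, Fintype.card_option] at this
      omega
    obtain ⟨d, hd, hd'⟩ := Δ.exists_dual_crossing hR h.none_mem hf
    obtain ⟨f, hfd⟩ : ∃ f, Δ.face (Δ.inv d) = some f := by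
      rw [← Option.ne_none_iff_exists']
      exact fun h' => hd' (h' ▸ h.none_mem)
    rw [hfd] at hd'
    have hdP : d ∈ P := (h.mem_iff d).2 ⟨hd, fun hS => hd' (hfd ▸ h.face_mem (Δ.inv d) hS)⟩
    obtain ⟨P₁, P₂, rfl⟩ := List.append_of_mem hdP
    obtain ⟨B₁, B₂, hb⟩ := List.append_of_mem (Δ.mem_boundary.2 hfd)
    obtain ⟨cs, hlen, hcs, hprod⟩ := ih (h.absorb hd' hb) (by
      rw [Finset.card_insert_of_notMem hd']; omega)
    have hPlen := length_le_of_nodup h.nodup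
    have hBlen := length_le_of_nodup (Δ.boundary_nodup (some f))
    rw [hb] at hBlen
    simp only [List.length_append, List.length_cons] at hPlen hBlen
    -- The inverse of the label of the face is needed, so a face that reads `r` itself gets the
    -- negative sign.
    obtain ⟨r, hr, s, hs⟩ : ∃ r ∈ R, ∃ s : Bool, FreeGroup.mk (if s then r else FreeGroup.invRev r) =
        (FreeGroup.mk ((Δ.boundary (some f)).map Δ.dartLabel))⁻¹ ∧
        r.length = (Δ.boundary (some f)).length := by
      obtain ⟨r, hr, h' | h'⟩ := Δ.relator f
      · refine ⟨r, hr, false, ?_, by rw [← h', List.length_map]⟩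
        rw [FreeGroup.inv_mk]
        exact congrArg (fun x => FreeGroup.mk (FreeGroup.invRev x)) h'.symm
      · refine ⟨r, hr, true, ?_, by rw [← FreeGroup.invRev_length (L₁ := r), ← h', List.length_map]⟩
        rw [FreeGroup.inv_mk, ← FreeGroup.invRev_invRev (L₁ := r)]
        exact congrArg (fun x => FreeGroup.mk (FreeGroup.invRev x)) h'.symm
    -- With `∂f = B₁ d⁻¹ B₂` and `g = P₁ d B₁⁻¹`, one has `P₁ d P₂ = g (∂f)⁻¹ g⁻¹ · P₁ B₂ B₁ P₂` in
    -- the free group. The lengths are bounded because the paths do not repeat an oriented edge.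
    refine ⟨((P₁.map Δ.dartLabel ++ [Δ.dartLabel d]) ++ FreeGroup.invRev (B₁.map Δ.dartLabel),
      r, s) :: cs, by simp [hlen], ?_, ?_⟩
    · rintro c hc
      obtain rfl | hc := List.mem_cons.1 hc
      · refine ⟨?_, ?_, hr⟩
        · simp; omega
        · rw [hs.2, hb]; simp; omega
      · exact hcs c hc
    · rw [List.map_cons, List.prod_cons, hprod]
      simp only [Guess.conjWord, ← FreeGroup.mul_mk, ← FreeGroup.inv_mk, hs.1, hb, List.map_append,
        List.map_cons]
      rw [← List.singleton_append (l := B₂.map Δ.dartLabel), ← FreeGroup.mul_mk, mk_dartLabel_inv,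
        ← List.singleton_append (l := P₂.map Δ.dartLabel), ← FreeGroup.mul_mk]
      group

theorem exists_products (Δ : VanKampenDiagram R) (hR : ∀ r ∈ R, r ≠ []) :
    ∃ cs : List (GroupWord α × GroupWord α × Bool), cs.length ≤ 4 * Δ.numEdges ∧
      (∀ c ∈ cs, c.1.length ≤ 4 * Δ.numEdges ∧ c.2.1.length ≤ 4 * Δ.numEdges ∧ c.2.1 ∈ R) ∧
      (cs.map fun c => FreeGroup.mk (Guess.conjWord c.1 c.2.1 c.2.2)).prod =
        FreeGroup.mk Δ.boundaryLabel := by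
  obtain ⟨cs, hlen, hcs, hprod⟩ := Δ.merged_outer.exists_products hR
    (n := Fintype.card Δ.F) (by simp [add_comm])
  refine ⟨cs, ?_, fun c hc => ⟨(hcs c hc).1, (hcs c hc).2.1.trans (by omega), (hcs c hc).2.2⟩, hprod⟩
  -- Every 2-cell has an oriented edge on its boundary, and different cells have different ones;
  -- thus there are at most `2 * numEdges` of them.
  choose d hd using fun f => List.exists_mem_of_ne_nil _ (Δ.boundary_ne_nil hR f)
  have hinj : Function.Injective d := fun f g h =>
    Option.some_injective _ ((Δ.mem_boundary.1 (hd f)).symm.trans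
      ((congrArg Δ.face h).trans (Δ.mem_boundary.1 (hd g))))
  have := Fintype.card_le_of_injective d hinj
  rw [Fintype.card_prod, Fintype.card_bool] at this
  rw [hlen, numEdges]
  omega

end VanKampenDiagram

/-! ## Construction of diagrams -/

namespace VanKampenDiagram

variable {α : Type} {R : Set (GroupWord α)}

/-- The diagram with one vertex and no edges. -/
def point (R : Set (GroupWord α)) : VanKampenDiagram R where
  V := Unit
  E := Empty
  F := Empty
  label := Empty.elim
  origin _ := ()
  next := Equiv.refl _
  boundary _ := []
  boundary_nodup _ := List.nodup_nil
  boundary_unique d := d.1.elim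
  boundary_next _ := rfl
  outer_nonempty h := h.some.elim
  origin_eq_iff d := d.1.elim
  nonempty_vertices := ⟨()⟩
  connected _ _ := .refl
  euler := rfl
  relator f := f.elim

/-- Change the starting point of the boundary path. -/
def rotate (Δ : VanKampenDiagram R) (k : ℕ) : VanKampenDiagram R where
  V := Δ.V
  E := Δ.E
  F := Δ.F
  label := Δ.label
  origin := Δ.origin
  next := Δ.next
  boundary f := (Δ.boundary f).rotate (f.elim k fun _ => 0)
  boundary_nodup f := List.nodup_rotate.2 (Δ.boundary_nodup f)
  boundary_unique d := by simpa using Δ.boundary_unique d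
  boundary_next f := by
    rw [List.map_rotate, Δ.boundary_next, List.rotate_rotate, List.rotate_rotate, add_comm]
  outer_nonempty h := by simpa using Δ.outer_nonempty h
  origin_eq_iff := Δ.origin_eq_iff
  nonempty_vertices := Δ.nonempty_vertices
  connected := Δ.connected
  euler := Δ.euler
  relator f := by simpa using Δ.relator f

theorem boundaryLabel_rotate (Δ : VanKampenDiagram R) (k : ℕ) :
    (Δ.rotate k).boundaryLabel = Δ.boundaryLabel.rotate k :=
  List.map_rotate ..

theorem map_add_one_finRange (n : ℕ) :
    (List.finRange (n + 1)).map (· + 1) = (List.finRange (n + 1)).rotate 1 := by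
  refine List.ext_getElem (by simp) fun i h1 h2 => ?_
  simp [List.getElem_rotate, Fin.ext_iff, Fin.val_add]

theorem map_sub_one_finRange (n : ℕ) :
    (List.finRange (n + 1)).reverse.map (· - 1) = (List.finRange (n + 1)).reverse.rotate 1 := by
  have h : ∀ l : List (Fin (n + 1)), (l.rotate 1).reverse.rotate 1 = l.reverse := by
    rintro (_ | ⟨x, l⟩) <;> simp
  have hinj : Function.Injective fun i : Fin (n + 1) => i + 1 := add_left_injective 1
  refine (List.map_injective_iff.2 hinj) ?_
  rw [List.map_map, List.map_rotate, List.map_reverse (f := (· + 1)), map_add_one_finRange, h]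
  simp [Function.comp_def]

/-- The rotation of a cycle with one face on each side. -/
def circleNext (n : ℕ) : Equiv.Perm (Fin (n + 1) × Bool) where
  toFun d := (if d.2 then d.1 + 1 else d.1 - 1, d.2)
  invFun d := (if d.2 then d.1 - 1 else d.1 + 1, d.2)
  left_inv d := by obtain ⟨d, _ | _⟩ := d <;> simp
  right_inv d := by obtain ⟨d, _ | _⟩ := d <;> simp

/-- The diagram with a single 2-cell whose boundary is a simple closed path. -/
def circle (x : α × Bool) (W : GroupWord α) (hR : x :: W ∈ R) : VanKampenDiagram R where
  V := Fin (W.length + 1)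
  E := Fin (W.length + 1)
  F := Unit
  label i := (x :: W).get i
  origin d := if d.2 then d.1 else d.1 + 1
  next := circleNext W.length
  boundary
    | none => (List.finRange (W.length + 1)).map (·, true)
    | some _ => (List.finRange (W.length + 1)).reverse.map (·, false)
  boundary_nodup f := by
    have hinj : ∀ b : Bool, Function.Injective fun i : Fin (W.length + 1) => (i, b) := fun b i j h =>
      congrArg Prod.fst h
    cases f
    · exact (List.nodup_finRange _).map (hinj _)
    · exact (List.nodup_reverse.2 (List.nodup_finRange _)).map (hinj _)
  boundary_unique d := by
    obtain ⟨i, _ | _⟩ := d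
    · refine ⟨some (), by simp, ?_⟩
      rintro (_ | _) <;> simp
    · refine ⟨none, by simp, ?_⟩
      rintro (_ | _) <;> simp
  boundary_next f := by
    cases f
    · simp only
      rw [← List.map_rotate, ← map_add_one_finRange, List.map_map, List.map_map]
      simp [circleNext, Function.comp_def]
    · simp only
      rw [← List.map_rotate, ← map_sub_one_finRange, List.map_map, List.map_map]
      simp [circleNext, Function.comp_def]
  outer_nonempty _ := by simp
  origin_eq_iff d d' := by
    constructor
    · obtain ⟨i, _ | _⟩ := d <;> obtain ⟨j, _ | _⟩ := d' <;> intro h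
      · exact ⟨0, by simpa using h⟩
      · exact ⟨1, by simpa [circleNext] using h⟩
      · exact ⟨1, by simpa [circleNext, sub_eq_iff_eq_add] using h⟩
      · exact ⟨0, by simpa using h⟩
    · rintro ⟨n, rfl⟩
      induction n with
      | zero => rfl
      | succ n ih =>
        rw [Function.iterate_succ_apply', ih]
        generalize (fun x : Fin (W.length + 1) × Bool => circleNext W.length (x.1, !x.2))^[n] d = e
        obtain ⟨i, _ | _⟩ := e <;> simp [circleNext]
  nonempty_vertices := ⟨0⟩
  connected u v := by
    let r : Fin (W.length + 1) → Fin (W.length + 1) → Prop := fun x y =>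
      ∃ d : Fin (W.length + 1) × Bool,
        (if d.2 then d.1 else d.1 + 1) = x ∧ (if !d.2 then d.1 else d.1 + 1) = y
    have h : ∀ v, Relation.ReflTransGen r 0 v ∧ Relation.ReflTransGen r v 0 := by
      intro v
      induction v using Fin.induction with
      | zero => exact ⟨.refl, .refl⟩
      | succ i ih =>
        rw [← Fin.coeSucc_eq_succ]
        exact ⟨ih.1.tail ⟨(i.castSucc, true), by simp⟩, .head ⟨(i.castSucc, false), by simp⟩ ih.2⟩
    exact (h u).2.trans (h v).1
  euler := by simp
  -- The 2-cell runs through the circle in the direction opposite to the outer face, so it reads the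
  -- inverse of the relator.
  relator f := ⟨_, hR, .inr (by
    rw [List.map_map, List.map_reverse, FreeGroup.invRev]
    congr 1
    conv_rhs => rw [← List.map_get_finRange (x :: W), List.map_map]
    rfl)⟩

theorem boundaryLabel_circle (x : α × Bool) (W : GroupWord α) (hR : x :: W ∈ R) :
    (circle x W hR).boundaryLabel = x :: W := by
  conv_rhs => rw [← List.map_get_finRange (x :: W)]
  exact List.map_map ..

/-! ### Attaching an edge -/

section Attach

variable (Δ : VanKampenDiagram R)

/-- The oriented edges of the diagram as oriented edges of the diagram with one more edge. -/
def oldDart (d : Δ.E × Bool) : Option Δ.E × Bool := (some d.1, d.2)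

theorem oldDart_injective : Function.Injective Δ.oldDart := by
  rintro ⟨d, b⟩ ⟨e, c⟩ h
  simpa [oldDart] using h

/-- On a finite set the relation given by forward iterates is an equivalence relation, which makes
symmetry and transitivity available for the orbits of the rotation. -/
theorem sameCycle_iff {β : Type} [Finite β] (f : Equiv.Perm β) (x y : β) :
    f.SameCycle x y ↔ ∃ n : ℕ, f^[n] x = y := by
  constructor
  · intro h
    obtain ⟨n, hn⟩ := h.exists_nat_pow_eq
    exact ⟨n, by rw [← hn, Equiv.Perm.coe_pow]⟩
  · rintro ⟨n, rfl⟩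
    exact ⟨n, by rw [zpow_natCast, Equiv.Perm.coe_pow]⟩

/-- The starting vertices of the oriented edges after an edge with a new endpoint has been attached
to the vertex `v`. -/
def attachOrigin (v : Δ.V) : Option Δ.E × Bool → Option Δ.V
  | (some e, b) => some (Δ.origin (e, b))
  | (none, true) => some v
  | (none, false) => none

/-- Attach an edge with a new endpoint to the vertex `v`, given the new permutation `next`. -/
def attach (x : α × Bool) (v : Δ.V) (next : Equiv.Perm (Option Δ.E × Bool))
    (h1 : next (none, true) = (none, false))
    (h2 : next (none, false) :: ((Δ.boundary none).map Δ.oldDart).map next =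
      (Δ.boundary none).map Δ.oldDart ++ [(none, true)])
    (h3 : ∀ d, d ∉ Δ.boundary none → next (Δ.oldDart d) = Δ.oldDart (Δ.next d))
    (h4 : ∀ d, next (Δ.oldDart d) = Δ.oldDart (Δ.next d) ∨ next (Δ.oldDart d) = (none, true) ∧
      next (none, false) = Δ.oldDart (Δ.next d) ∧ v = Δ.target d)
    (h5 : next (none, false) = (none, true) ∧ IsEmpty Δ.E ∨
      ∃ d, next (none, false) = Δ.oldDart d ∧ Δ.origin d = v) : VanKampenDiagram R where
  V := Option Δ.V
  E := Option Δ.E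
  F := Δ.F
  label e := e.elim x Δ.label
  origin := Δ.attachOrigin v
  next := next
  boundary
    | none => (none, true) :: (none, false) :: (Δ.boundary none).map Δ.oldDart
    | some f => (Δ.boundary (some f)).map Δ.oldDart
  boundary_nodup f := by
    cases f
    · simpa [oldDart] using (Δ.boundary_nodup none).map Δ.oldDart_injective
    · exact (Δ.boundary_nodup _).map Δ.oldDart_injective
  boundary_unique d := by
    have hold : ∀ (f : Option Δ.F) (d : Δ.E × Bool),
        Δ.oldDart d ∈ (Δ.boundary f).map Δ.oldDart ↔ d ∈ Δ.boundary f := fun f d =>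
      List.mem_map_of_injective Δ.oldDart_injective
    have hnone : ∀ (f : Option Δ.F) (b : Bool), (none, b) ∉ (Δ.boundary f).map Δ.oldDart := by
      simp [oldDart]
    obtain ⟨_ | e, b⟩ := d
    · refine ⟨none, by cases b <;> simp, ?_⟩
      rintro (_ | f) hf
      · rfl
      · exact absurd hf (hnone _ _)
    · obtain ⟨f, hf, hu⟩ := Δ.boundary_unique (e, b)
      refine ⟨f, ?_, ?_⟩
      · cases f
        · exact List.mem_cons_of_mem _ (List.mem_cons_of_mem _ ((hold _ _).2 hf))
        · exact (hold _ _).2 hf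
      · rintro (_ | g) hg
        · refine hu _ ((hold _ _).1 ?_)
          simpa [oldDart] using hg
        · exact hu _ ((hold _ _).1 hg)
  boundary_next f := by
    cases f
    · simp only [List.map_cons, h1, h2]
      rfl
    · simp only
      rw [← List.map_rotate, ← Δ.boundary_next, List.map_map, List.map_map]
      refine List.map_congr_left fun d hd => h3 d fun hd' => ?_
      exact Option.some_ne_none _ ((Δ.boundary_unique d).unique hd hd')
  outer_nonempty _ := by simp
  origin_eq_iff := by
    -- `ρ` is the rotation around the vertices of the new diagram. Its orbits are the old ones, with
    -- `(none, true)` added to the orbit of `v` if there is one, and the fixed point `(none, false)`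
    -- at the new vertex.
    let ρ : Equiv.Perm (Option Δ.E × Bool) :=
      ((Equiv.refl _).prodCongr (Equiv.boolNot)).trans next
    have hρ : ∀ d, ρ (Δ.oldDart d) = next (Δ.oldDart (Δ.inv d)) := fun d => rfl
    have hinv : ∀ d, Δ.attachOrigin v (ρ d) = Δ.attachOrigin v d := by
      rintro ⟨_ | e, b⟩
      · cases b
        · exact congrArg _ h1
        · change Δ.attachOrigin v (next (none, false)) = some v
          obtain ⟨h, -⟩ | ⟨d, h, hd⟩ := h5
          · rw [h]; rfl
          · rw [h, ← hd]; rfl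
      · change Δ.attachOrigin v (next (Δ.oldDart (Δ.inv (e, b)))) = some (Δ.origin (e, b))
        rw [← Δ.target_inv (e, b)]
        obtain h | ⟨h, -, hv⟩ := h4 (Δ.inv (e, b))
        · rw [h, ← Δ.origin_next]; rfl
        · rw [h, hv]; rfl
    -- At the corner where the new edge has been inserted, one step of the old rotation becomes two
    -- steps of the new one.
    have hstep : ∀ d, ρ.SameCycle (Δ.oldDart d) (Δ.oldDart (Δ.next (Δ.inv d))) := by
      intro d
      obtain h | ⟨h, h', -⟩ := h4 (Δ.inv d)
      · exact (sameCycle_iff _ _ _).2 ⟨1, h⟩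
      · refine (sameCycle_iff _ _ _).2 ⟨2, ?_⟩
        change ρ (ρ _) = _
        rw [hρ, h, ← h']; rfl
    have hold : ∀ d e, Δ.origin d = Δ.origin e → ρ.SameCycle (Δ.oldDart d) (Δ.oldDart e) := by
      intro d e h
      obtain ⟨n, rfl⟩ := (Δ.origin_eq_iff d e).1 h
      clear h
      induction n with
      | zero => exact .refl _ _
      | succ n ih =>
        rw [Function.iterate_succ_apply']
        exact ih.trans (hstep _)
    have hnew : ∀ d, Δ.origin d = v → ρ.SameCycle (none, true) (Δ.oldDart d) := by
      intro d hd
      obtain ⟨-, h⟩ | ⟨d', h, hd'⟩ := h5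
      · exact isEmptyElim d.1
      · exact ((sameCycle_iff ρ (none, true) (Δ.oldDart d')).2 ⟨1, h⟩).trans (hold _ _ (hd'.trans hd.symm))
    intro d d'
    refine Iff.trans ⟨fun h => ?_, fun h => ?_⟩ (sameCycle_iff ρ d d')
    · obtain ⟨_ | e, b⟩ := d <;> obtain ⟨_ | e', b'⟩ := d'
      · cases b <;> cases b' <;> first | exact .refl _ _ | simp [attachOrigin] at h
      · cases b
        · simp [attachOrigin] at h
        · exact hnew (e', b') (Option.some_injective _ h).symm
      · cases b'
        · simp [attachOrigin] at h
        · exact (hnew (e, b) (Option.some_injective _ h)).symm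
      · exact hold (e, b) (e', b') (Option.some_injective _ h)
    · obtain ⟨n, rfl⟩ := (sameCycle_iff _ _ _).1 h
      clear h
      induction n with
      | zero => rfl
      | succ n ih => rw [Function.iterate_succ_apply', hinv, ih]
  nonempty_vertices := ⟨none⟩
  connected := by
    have hold : ∀ u w, Relation.ReflTransGen (fun x y => ∃ d : Option Δ.E × Bool,
        Δ.attachOrigin v d = x ∧ Δ.attachOrigin v (d.1, !d.2) = y) (some u) (some w) := by
      intro u w
      refine (Δ.connected u w).lift some ?_
      rintro _ _ ⟨d, rfl, rfl⟩
      exact ⟨Δ.oldDart d, rfl, rfl⟩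
    rintro (_ | u) (_ | w)
    · exact .refl
    · exact .head ⟨(none, false), rfl, rfl⟩ (hold v w)
    · exact .tail (hold u v) ⟨(none, true), rfl, rfl⟩
    · exact hold u w
  euler := by
    have := Δ.euler
    simp only [Fintype.card_option]
    omega
  relator f := by
    simp only [List.map_map]
    exact Δ.relator f

/-- Attach an edge with a new endpoint at the starting point of the boundary path. -/
theorem exists_attach (x : α × Bool) : ∃ Δ' : VanKampenDiagram R,
    Δ'.boundaryLabel = x :: (x.1, !x.2) :: Δ.boundaryLabel ∧ Δ'.numEdges = Δ.numEdges + 1 := by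
  classical
  suffices h : ∃ (v : Δ.V) (next : Equiv.Perm (Option Δ.E × Bool)),
      next (none, true) = (none, false) ∧
      next (none, false) :: ((Δ.boundary none).map Δ.oldDart).map next =
        (Δ.boundary none).map Δ.oldDart ++ [(none, true)] ∧
      (∀ d, d ∉ Δ.boundary none → next (Δ.oldDart d) = Δ.oldDart (Δ.next d)) ∧
      (∀ d, next (Δ.oldDart d) = Δ.oldDart (Δ.next d) ∨ next (Δ.oldDart d) = (none, true) ∧
        next (none, false) = Δ.oldDart (Δ.next d) ∧ v = Δ.target d) ∧
      (next (none, false) = (none, true) ∧ IsEmpty Δ.E ∨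
        ∃ d, next (none, false) = Δ.oldDart d ∧ Δ.origin d = v) by
    obtain ⟨v, next, h1, h2, h3, h4, h5⟩ := h
    refine ⟨Δ.attach x v next h1 h2 h3 h4 h5, ?_, Fintype.card_option⟩
    have h : ((Δ.boundary none).map Δ.oldDart).map (Δ.attach x v next h1 h2 h3 h4 h5).dartLabel =
        Δ.boundaryLabel := List.map_map ..
    exact congrArg (fun w => x :: (x.1, !x.2) :: w) h
  by_cases hE : IsEmpty Δ.E
  · refine ⟨Δ.nonempty_vertices.some, Equiv.swap (none, true) (none, false), by simp, ?_,
      fun d => isEmptyElim d.1, fun d => isEmptyElim d.1, .inl ⟨by simp, hE⟩⟩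
    have : Δ.boundary none = [] := List.eq_nil_iff_forall_not_mem.2 fun d => isEmptyElim d.1
    simp [this]
  · have hne := Δ.outer_nonempty (not_isEmpty_iff.1 hE)
    obtain ⟨m, y, hm⟩ : ∃ m y, Δ.boundary none = m ++ [y] :=
      ⟨_, _, (List.dropLast_append_getLast hne).symm⟩
    have hnext : Δ.next y :: m.map Δ.next = m ++ [y] := by
      have h := Δ.boundary_next none
      rw [hm] at h
      obtain _ | ⟨z, m⟩ := m
      · simpa using h
      · rw [List.cons_append, List.rotate_cons_succ, List.rotate_zero, ← List.cons_append,
          List.map_append] at h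
        obtain ⟨h, h'⟩ := List.append_inj' h rfl
        rw [h, show Δ.next y = z by simpa using h', List.cons_append]
    have hy : y ∉ m := by
      have := Δ.boundary_nodup none
      rw [hm] at this
      exact (List.nodup_cons.1 (List.nodup_append_comm.1 this)).1
    let base : Equiv.Perm (Option Δ.E × Bool) :=
      { toFun := fun d => match d with
          | (some e, b) => Δ.oldDart (Δ.next (e, b))
          | (none, b) => (none, b)
        invFun := fun d => match d with
          | (some e, b) => Δ.oldDart (Δ.next.symm (e, b))
          | (none, b) => (none, b)
        left_inv := by rintro ⟨_ | e, b⟩ <;> simp [oldDart]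
        right_inv := by rintro ⟨_ | e, b⟩ <;> simp [oldDart] }
    -- The last oriented edge `y` of the outer boundary is followed by the new edge, then by its
    -- inverse, then by the old successor of `y`; the remaining oriented edges keep their
    -- successors.
    let f := base * Equiv.swap (none, true) (none, false) * Equiv.swap (none, false) (Δ.oldDart y)
    have hf : ∀ d, f d = base (Equiv.swap (none, true) (none, false)
      (Equiv.swap (none, false) (Δ.oldDart y) d)) := fun d => rfl
    have hne : ∀ d b, Δ.oldDart d ≠ (none, b) := by simp [oldDart]
    have f1 : f (none, true) = (none, false) := by
      rw [hf, Equiv.swap_apply_of_ne_of_ne (by simp) (hne _ _).symm, Equiv.swap_apply_left]; rfl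
    have f2 : f (none, false) = Δ.oldDart (Δ.next y) := by
      rw [hf, Equiv.swap_apply_left, Equiv.swap_apply_of_ne_of_ne (hne _ _) (hne _ _)]; rfl
    have f3 : f (Δ.oldDart y) = (none, true) := by
      rw [hf, Equiv.swap_apply_right, Equiv.swap_apply_right]; rfl
    have f4 : ∀ d, d ≠ y → f (Δ.oldDart d) = Δ.oldDart (Δ.next d) := by
      intro d hd
      rw [hf, Equiv.swap_apply_of_ne_of_ne (hne _ _) (Δ.oldDart_injective.ne hd),
        Equiv.swap_apply_of_ne_of_ne (hne _ _) (hne _ _)]; rfl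
    refine ⟨Δ.target y, f, f1, ?_, fun d hd => f4 d ?_, fun d => ?_, .inr ⟨_, f2, Δ.origin_next y⟩⟩
    · have : (m.map Δ.oldDart).map f = (m.map Δ.next).map Δ.oldDart := by
        rw [List.map_map, List.map_map]
        exact List.map_congr_left fun d hd => f4 d (by rintro rfl; exact hy hd)
      have hl : Δ.oldDart (Δ.next y) :: (m.map Δ.oldDart).map f = (m ++ [y]).map Δ.oldDart := by
        rw [this, ← List.map_cons, hnext]
      rw [f2, hm, List.map_append, List.map_append, ← List.cons_append, hl]
      simp [f3]
    · rintro rfl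
      exact hd (by simp [hm])
    · by_cases hd : d = y
      · subst hd
        exact .inr ⟨f3, f2, rfl⟩
      · exact .inl (f4 d hd)

end Attach

end VanKampenDiagram

/-! ### Diagrams over the cyclically reduced words that represent the identity -/

namespace FreeGroup

/-- A word is cyclically reduced or has a cyclic conjugate that begins with a pair of mutually
inverse letters. -/
theorem isCyclicallyReduced_or_exists_rotate {α : Type} (W : List (α × Bool)) :
    IsCyclicallyReduced W ∨ ∃ k x V, W.rotate k = x :: (x.1, !x.2) :: V := by
  have hinv : ∀ {x y : α × Bool}, ¬ (x.1 = y.1 → x.2 = y.2) → y = (x.1, !x.2) := by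
    rintro ⟨x, b⟩ ⟨y, c⟩ h
    simp only [Classical.not_imp] at h
    obtain ⟨rfl, h⟩ := h
    cases b <;> cases c <;> simp at h ⊢
  by_cases h : IsReduced W
  · refine or_iff_not_imp_left.2 fun hc => ?_
    rw [isCyclicallyReduced_iff, not_and] at hc
    have hc := hc h
    push Not at hc
    obtain ⟨y, hy, x, hx, hxy, hne⟩ := hc
    obtain _ | ⟨z, W⟩ := W
    · simp at hx
    · obtain rfl : z = x := by simpa using hx
      obtain rfl | ⟨V, y', rfl⟩ := W.eq_nil_or_concat
      · exact absurd (by simpa using hy) fun h : z = y => hne (h ▸ rfl)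
      · obtain rfl : y' = y := by
          rw [List.concat_eq_append, ← List.cons_append, List.getLast?_concat] at hy
          simpa using hy
        refine ⟨V.length + 1, y', V, ?_⟩
        have h1 := hinv (x := y') (y := z) fun h => hne (h hxy)
        rw [List.concat_eq_append, ← List.cons_append]
        refine (List.rotate_append_length_eq (z :: V) [y']).trans ?_
        rw [h1]; rfl
  · right
    rw [IsReduced, List.isChain_iff_forall_rel_of_append_cons_cons] at h
    push Not at h
    obtain ⟨x, y, A, B, rfl, h⟩ := h
    refine ⟨A.length, x, B ++ A, ?_⟩
    rw [List.rotate_append_length_eq, hinv (x := x) (y := y) fun h' => h.2 (h' h.1)]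
    rfl

end FreeGroup

section CyclicallyReducedRelators

variable {α : Type} {G : Type*} [Group G] (φ : FreeGroup α →* G)

/-- The nonempty cyclically reduced words that represent the identity. -/
def cyclicRelators : Set (GroupWord α) :=
  {r | φ (.mk r) = 1 ∧ r ≠ [] ∧ FreeGroup.IsCyclicallyReduced r}

theorem map_mk_rotate {W : GroupWord α} (h : φ (.mk W) = 1) (k : ℕ) : φ (.mk (W.rotate k)) = 1 := by
  rw [List.rotate_eq_drop_append_take_mod, ← FreeGroup.mul_mk, map_mul, mul_eq_one_comm,
    ← map_mul, FreeGroup.mul_mk, List.take_append_drop]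
  exact h

/-- Induction on the length. A cyclically reduced word bounds a polygon; otherwise a cyclic
conjugate begins with an inverse pair, which is drawn as a hair. The hair adds one edge while the
word grows by two letters. -/
theorem exists_diagram {W : GroupWord α} (h : φ (.mk W) = 1) :
    ∃ Δ : VanKampenDiagram (cyclicRelators φ), Δ.boundaryLabel = W ∧ Δ.numEdges ≤ W.length := by
  induction hn : W.length using Nat.strong_induction_on generalizing W with
  | _ n ih =>
    subst hn
    obtain hc | ⟨k, x, V, hk⟩ := FreeGroup.isCyclicallyReduced_or_exists_rotate W
    · obtain _ | ⟨x, W⟩ := W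
      · exact ⟨.point _, rfl, Nat.zero_le _⟩
      · exact ⟨.circle x W ⟨h, by simp, hc⟩, VanKampenDiagram.boundaryLabel_circle _ _ _,
          (Fintype.card_fin _).le⟩
    · have hV : φ (.mk V) = 1 := by
        have := map_mk_rotate φ h k
        rw [hk] at this
        exact (StackMachine.Guess.map_mk_cancel φ [] V x).symm.trans this
      have hlen : W.length = V.length + 2 := by
        rw [← List.length_rotate (n := k), hk]; rfl
      obtain ⟨Δ, hΔ, hE⟩ := ih V.length (by omega) hV rfl
      obtain ⟨Δ', hΔ', hE'⟩ := Δ.exists_attach x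
      -- This rotation undoes the rotation by `k`, so that the boundary is read from the starting
      -- point of `W` again.
      refine ⟨Δ'.rotate (W.length - k % W.length), ?_, ?_⟩
      · rw [VanKampenDiagram.boundaryLabel_rotate, hΔ', hΔ, ← hk, List.rotate_rotate,
          ← List.rotate_mod]
        have : (k + (W.length - k % W.length)) % W.length = 0 := by
          have h1 := Nat.mod_lt k (show 0 < W.length by omega)
          have h2 := Nat.div_add_mod k W.length
          rw [show k + (W.length - k % W.length) = W.length * (k / W.length + 1) by
            rw [mul_add]; omega]
          exact Nat.mul_mod_right _ _
        rw [this, List.rotate_zero]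
      · change Δ'.numEdges ≤ _
        omega

/-- A word in the kernel bounds a diagram, and cutting the diagram open expresses the word as a
product of conjugates of relators and their inverses. -/
theorem relatorClosure_cyclicRelators : φ.ker = relatorClosure (cyclicRelators φ) := by
  refine le_antisymm (fun g hg => ?_) (Subgroup.normalClosure_le_normal ?_)
  · obtain ⟨W⟩ := g
    obtain ⟨Δ, hΔ, -⟩ := exists_diagram φ (W := W) hg
    obtain ⟨cs, -, hcs, hprod⟩ := Δ.exists_products fun r hr => hr.2.1
    change FreeGroup.mk W ∈ _
    rw [← hΔ, ← hprod]
    refine Subgroup.list_prod_mem _ fun x hx => ?_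
    obtain ⟨c, hc, rfl⟩ := List.mem_map.1 hx
    have hr : FreeGroup.mk c.2.1 ∈ relatorClosure (cyclicRelators φ) :=
      Subgroup.subset_normalClosure ⟨_, (hcs c hc).2.2, rfl⟩
    have hr' : FreeGroup.mk (if c.2.2 then c.2.1 else FreeGroup.invRev c.2.1) ∈
        relatorClosure (cyclicRelators φ) := by
      split_ifs
      · exact hr
      · rw [← FreeGroup.inv_mk]; exact inv_mem hr
    rw [StackMachine.Guess.conjWord, ← FreeGroup.mul_mk, ← FreeGroup.mul_mk, ← FreeGroup.inv_mk]
    exact Subgroup.normalClosure_normal.conj_mem _ hr' _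
  · rintro _ ⟨r, hr, rfl⟩
    exact hr.1

theorem dehnOne_cyclicRelators_le (x : ℕ) : dehnOne (cyclicRelators φ) x ≤ x := by
  refine iSup_le fun W => iSup_le fun hW => iSup_le fun hx => ?_
  rw [← relatorClosure_cyclicRelators] at hW
  obtain ⟨Δ, hΔ, hE⟩ := exists_diagram φ hW
  exact (iInf₂_le Δ hΔ).trans (by exact_mod_cast hE.trans hx)

end CyclicallyReducedRelators

/-! ## Cyclically reduced words form a regular language -/

section Regular

variable (α : Type)

open Classical in
/-- The automaton that recognizes the nonempty cyclically reduced words: it records the first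
letter, the last letter, and whether the word is reduced. -/
noncomputable def cyclicReductionDFA : DFA (α × Bool) (Option ((α × Bool) × (α × Bool) × Bool)) where
  step
    | none, x => some (x, x, true)
    | some (f, l, ok), x => some (f, x, ok && decide (l.1 = x.1 → l.2 = x.2))
  start := none
  accept := {s | ∃ f l, s = some (f, l, true) ∧ (l.1 = f.1 → l.2 = f.2)}

variable {α}

open Classical in
theorem eval_cyclicReductionDFA (x : α × Bool) (w : GroupWord α) :
    (cyclicReductionDFA α).eval (x :: w) =
      some (x, w.getLast?.getD x, decide (FreeGroup.IsReduced (x :: w))) := by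
  induction w using List.reverseRecOn with
  | nil => simp [cyclicReductionDFA, DFA.eval, DFA.evalFrom]
  | append_singleton w y ih =>
    have h : FreeGroup.IsReduced (x :: (w ++ [y])) ↔ FreeGroup.IsReduced (x :: w) ∧
        ((w.getLast?.getD x).1 = y.1 → (w.getLast?.getD x).2 = y.2) := by
      rw [FreeGroup.IsReduced, FreeGroup.IsReduced, ← List.cons_append, List.isChain_append,
        List.getLast?_cons]
      simp
    refine (DFA.eval_append_singleton _ (x :: w) y).trans ?_
    rw [ih, List.getLast?_concat]
    simp only [h, Bool.decide_and]
    rfl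

theorem eval_mem_accept_iff (w : GroupWord α) :
    (cyclicReductionDFA α).eval w ∈ (cyclicReductionDFA α).accept ↔
      w ≠ [] ∧ FreeGroup.IsCyclicallyReduced w := by
  obtain _ | ⟨x, w⟩ := w
  · simp [cyclicReductionDFA, DFA.eval, DFA.evalFrom]
  · rw [eval_cyclicReductionDFA, FreeGroup.isCyclicallyReduced_iff, List.getLast?_cons]
    constructor
    · rintro ⟨f, l, h, hfl⟩
      simp only [Option.some.injEq, Prod.mk.injEq, decide_eq_true_eq] at h
      obtain ⟨rfl, rfl, h⟩ := h
      exact ⟨by simp, h, by simpa using hfl⟩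
    · rintro ⟨-, h, hfl⟩
      exact ⟨x, _, by simp [h], hfl _ rfl _ rfl⟩

end Regular

/-! ## Languages over the empty alphabet -/

section IsEmpty

variable {α : Type} [IsEmpty α]

/-- The machine that halts at once and accepts iff `p` holds. -/
abbrev constMachine (α : Type) [IsEmpty α] (p : Prop) : StackMachine α where
  K := Unit
  Γ _ := Unit
  Λ := Unit
  σ := Unit
  inputStack := ()
  inputSymbol := Function.Embedding.ofIsEmpty
  main := ()
  start := ()
  program _ := [.halt]
  acceptStates := {_s | p}

open StackMachine

theorem detRun_constMachine (p : Prop) (w : List α) :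
    (constMachine α p).DetRun 0 1 ((constMachine α p).initial w) ⟨none, (), fun _ => []⟩ := by
  obtain rfl : w = [] := List.eq_nil_iff_forall_not_mem.2 fun x _ => isEmptyElim x
  refine .step (q := .halt) rfl (space_initial _).le ?_
  simp only [Turing.TM2.stepAux]
  convert StackMachine.DetRun.refl _
  simp

theorem accepts_constMachine_iff {L : Set (List α)} (w : List α) :
    w ∈ L ↔ (constMachine α ([] ∈ L)).Accepts w := by
  obtain rfl : w = [] := List.eq_nil_iff_forall_not_mem.2 fun x _ => isEmptyElim x
  rw [accepts_iff_acceptsFrom, (detRun_constMachine _ _).acceptsFrom_iff,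
    Halted.acceptsFrom_iff (M := constMachine α ([] ∈ L)) (c := ⟨none, (), fun _ => []⟩) rfl]
  exact Iff.rfl

theorem InNP.of_isEmpty (L : Set (List α)) : InNP L := by
  refine ⟨constMachine α ([] ∈ L), 1, accepts_constMachine_iff, fun w hw => ?_⟩
  obtain rfl : w = [] := List.eq_nil_iff_forall_not_mem.2 fun x _ => isEmptyElim x
  exact ⟨1, by simp, _, (detRun_constMachine _ _).reachesIn, rfl, hw⟩

theorem InPSPACE.of_isEmpty (L : Set (List α)) : InPSPACE L := by
  refine ⟨constMachine α ([] ∈ L), 0, fun _ => ⟨_, rfl⟩,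
    fun w => ⟨_, (detRun_constMachine _ w).reaches, rfl⟩, fun w c hc => ?_, accepts_constMachine_iff⟩
  obtain h | h := (detRun_constMachine _ w).space_le_or_reaches hc
  · exact h.trans (Nat.zero_le _)
  · rw [Halted.eq_of_reaches (M := constMachine α ([] ∈ L)) (c := ⟨none, (), fun _ => []⟩) rfl h]
    simp [space]

end IsEmpty

/-! ## The main theorem -/

theorem InNP.cyclicRelators {α : Type} [Fintype α] [Nonempty α] {G : Type*} [Group G]
    {φ : FreeGroup α →* G} (h : InNP {w : GroupWord α | φ (.mk w) = 1}) :
    InNP (cyclicRelators φ) := by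
  have : Inhabited (α × Bool) := ⟨(Classical.arbitrary α, true)⟩
  have h := h.inter_accepts (cyclicReductionDFA α)
  simp only [eval_mem_accept_iff] at h
  exact h

theorem InPSPACE.cyclicRelators {α : Type} [Fintype α] [Nonempty α] {G : Type*} [Group G]
    {φ : FreeGroup α →* G} (h : InPSPACE {w : GroupWord α | φ (.mk w) = 1}) :
    InPSPACE (cyclicRelators φ) := by
  have : Inhabited (α × Bool) := ⟨(Classical.arbitrary α, true)⟩
  have h := h.inter_accepts (cyclicReductionDFA α)
  simp only [eval_mem_accept_iff] at h
  exact h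

theorem isPresentation_cyclicRelators {α : Type} {G : Type*} [Group G] {a : α → G}
    (ha : Subgroup.closure (Set.range a) = ⊤) :
    IsPresentation a (cyclicRelators (FreeGroup.lift a)) :=
  ⟨fun _ hr => hr.2.1, fun _ hr => hr.2.2, ha, relatorClosure_cyclicRelators _⟩

theorem polynomiallyBounded_dehnOne_cyclicRelators {α : Type} {G : Type*} [Group G]
    (φ : FreeGroup α →* G) : PolynomiallyBounded (dehnOne (cyclicRelators φ)) :=
  ⟨Polynomial.X, fun x _ => by simpa using dehnOne_cyclicRelators_le φ x⟩

/-- If all diagrams for `W` had more than `n` edges, the infimum would be at least `n + 1`; this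
includes the case of no diagram, where it is `⊤`. -/
theorem exists_diagram_of_dehnOne_le {α : Type} {R : Set (GroupWord α)} {W : GroupWord α} {n x : ℕ}
    (hW : FreeGroup.mk W ∈ relatorClosure R) (hx : W.length ≤ x) (h : dehnOne R x ≤ n) :
    ∃ Δ : VanKampenDiagram R, Δ.boundaryLabel = W ∧ Δ.numEdges ≤ n := by
  by_contra! hΔ
  have h1 : (n + 1 : ℕ) ≤ minEdges R W := le_iInf₂ fun Δ hW => by exact_mod_cast hΔ Δ hW
  have h2 : minEdges R W ≤ dehnOne R x := le_iSup₂_of_le W hW (le_iSup_of_le hx le_rfl)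
  have h3 := (h1.trans h2).trans h
  rw [Nat.cast_le] at h3
  omega

theorem IsPresentation.exists_products {α : Type} {G : Type*} [Group G] {a : α → G}
    {R : Set (GroupWord α)} (hR : IsPresentation a R) (hd : PolynomiallyBounded (dehnOne R)) :
    (∀ r ∈ R, FreeGroup.lift a (.mk r) = 1) ∧ ∃ b, PolyBdd b ∧
      ∀ W : GroupWord α, FreeGroup.lift a (.mk W) = 1 →
      ∃ cs : List (GroupWord α × GroupWord α × Bool), cs.length ≤ b W.length ∧
      (∀ c ∈ cs, c.1.length ≤ b W.length ∧ c.2.1.length ≤ b W.length ∧ c.2.1 ∈ R) ∧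
      (cs.map fun c => FreeGroup.mk (StackMachine.Guess.conjWord c.1 c.2.1 c.2.2)).prod =
        FreeGroup.mk W := by
  obtain ⟨p, hp⟩ := hd
  -- The bound on the Dehn function is available only for positive arguments, so it is used at `n +
  -- 1` to cover the empty word.
  refine ⟨fun r hr => ?_, fun n => 4 * p.eval (n + 1),
    (PolyBdd.const 4).mul (.eval_comp p (PolyBdd.id.add (.const 1))), fun W hW => ?_⟩
  · rw [← MonoidHom.mem_ker, hR.ker_eq]
    exact Subgroup.subset_normalClosure ⟨r, hr, rfl⟩
  · rw [← MonoidHom.mem_ker, hR.ker_eq] at hW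
    obtain ⟨Δ, rfl, hE⟩ := exists_diagram_of_dehnOne_le hW (Nat.le_succ _) (hp _ (Nat.succ_pos _))
    obtain ⟨cs, h1, h2, h3⟩ := Δ.exists_products hR.nonempty
    have hE' := Nat.mul_le_mul_left 4 hE
    exact ⟨cs, h1.trans hE', fun c hc => ⟨(h2 c hc).1.trans hE', (h2 c hc).2.1.trans hE',
      (h2 c hc).2.2⟩, h3⟩

theorem theorem1p3 {G : Type*} [Group G] (m : ℕ) (a : Fin m → G)
    (ha : Subgroup.closure (Set.range a) = ⊤) :
    (InNP (wordProblem a) ↔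
      ∃ R : Set (GroupWord (Fin m)),
        IsPresentation a R ∧ PolynomiallyBounded (dehnOne R) ∧ InNP R) ∧
    (InPSPACE (wordProblem a) ↔
      ∃ R : Set (GroupWord (Fin m)),
        IsPresentation a R ∧ PolynomiallyBounded (dehnOne R) ∧ InPSPACE R) := by
  have hP := isPresentation_cyclicRelators ha
  have hD := polynomiallyBounded_dehnOne_cyclicRelators (FreeGroup.lift a)
  -- Without generators there is only the empty word and a machine can halt at once. The
  -- constructions for the other case need a letter, as a default value and as an alternative when a
  -- relator is guessed.
  cases isEmpty_or_nonempty (Fin m) with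
  | inl hm =>
    exact ⟨iff_of_true (.of_isEmpty _) ⟨_, hP, hD, .of_isEmpty _⟩,
      iff_of_true (.of_isEmpty _) ⟨_, hP, hD, .of_isEmpty _⟩⟩
  | inr hm =>
    refine ⟨⟨fun h => ⟨_, hP, hD, InNP.cyclicRelators h⟩, ?_⟩,
      ⟨fun h => ⟨_, hP, hD, InPSPACE.cyclicRelators h⟩, ?_⟩⟩
    · rintro ⟨R, hR, hd, h⟩
      obtain ⟨h1, b, hb, h2⟩ := hR.exists_products hd
      exact InNP.of_products h h1 hb h2
    · rintro ⟨R, hR, hd, h⟩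
      obtain ⟨h1, b, hb, h2⟩ := hR.exists_products hd
      exact InPSPACE.of_products h h1 hb h2
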